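/- Let $L$ be a finite relational language in which every relation symbol $E$ has arity at least $2$, and let $\overline\alpha:L\to(0,1]$ be a function such that, if all relation symbols of $L$ are binary, then $\overline\alpha(E)\neq 1$ for some $E\in L$. Let $K_L$ be the class of finite $L$-structures (including the empty one) in which each $E\in L$ is interpreted irreflexively (it holds only of tuples without repetitions) and symmetrically. For $\mathfrak A\in K_L$ put $\delta(\mathfrak A)=|A|-\sum_{E\in L}\overline\alpha(E)N_E(\mathfrak A)$, where $N_E(\mathfrak A)$ is the number of subsets of $A$ on which $E$ holds. Let $K_{\overline\alpha}$ be the class of $\mathfrak A\in K_L$ with $\delta(\mathfrak A')\ge 0$ for all $\mathfrak A'\subseteq\mathfrak A$, and $\overline{K_{\overline\alpha}}$ the class of $L$-structures all of whose finite substructures are in $K_{\overline\alpha}$. For $\mathfrak A\subseteq\mathfrak B$ in $K_L$ write $\mathfrak A\le\mathfrak B$ if $\delta(\mathfrak A)\le\delta(\mathfrak A')$ whenever $\mathfrak A\subseteq\mathfrak A'\subseteq\mathfrak B$; for a finite substructure $\mathfrak A$ of a structure $\mathfrak M\in\overline{K_{\overline\alpha}}$ write $\mathfrak A\le\mathfrak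 M$ if $\mathfrak A\le\mathfrak B$ for all finite $\mathfrak B$ with $\mathfrak A\subseteq\mathfrak B\subseteq\mathfrak M$. A pair $(\mathfrak B,\mathfrak C)$ with $\mathfrak B\subseteq\mathfrak C$ in $K_L$ is a minimal pair if $\mathfrak B\not\le\mathfrak C$ but $\mathfrak B\le\mathfrak D$ whenever $\mathfrak B\subseteq\mathfrak D\subsetneq\mathfrak C$. A countable structure $\mathfrak M\in\overline{K_{\overline\alpha}}$ is a generic structure for $(K_{\overline\alpha},\le)$ (a Baldwin--Shi hypergraph for $\overline\alpha$) if it is the union of a chain $\mathfrak A_0\le\mathfrak A_1\le\cdots$ with each $\mathfrak A_i\in K_{\overline\alpha}$, and if whenever $\mathfrak A\le\mathfrak B$ are in $K_{\overline\alpha}$ and $\mathfrak A\le\mathfrak M$ there is $\mathfrak B'\le\mathfrak M$ isomorphic to $\mathfrak B$ over $\mathfrak A$. Let $S_{\overline\alpha}$ be the set of first-order sentences expressing, of a structure $\mathfrak M$, that (i) $\mathfrak M\in\overline{K_{\overline\alpha}}$ and (ii) for all $\mathfrak A\le\mathfrak B$ from $K_{\overline\alpha}$, every embedding of $\mathfrak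 A$ into $\mathfrak M$ extends to an embedding of $\mathfrak B$ into $\mathfrak M$. Then: 1. $S_{\overline\alpha}$ is complete and is the theory of the $(K_{\overline\alpha},\le)$-generic. That is: $S_{\overline\alpha}$ is satisfiable and decides every $L$-sentence; a generic structure for $(K_{\overline\alpha},\le)$ exists; and for every generic structure $\mathfrak M$, an $L$-sentence is true in $\mathfrak M$ if and only if it is a consequence of $S_{\overline\alpha}$. 2. Let $\mathfrak M\models S_{\overline\alpha}$ and $X\subseteq M$. The following are equivalent: (a) $X$ is algebraically closed in $\mathfrak M$, i.e. every finite subset of $M$ that is definable with parameters from $X$ is contained in $X$; (b) for every minimal pair $(\mathfrak B,\mathfrak C)$ with $\mathfrak C\subseteq\mathfrak M$, if $B\subseteq X$ then $C\subseteq X$; (c) for every finite $B\subseteq M$, $B\cap X\le B$. -/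

import Mathlib

open FirstOrder

universe u v w w'

noncomputable section

namespace BaldwinShi

variable {L : FirstOrder.Language.{u, v}} {M : Type w} [L.Structure M]

/-- Every relation symbol is interpreted irreflexively (it only holds of tuples without
repetitions) and symmetrically. A finite `M` with this property is an element of `K_L`. -/
def IsHypergraph (L : FirstOrder.Language.{u, v}) (M : Type w) [L.Structure M] : Prop :=
  ∀ (n : ℕ) (E : L.Relations n) (x : Fin n → M), Language.Structure.RelMap E x →
    Function.Injective x ∧ ∀ π : Equiv.Perm (Fin n), Language.Structure.RelMap E (x ∘ π)

/-- The set of subsets of `A` on which the relation symbol `E` holds. -/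
def edges (E : Σ n, L.Relations n) (A : Set M) : Set (Set M) :=
  {s | s ⊆ A ∧ ∃ x : Fin E.1 → M, Language.Structure.RelMap E.2 x ∧ Set.range x = s}

variable [Fintype (Σ n, L.Relations n)]

/-- The rank `δ(A) = |A| - ∑_E α(E) N_E(A)` of a finite set `A ⊆ M`, regarded as an induced
substructure of `M`. -/
def delta (α : (Σ n, L.Relations n) → ℝ) (A : Set M) : ℝ :=
  (A.ncard : ℝ) - ∑ E : Σ n, L.Relations n, α E * ((edges E A).ncard : ℝ)

/-- The class of all structures whose finite substructures all lie in `K_α`. (In a relational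
language the finite substructures of `M` are exactly the finite subsets of `M`.) -/
def InKbar (α : (Σ n, L.Relations n) → ℝ) (M : Type w) [L.Structure M] : Prop :=
  IsHypergraph L M ∧ ∀ A : Set M, A.Finite → 0 ≤ delta α A

/-- The class `K_α` of finite structures all of whose substructures have nonnegative rank. -/
def InK (α : (Σ n, L.Relations n) → ℝ) (M : Type w) [L.Structure M] : Prop :=
  Finite M ∧ InKbar α M

/-- `A ≤ B` for finite subsets `A`, `B` of `M`, regarded as induced substructures. -/
def StrongIn (α : (Σ n, L.Relations n) → ℝ) (A B : Set M) : Prop :=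
  A ⊆ B ∧ ∀ C : Set M, A ⊆ C → C ⊆ B → delta α A ≤ delta α C

/-- `A ≤ M` for a finite subset `A` of a structure `M` of any cardinality. -/
def Strong (α : (Σ n, L.Relations n) → ℝ) (A : Set M) : Prop :=
  ∀ B : Set M, B.Finite → A ⊆ B → StrongIn α A B

/-- `(A, B)` is a minimal pair, for finite subsets `A`, `B` of `M`. -/
def MinimalPair (α : (Σ n, L.Relations n) → ℝ) (A B : Set M) : Prop :=
  A ⊆ B ∧ (∀ C : Set M, A ⊆ C → C ⊂ B → StrongIn α A C) ∧ ¬ StrongIn α A B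

/-- `M` is a generic structure for `(K_α, ≤)`. In the second clause, an isomorphic copy of `A`
that is strong in `M` is given by its embedding `f`, and the strong substructure of `M` that is
isomorphic to `B` over it is the range of `g`. -/
def IsGeneric (α : (Σ n, L.Relations n) → ℝ) (M : Type w) [L.Structure M] : Prop :=
  Countable M ∧ InKbar α M ∧
  (∃ A : ℕ → Set M, (∀ i, (A i).Finite) ∧ (∀ i, StrongIn α (A i) (A (i + 1))) ∧
    ⋃ i, A i = Set.univ) ∧
  ∀ (B : Type) [L.Structure B] (A : L.Substructure B), InK α B →
    StrongIn α (A : Set B) Set.univ →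
    ∀ f : A ↪[L] M, Strong α (Set.range f) →
      ∃ g : B ↪[L] M, Strong α (Set.range g) ∧ ∀ a : A, g a = f a

open Classical in
/-- The quantifier-free type (atomic diagram) of the tuple `v` of elements of `B`. -/
def atomicDiagram {ι : Type} [Finite ι] {B : Type} [L.Structure B] (v : ι → B) : L.Formula ι :=
  Language.Formula.iInf (fun p : ι × ι =>
    if v p.1 = v p.2 then Language.Term.equal (Language.Term.var p.1) (Language.Term.var p.2)
    else (Language.Term.equal (Language.Term.var p.1) (Language.Term.var p.2)).not) ⊓
  Language.Formula.iInf (fun E : Σ n, L.Relations n => Language.Formula.iInf (fun t : Fin E.1 → ι =>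
    if Language.Structure.RelMap E.2 (v ∘ t) then E.2.formula (fun i => Language.Term.var (t i))
    else (E.2.formula (fun i => Language.Term.var (t i))).not))

/-- The sentence `∀ x, ¬ Δ_B(x)`: no substructure is isomorphic to `B`. -/
def omitSentence (L : FirstOrder.Language.{u, v}) [Fintype (Σ n, L.Relations n)]
    (B : Type) [Finite B] [L.Structure B] : L.Sentence :=
  Language.Formula.iAlls B
    (Language.Formula.relabel Sum.inr (atomicDiagram (id : B → B)).not : L.Formula (Empty ⊕ B))

/-- The sentence `∀ x, Δ_A(x) → ∃ y, Δ_{A,B}(x, y)`, where `x` enumerates `A` and `y` enumerates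
the complement of `A` in `B`. -/
def extensionSentence {B : Type} [Finite B] [L.Structure B] (A : L.Substructure B) :
    L.Sentence :=
  Language.Formula.iAlls A (Language.Formula.relabel Sum.inr
    ((atomicDiagram (fun a : A => (a : B))).imp
      (Language.Formula.iExs {b : B // b ∉ A}
        (atomicDiagram (Sum.elim (fun a : A => (a : B))
          (fun b : {b : B // b ∉ A} => (b : B)))))) : L.Formula (Empty ⊕ A))

/-- The theory `S_α`: its models are the structures `M` such that every finite substructure of `M`
is in `K_α`, and, for all `A ≤ B` from `K_α`, every embedding of `A` into `M` extends to an
embedding of `B` into `M`. Finite structures are taken, up to isomorphism, on the sets `Fin n`. -/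
def theoryS (α : (Σ n, L.Relations n) → ℝ) : L.Theory :=
  {φ | ∃ (n : ℕ) (_ : L.Structure (Fin n)), ¬ InK α (Fin n) ∧ φ = omitSentence L (Fin n)} ∪
  {φ | ∃ (n : ℕ) (_ : L.Structure (Fin n)) (A : L.Substructure (Fin n)), InK α (Fin n) ∧
    StrongIn α (A : Set (Fin n)) Set.univ ∧ φ = extensionSentence A}

/-- `X` is algebraically closed in `M`: every finite subset of `M` that is definable with
parameters from `X` is contained in `X`. -/
def IsAlgClosedSet (L : FirstOrder.Language.{u, v}) {M : Type w} [L.Structure M] (X : Set M) : Prop :=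
  ∀ S : Set M, X.Definable₁ L S → S.Finite → S ⊆ X

end BaldwinShi

end

open BaldwinShi

/-!
The rank `δ` is submodular, and it is modular on free amalgams (`IsFreeAmalgam`). Hence, if
`A ≤ B`, then `B` can be amalgamated freely over `A` with any structure, which is strong in the
amalgam.

*Completeness.* Call a finite subset of a structure `m`-strong if no extension of it by at most `m`
points has smaller rank. The sentences of `S_α` only provide embeddings of `B` over `A`, without
control of the position of the image. Nevertheless, for `A ≤ B`, an embedding of `A` with
sufficiently strong image extends to one of `B` with `m`-strong image (`exists_extension_mStrong`).
The reason is that one may embed a larger structure: `B` with a gadget attached to one of its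
points (`exists_gadget`). The gadget is chosen so that it uses up, with an error less than the gap
`ε`, the rank of `B` over `A`, but so that no small part of it lowers the rank. Here `-ε` is the
largest negative rank of an extension by at most `m` points (`exists_gap`). A small extension of
the image of `B` of lower rank would lower the rank by `ε`, and, together with the gadget, would
have lower rank than `A`, although it is a bounded extension of `A`. Gadgets are wedges of cycles
that carry edges of total weight slightly above their length, spread out evenly
(`exists_cyclic_hypergraph`, `charging`).

Isomorphisms between sufficiently strong finite subsets of two models of `S_α` therefore satisfy
the back-and-forth property; the loss of strength at each step is bounded in terms of the number of
quantifiers still to be treated (`realize_iff_of_mStrong`). As the empty set is strong, any two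
models are elementarily equivalent.

*The generic structure.* It is the union of a chain of finite structures on sets of natural numbers
that meets countably many cofinal sets, one for each extension problem (`exists_isGeneric`). In a
generic structure, free amalgamation with a member of the chain yields the sentences of `S_α`
(`IsGeneric.models`).

*Algebraic closure.* A minimal pair `(B, C)` has finitely many copies over `B`, as each new copy
lowers the rank of their union by at least `δ(B) - δ(C) > 0`; so algebraically closed sets are
closed under minimal pairs (`IsAlgClosedSet.minimalPair_closed`). Conversely, suppose that
`B ∩ X ≤ B` for all finite `B`, and let `a ∉ X`. There is a sufficiently strong `B` containing `a`
and given parameters from `X`, such that `B ∩ X` is as strong as required in terms of the size of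
`B \ X`. Then `B` has a sufficiently strong copy over `B ∩ X` that is disjoint from any given
finite set outside `B ∩ X`. By the back-and-forth property the copy of `a` satisfies the same
formula, so that `a` lies in no finite set definable over `X` (`isAlgClosedSet_of_closed`).
-/

noncomputable section

namespace BaldwinShi

open Language.Structure

/-! ### Partial embeddings and the rank -/

section Rank

variable {L : FirstOrder.Language.{u, v}} {M : Type w} [L.Structure M] {N : Type w'} [L.Structure N]

/-- `f` restricts to an isomorphism from the substructure on `A` to the substructure on `f '' A`.
The values of `f` outside `A` are irrelevant. -/
def PEmb (L : FirstOrder.Language.{u, v}) {M : Type w} [L.Structure M] {N : Type w'}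
    [L.Structure N] (f : M → N) (A : Set M) : Prop :=
  Set.InjOn f A ∧ ∀ (n : ℕ) (E : L.Relations n) (x : Fin n → M), (∀ i, x i ∈ A) →
    (RelMap E (f ∘ x) ↔ RelMap E x)

theorem PEmb.mono {f : M → N} {A B : Set M} (h : PEmb L f B) (hAB : A ⊆ B) : PEmb L f A :=
  ⟨h.1.mono hAB, fun n E x hx => h.2 n E x fun i => hAB (hx i)⟩

theorem PEmb.comp {P : Type*} [L.Structure P] {f : M → N} {g : N → P} {A : Set M}
    (hg : PEmb L g (f '' A)) (hf : PEmb L f A) : PEmb L (g ∘ f) A :=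
  ⟨hg.1.comp hf.1 (Set.mapsTo_image f A), fun n E x hx => by
    rw [← hf.2 n E x hx, ← hg.2 n E (f ∘ x) fun i => ⟨x i, hx i, rfl⟩]
    rfl⟩

theorem PEmb.congr {f g : M → N} {A : Set M} (hf : PEmb L f A) (h : Set.EqOn f g A) :
    PEmb L g A :=
  ⟨hf.1.congr h, fun n E x hx => by
    rw [← hf.2 n E x hx]
    have : g ∘ x = f ∘ x := funext fun i => (h (hx i)).symm
    rw [this]⟩

theorem PEmb.id (A : Set M) : PEmb L (id : M → M) A :=
  ⟨Function.injective_id.injOn, fun _ _ _ _ => Iff.rfl⟩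

theorem PEmb.of_embedding (f : M ↪[L] N) (A : Set M) : PEmb L f A :=
  ⟨f.injective.injOn, fun _ E x _ => f.map_rel E x⟩

theorem PEmb.of_comp {P : Type*} [L.Structure P] {f : M → N} {g : N → P} {A : Set M}
    (hf : PEmb L f A) (h : PEmb L (g ∘ f) A) : PEmb L g (f '' A) := by
  refine ⟨?_, fun n E x hx => ?_⟩
  · rintro _ ⟨x, hx, rfl⟩ _ ⟨y, hy, rfl⟩ hxy
    rw [h.1 hx hy hxy]
  · choose y hy hyx using hx
    rw [show x = f ∘ y from funext fun i => (hyx i).symm, hf.2 n E y hy]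
    exact h.2 n E y hy

/-- A left inverse of a partial embedding is a partial embedding of the image. -/
theorem PEmb.leftInv {f : M → N} {g : N → M} {A : Set M} (hf : PEmb L f A)
    (h : Set.LeftInvOn g f A) : PEmb L g (f '' A) :=
  hf.of_comp ((PEmb.id A).congr fun _ hx => (h hx).symm)

theorem edges_finite (E : Σ n, L.Relations n) {A : Set M} (hA : A.Finite) : (edges E A).Finite :=
  hA.finite_subsets.subset fun _ h => h.1

theorem edges_mono (E : Σ n, L.Relations n) {A B : Set M} (h : A ⊆ B) : edges E A ⊆ edges E B :=
  fun _ hs => ⟨hs.1.trans h, hs.2⟩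

theorem edges_inter (E : Σ n, L.Relations n) (A B : Set M) :
    edges E (A ∩ B) = edges E A ∩ edges E B := by
  ext s
  simp only [edges, Set.subset_inter_iff, Set.mem_ofPred_eq, Set.mem_inter_iff]
  tauto

theorem edges_image {f : M → N} {A : Set M} (hf : PEmb L f A) (E : Σ n, L.Relations n) :
    edges E (f '' A) = Set.image f '' edges E A := by
  ext s
  constructor
  · rintro ⟨hs, x, hx, rfl⟩
    have : ∀ i, ∃ y ∈ A, f y = x i := fun i => hs ⟨i, rfl⟩
    choose y hy hyx using this
    have hx' : x = f ∘ y := funext fun i => (hyx i).symm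
    refine ⟨Set.range y, ⟨by rintro _ ⟨i, rfl⟩; exact hy i, y, ?_, rfl⟩, ?_⟩
    · rw [← hf.2 _ _ y hy, ← hx']
      exact hx
    · rw [hx', Set.range_comp]
  · rintro ⟨_, ⟨hs, x, hx, rfl⟩, rfl⟩
    refine ⟨Set.image_mono hs, f ∘ x, ?_, Set.range_comp f x⟩
    exact (hf.2 _ _ x fun i => hs ⟨i, rfl⟩).2 hx

theorem edges_image_ncard {f : M → N} {A : Set M} (hf : PEmb L f A) (E : Σ n, L.Relations n) :
    (edges E (f '' A)).ncard = (edges E A).ncard := by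
  rw [edges_image hf]
  refine Set.InjOn.ncard_image ?_
  intro s hs t ht h
  exact (hf.1.image_eq_image_iff hs.1 ht.1).1 h

theorem IsHypergraph.edges_ncard_eq (h : IsHypergraph L M) {E : Σ n, L.Relations n} {A s : Set M}
    (hs : s ∈ edges E A) : s.ncard = E.1 := by
  obtain ⟨-, x, hx, rfl⟩ := hs
  rw [← Set.image_univ, Set.ncard_image_of_injective _ (h _ _ _ hx).1]
  simp

variable [Fintype (Σ n, L.Relations n)] {α : (Σ n, L.Relations n) → ℝ}

theorem delta_image {f : M → N} {A : Set M} (hf : PEmb L f A) : delta α (f '' A) = delta α A := by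
  unfold delta
  rw [hf.1.ncard_image]
  simp only [edges_image_ncard hf]

/-- The rank is submodular. -/
theorem delta_union_add_inter_le (hα : ∀ E, 0 ≤ α E) {A B : Set M} (hA : A.Finite)
    (hB : B.Finite) : delta α (A ∪ B) + delta α (A ∩ B) ≤ delta α A + delta α B := by
  unfold delta
  have h1 : ((A ∪ B).ncard : ℝ) + (A ∩ B).ncard = A.ncard + B.ncard := by
    exact_mod_cast Set.ncard_union_add_ncard_inter A B hA hB
  have h2 : ∀ E, α E * ((edges E A).ncard : ℝ) + α E * (edges E B).ncard ≤
      α E * (edges E (A ∪ B)).ncard + α E * (edges E (A ∩ B)).ncard := fun E => by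
    rw [← mul_add, ← mul_add]
    refine mul_le_mul_of_nonneg_left ?_ (hα E)
    have h3 := Set.ncard_union_add_ncard_inter (edges E A) (edges E B) (edges_finite E hA)
      (edges_finite E hB)
    have h4 : (edges E A ∪ edges E B).ncard ≤ (edges E (A ∪ B)).ncard :=
      Set.ncard_le_ncard (Set.union_subset (edges_mono E Set.subset_union_left)
        (edges_mono E Set.subset_union_right)) (edges_finite E (hA.union hB))
    rw [← edges_inter] at h3
    exact_mod_cast (by omega : (edges E A).ncard + (edges E B).ncard ≤
      (edges E (A ∪ B)).ncard + (edges E (A ∩ B)).ncard)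
  have h5 := Finset.sum_le_sum fun E (_ : E ∈ Finset.univ) => h2 E
  rw [Finset.sum_add_distrib, Finset.sum_add_distrib] at h5
  linarith

/-- Rank differences are integers minus sums of weights. -/
theorem delta_sub_eq {A B : Set M} (hB : B.Finite) (hAB : A ⊆ B) :
    ∃ s : Multiset (Σ n, L.Relations n),
      delta α B - delta α A = ((B \ A).ncard : ℝ) - (s.map α).sum := by
  refine ⟨∑ E, (edges E B \ edges E A).ncard • {E}, ?_⟩
  have h1 : (((∑ E, (edges E B \ edges E A).ncard • ({E} : Multiset (Σ n, L.Relations n)))).map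
      α).sum = ∑ E, α E * ((edges E B \ edges E A).ncard : ℝ) := by
    have := map_sum (Multiset.sumAddMonoidHom.comp (Multiset.mapAddMonoidHom α))
      (fun E => (edges E B \ edges E A).ncard • ({E} : Multiset (Σ n, L.Relations n))) Finset.univ
    simp only [AddMonoidHom.coe_comp, Function.comp_apply, Multiset.coe_mapAddMonoidHom,
      Multiset.coe_sumAddMonoidHom] at this
    rw [this]
    refine Finset.sum_congr rfl fun E _ => ?_
    rw [Multiset.map_nsmul, Multiset.sum_nsmul, Multiset.map_singleton, Multiset.sum_singleton,
      nsmul_eq_mul, mul_comm]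
  rw [h1]
  unfold delta
  have h2 : ((B \ A).ncard : ℝ) = B.ncard - A.ncard := by
    rw [eq_sub_iff_add_eq]
    exact_mod_cast Set.ncard_sdiff_add_ncard_of_subset hAB hB
  have h3 : ∀ E : Σ n, L.Relations n,
      ((edges E B \ edges E A).ncard : ℝ) = (edges E B).ncard - (edges E A).ncard := fun E => by
      rw [eq_sub_iff_add_eq]
      exact_mod_cast Set.ncard_sdiff_add_ncard_of_subset (edges_mono E hAB) (edges_finite E hB)
  simp only [h2, h3, mul_sub, Finset.sum_sub_distrib]
  ring

theorem delta_empty (har : ∀ E : Σ n, L.Relations n, 2 ≤ E.1) :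
    delta α (∅ : Set M) = 0 := by
  have : ∀ E, edges E (∅ : Set M) = ∅ := fun E => by
    ext s
    simp only [edges, Set.mem_ofPred_eq, Set.mem_empty_iff_false, iff_false]
    rintro ⟨hs, x, -, rfl⟩
    exact hs ⟨⟨0, by have := har E; omega⟩, rfl⟩
  simp [delta, this]

theorem IsHypergraph.delta_singleton (h : IsHypergraph L M)
    (har : ∀ E : Σ n, L.Relations n, 2 ≤ E.1) (a : M) : delta α ({a} : Set M) = 1 := by
  have : ∀ E, edges E ({a} : Set M) = ∅ := fun E => by
    ext s
    simp only [Set.mem_empty_iff_false, iff_false]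
    intro hs
    have h1 := h.edges_ncard_eq hs
    have h2 := Set.ncard_le_ncard hs.1
    rw [Set.ncard_singleton] at h2
    have := har E
    omega
  simp [delta, this]

theorem delta_insert_le (hα : ∀ E, 0 ≤ α E) {A : Set M} (hA : A.Finite) (a : M) :
    delta α (insert a A) ≤ delta α A + 1 := by
  by_cases ha : a ∈ A
  · rw [Set.insert_eq_of_mem ha]
    linarith
  · obtain ⟨s, hs⟩ := delta_sub_eq (α := α) (hA.insert a) (Set.subset_insert a A)
    have h1 : (insert a A \ A) = {a} := by
      ext y
      simp only [Set.mem_sdiff, Set.mem_insert_iff, Set.mem_singleton_iff]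
      constructor
      · rintro ⟨rfl | h, h'⟩
        · rfl
        · exact absurd h h'
      · rintro rfl
        exact ⟨Or.inl rfl, ha⟩
    have h2 : 0 ≤ (s.map α).sum := Multiset.sum_nonneg fun x hx => by
      obtain ⟨E, -, rfl⟩ := Multiset.mem_map.1 hx
      exact hα E
    rw [h1, Set.ncard_singleton] at hs
    push_cast at hs
    linarith

/-- If `A ≤ B` then `A ∩ F ≤ F` for every `F ⊆ B`. -/
theorem StrongIn.inter_le (hα : ∀ E, 0 ≤ α E) {A B F : Set M} (h : StrongIn α A B)
    (hB : B.Finite) (hF : F ⊆ B) : delta α (A ∩ F) ≤ delta α F := by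
  have h1 := delta_union_add_inter_le hα (hB.subset h.1) (hB.subset hF)
  have h2 := h.2 (A ∪ F) Set.subset_union_left (Set.union_subset h.1 hF)
  linarith

theorem StrongIn.trans (hα : ∀ E, 0 ≤ α E) {A B C : Set M} (hAB : StrongIn α A B)
    (hBC : StrongIn α B C) (hC : C.Finite) : StrongIn α A C := by
  refine ⟨hAB.1.trans hBC.1, fun F hAF hFC => ?_⟩
  have h1 := hBC.inter_le hα hC hFC
  have h2 := hAB.2 (B ∩ F) (Set.subset_inter hAB.1 hAF) Set.inter_subset_left
  linarith

theorem StrongIn.mono {A B C : Set M} (h : StrongIn α A C) (hAB : A ⊆ B) (hBC : B ⊆ C) :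
    StrongIn α A B :=
  ⟨hAB, fun F hAF hFB => h.2 F hAF (hFB.trans hBC)⟩

theorem StrongIn.refl (A : Set M) : StrongIn α A A :=
  ⟨subset_rfl, fun _ h1 h2 => by rw [Set.Subset.antisymm h1 h2]⟩

theorem StrongIn.image {f : M → N} {A B : Set M} (h : StrongIn α A B) (hf : PEmb L f B) :
    StrongIn α (f '' A) (f '' B) := by
  refine ⟨Set.image_mono h.1, fun C hAC hCB => ?_⟩
  obtain ⟨D, hD, rfl⟩ := Set.subset_image_iff.1 hCB
  rw [delta_image (hf.mono h.1), delta_image (hf.mono hD)]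
  exact h.2 D ((hf.1.image_subset_image_iff h.1 hD).1 hAC) hD

/-- All subsets of an extension of `A` in which `A` is strong have nonnegative rank if those of
`A` do. -/
theorem StrongIn.delta_nonneg (hα : ∀ E, 0 ≤ α E) {A B : Set M} (h : StrongIn α A B)
    (hB : B.Finite) (hA : ∀ F ⊆ A, 0 ≤ delta α F) : ∀ F ⊆ B, 0 ≤ delta α F :=
  fun _ hF => (hA _ Set.inter_subset_left).trans (h.inter_le hα hB hF)

end Rank

/-! ### Free amalgams -/

section Amalgam

/-- An `L`-structure in a relational language, given by its relations. -/
@[reducible] def mkStr {L : FirstOrder.Language.{u, v}} [L.IsRelational] {D : Type w}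
    (R : (E : Σ n, L.Relations n) → (Fin E.1 → D) → Prop) : L.Structure D where
  funMap := fun f => isEmptyElim f
  RelMap := fun {n} E x => R ⟨n, E⟩ x

/-- `D`, with the embeddings `i` and `j`, is the free amalgam of `M₁` and `M₂` over the
substructure on `A ⊆ M₂`, which is embedded in `M₁` by `f`, except that `D` may have further
elements, which lie on no edge. -/
structure IsFreeAmalgam {L : FirstOrder.Language.{u, v}} {M₁ : Type w} [L.Structure M₁]
    {M₂ : Type w'} [L.Structure M₂] {D : Type*} [L.Structure D] (f : M₂ → M₁) (A : Set M₂)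
    (i : M₁ → D) (j : M₂ → D) : Prop where
  hypergraph : IsHypergraph L D
  left : PEmb L i Set.univ
  right : PEmb L j Set.univ
  eqOn : ∀ a ∈ A, j a = i (f a)
  mem_of_eq : ∀ x y, i x = j y → y ∈ A ∧ x = f y
  relMap : ∀ (n : ℕ) (E : L.Relations n) (x : Fin n → D), RelMap E x →
    (∃ y, x = i ∘ y ∧ RelMap E y) ∨ ∃ y, x = j ∘ y ∧ RelMap E y

/-- Free amalgams exist. The disjoint union is used as the universe, so that the copy of `A` in
`M₂` is left over as a set of isolated points. -/
theorem exists_isFreeAmalgam {L : FirstOrder.Language.{u, v}} [L.IsRelational] {M₁ : Type w}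
    [L.Structure M₁] {M₂ : Type w'} [L.Structure M₂] (h₁ : IsHypergraph L M₁)
    (h₂ : IsHypergraph L M₂) {f : M₂ → M₁} {A : Set M₂} (hf : PEmb L f A) :
    ∃ (_ : L.Structure (M₁ ⊕ M₂)) (i : M₁ → M₁ ⊕ M₂) (j : M₂ → M₁ ⊕ M₂),
      IsFreeAmalgam (L := L) f A i j := by
  classical
  let i : M₁ → M₁ ⊕ M₂ := Sum.inl
  let j : M₂ → M₁ ⊕ M₂ := fun x => if x ∈ A then Sum.inl (f x) else Sum.inr x
  have hi : Function.Injective i := Sum.inl_injective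
  have hij : ∀ x y, i x = j y → y ∈ A ∧ x = f y := fun x y h => by
    by_cases hy : y ∈ A
    · simp only [i, j, hy, if_true, Sum.inl.injEq] at h
      exact ⟨hy, h⟩
    · simp [i, j, hy] at h
  have hj : Function.Injective j := fun x y h => by
    by_cases hx : x ∈ A
    · have h' : i (f x) = j y := by rw [← h]; simp [i, j, hx]
      exact hf.1 hx (hij _ _ h').1 (hij _ _ h').2
    · by_cases hy : y ∈ A
      · simp [j, hx, hy] at h
      · simpa [j, hx, hy] using h
  let S : L.Structure (M₁ ⊕ M₂) := mkStr fun E x =>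
    (∃ y, x = i ∘ y ∧ RelMap E.2 y) ∨ ∃ y, x = j ∘ y ∧ RelMap E.2 y
  have hrel : ∀ (n : ℕ) (E : L.Relations n) (x : Fin n → M₁ ⊕ M₂), RelMap E x ↔
    (∃ y, x = i ∘ y ∧ RelMap E y) ∨ ∃ y, x = j ∘ y ∧ RelMap E y := fun _ _ _ => Iff.rfl
  refine ⟨S, i, j, ?_, ⟨hi.injOn, fun n E x _ => ?_⟩, ⟨hj.injOn, fun n E x _ => ?_⟩,
    fun a ha => by simp [i, j, ha], hij, fun n E x => (hrel n E x).1⟩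
  · rintro n E x (⟨y, rfl, hy⟩ | ⟨y, rfl, hy⟩)
    · exact ⟨hi.comp (h₁ n E y hy).1, fun π => Or.inl ⟨y ∘ π, rfl, (h₁ n E y hy).2 π⟩⟩
    · exact ⟨hj.comp (h₂ n E y hy).1, fun π => Or.inr ⟨y ∘ π, rfl, (h₂ n E y hy).2 π⟩⟩
  · rw [hrel]
    constructor
    · rintro (⟨y, hxy, hy⟩ | ⟨y, hxy, hy⟩)
      · rwa [hi.comp_left hxy]
      · have h := fun k => hij _ _ (congrFun hxy k)
        rwa [show x = f ∘ y from funext fun k => (h k).2, hf.2 n E y fun k => (h k).1]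
    · exact fun h => Or.inl ⟨x, rfl, h⟩
  · rw [hrel]
    constructor
    · rintro (⟨y, hxy, hy⟩ | ⟨y, hxy, hy⟩)
      · have h := fun k => hij _ _ (congrFun hxy k).symm
        rwa [show y = f ∘ x from funext fun k => (h k).2, hf.2 n E x fun k => (h k).1] at hy
      · rwa [hj.comp_left hxy]
    · exact fun h => Or.inr ⟨x, rfl, h⟩

namespace IsFreeAmalgam

variable {L : FirstOrder.Language.{u, v}} {M₁ : Type w} [L.Structure M₁]
  {M₂ : Type w'} [L.Structure M₂] {D : Type*} [L.Structure D] {f : M₂ → M₁} {A : Set M₂}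
  {i : M₁ → D} {j : M₂ → D}

theorem left_injective (h : IsFreeAmalgam (L := L) f A i j) : Function.Injective i :=
  fun _ _ hxy => h.left.1 trivial trivial hxy

theorem right_injective (h : IsFreeAmalgam (L := L) f A i j) : Function.Injective j :=
  fun _ _ hxy => h.right.1 trivial trivial hxy

theorem edges_eq (h : IsFreeAmalgam (L := L) f A i j) (E : Σ n, L.Relations n) (F : Set D) :
    edges E F = edges E (i '' (i ⁻¹' F)) ∪ edges E (j '' (j ⁻¹' F)) := by
  refine Set.Subset.antisymm ?_ (Set.union_subset (edges_mono E (Set.image_preimage_subset i F))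
    (edges_mono E (Set.image_preimage_subset j F)))
  rintro s ⟨hs, x, hx, rfl⟩
  rcases h.relMap _ _ x hx with ⟨y, rfl, -⟩ | ⟨y, rfl, -⟩
  · refine Or.inl ⟨?_, _, hx, rfl⟩
    rintro _ ⟨k, rfl⟩
    exact ⟨y k, hs ⟨k, rfl⟩, rfl⟩
  · refine Or.inr ⟨?_, _, hx, rfl⟩
    rintro _ ⟨k, rfl⟩
    exact ⟨y k, hs ⟨k, rfl⟩, rfl⟩

theorem image_inter_image (h : IsFreeAmalgam (L := L) f A i j) (F : Set D) :
    i '' (i ⁻¹' F) ∩ j '' (j ⁻¹' F) = j '' (j ⁻¹' F ∩ A) := by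
  ext x
  constructor
  · rintro ⟨⟨y, hy, rfl⟩, z, hz, hzy⟩
    exact ⟨z, ⟨hz, (h.mem_of_eq y z hzy.symm).1⟩, hzy⟩
  · rintro ⟨z, ⟨hz, hzA⟩, rfl⟩
    refine ⟨⟨f z, ?_, (h.eqOn z hzA).symm⟩, z, hz, rfl⟩
    rw [Set.mem_preimage, ← h.eqOn z hzA]
    exact hz

theorem preimage_left_subset (h : IsFreeAmalgam (L := L) f A i j) {G : Set D} {F : Set M₁}
    {T : Set M₂} (hF : ∀ a ∈ A, f a ∈ F) (hG : G ⊆ i '' F ∪ j '' T) : i ⁻¹' G ⊆ F := fun x hx => by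
  rcases hG hx with ⟨x', hx', he⟩ | ⟨y, -, he⟩
  · rwa [← h.left_injective he]
  · rw [(h.mem_of_eq x y he.symm).2]
    exact hF y (h.mem_of_eq x y he.symm).1

theorem preimage_right_subset (h : IsFreeAmalgam (L := L) f A i j) {G : Set D} {F : Set M₁}
    {T : Set M₂} (hT : A ⊆ T) (hG : G ⊆ i '' F ∪ j '' T) : j ⁻¹' G ⊆ T := fun y hy => by
  rcases hG hy with ⟨x, -, he⟩ | ⟨y', hy', he⟩
  · exact hT (h.mem_of_eq x y he).1
  · rwa [← h.right_injective he]

variable [Fintype (Σ n, L.Relations n)] {α : (Σ n, L.Relations n) → ℝ}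

/-- The rank is modular on free amalgams. -/
theorem delta_eq (h : IsFreeAmalgam (L := L) f A i j) {F : Set D} (hF : F.Finite)
    (hF' : F ⊆ Set.range i ∪ Set.range j) :
    delta α F = delta α (i ⁻¹' F) + delta α (j ⁻¹' F) - delta α (j ⁻¹' F ∩ A) := by
  rw [← delta_image (h.left.mono (Set.subset_univ (i ⁻¹' F))),
    ← delta_image (h.right.mono (Set.subset_univ (j ⁻¹' F))),
    ← delta_image (h.right.mono (Set.subset_univ (j ⁻¹' F ∩ A))), ← h.image_inter_image]
  have hfi : (i '' (i ⁻¹' F)).Finite := hF.subset (Set.image_preimage_subset i F)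
  have hfj : (j '' (j ⁻¹' F)).Finite := hF.subset (Set.image_preimage_subset j F)
  have hu : i '' (i ⁻¹' F) ∪ j '' (j ⁻¹' F) = F := by
    rw [Set.image_preimage_eq_inter_range, Set.image_preimage_eq_inter_range,
      ← Set.inter_union_distrib_left, Set.inter_eq_left.2 hF']
  unfold delta
  have h1 : (F.ncard : ℝ) + (i '' (i ⁻¹' F) ∩ j '' (j ⁻¹' F)).ncard =
      (i '' (i ⁻¹' F)).ncard + (j '' (j ⁻¹' F)).ncard := by
    have := Set.ncard_union_add_ncard_inter _ _ hfi hfj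
    rw [hu] at this
    exact_mod_cast this
  have h2 : ∀ E : Σ n, L.Relations n, α E * ((edges E F).ncard : ℝ) =
      α E * (edges E (i '' (i ⁻¹' F))).ncard + α E * (edges E (j '' (j ⁻¹' F))).ncard -
      α E * (edges E (i '' (i ⁻¹' F) ∩ j '' (j ⁻¹' F))).ncard := fun E => by
    have := Set.ncard_union_add_ncard_inter _ _ (edges_finite E hfi) (edges_finite E hfj)
    rw [← h.edges_eq, ← edges_inter] at this
    rw [← mul_add, ← mul_sub]
    congr 1
    rw [eq_sub_iff_add_eq]
    exact_mod_cast this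
  simp only [h2, Finset.sum_sub_distrib, Finset.sum_add_distrib]
  linarith

theorem delta_eq_of_subset (h : IsFreeAmalgam (L := L) f A i j) {G : Set D} {F : Set M₁}
    {T : Set M₂} (hF : F.Finite) (hT : T.Finite) (hG : G ⊆ i '' F ∪ j '' T) :
    delta α G = delta α (i ⁻¹' G) + delta α (j ⁻¹' G) - delta α (j ⁻¹' G ∩ A) :=
  h.delta_eq (((hF.image i).union (hT.image j)).subset hG)
    (hG.trans (Set.union_subset_union (Set.image_subset_range _ _) (Set.image_subset_range _ _)))

/-- If `A ≤ B` then `Q ≤ D`, where `D` is the amalgam of `Q` and `B` over `A`. -/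
theorem strongIn_left (h : IsFreeAmalgam (L := L) f A i j) {Q : Set M₁} {B : Set M₂}
    (hQ : Q.Finite) (hB : B.Finite) (hfQ : ∀ a ∈ A, f a ∈ Q) (hAB : StrongIn α A B) :
    StrongIn α (i '' Q) (i '' Q ∪ j '' B) := by
  refine ⟨Set.subset_union_left, fun G hQG hGD => ?_⟩
  have hAG : A ⊆ j ⁻¹' G := fun a ha => by
    rw [Set.mem_preimage, h.eqOn a ha]
    exact hQG ⟨f a, hfQ a ha, rfl⟩
  rw [h.delta_eq_of_subset hQ hB hGD, Set.inter_eq_right.2 hAG,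
    delta_image (h.left.mono (Set.subset_univ Q)),
    (h.preimage_left_subset hfQ hGD).antisymm (Set.image_subset_iff.1 hQG)]
  have := hAB.2 _ hAG (h.preimage_right_subset hAB.1 hGD)
  linarith

/-- If `f '' A ≤ Q` then `B ≤ D`, where `D` is the amalgam of `Q` and `B` over `A`. -/
theorem strongIn_right (h : IsFreeAmalgam (L := L) f A i j) {Q : Set M₁} {B : Set M₂}
    (hQ : Q.Finite) (hB : B.Finite) (hf : PEmb L f A) (hAB : A ⊆ B)
    (hAQ : StrongIn α (f '' A) Q) : StrongIn α (j '' B) (i '' Q ∪ j '' B) := by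
  refine ⟨Set.subset_union_right, fun G hBG hGD => ?_⟩
  have hBj : B ⊆ j ⁻¹' G := Set.image_subset_iff.1 hBG
  rw [h.delta_eq_of_subset hQ hB hGD, Set.inter_eq_right.2 (hAB.trans hBj),
    delta_image (h.right.mono (Set.subset_univ B)),
    (h.preimage_right_subset hAB hGD).antisymm hBj, ← delta_image hf]
  have := hAQ.2 (i ⁻¹' G) (by
    rintro _ ⟨a, ha, rfl⟩
    rw [Set.mem_preimage, ← h.eqOn a ha]
    exact hBG ⟨a, hAB ha, rfl⟩)
    (h.preimage_left_subset (fun a ha => hAQ.1 ⟨a, ha, rfl⟩) hGD)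
  linarith

end IsFreeAmalgam

end Amalgam

/-! ### Models of `S_α` -/

section Semantics

variable {L : FirstOrder.Language.{u, v}} [Fintype (Σ n, L.Relations n)] {M : Type w}
  [L.Structure M] {N : Type w'} [L.Structure N]

theorem realize_atomicDiagram {ι : Type} [Finite ι] {B : Type} [L.Structure B] (v : ι → B)
    (w : ι → N) : (atomicDiagram v : L.Formula ι).Realize w ↔
      (∀ i j, v i = v j ↔ w i = w j) ∧
        ∀ (E : Σ n, L.Relations n) (t : Fin E.1 → ι), RelMap E.2 (v ∘ t) ↔ RelMap E.2 (w ∘ t) := by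
  unfold atomicDiagram
  rw [Language.Formula.realize_inf, Language.Formula.realize_iInf, Language.Formula.realize_iInf]
  refine and_congr ⟨fun h i j => ?_, fun h p => ?_⟩ (forall_congr' fun E => ?_)
  · have := h (i, j)
    split_ifs at this with hv <;>
      simp only [Language.Formula.realize_not, Language.Formula.realize_equal,
        Language.Term.realize_var] at this <;> simpa [hv] using this
  · have := h p.1 p.2
    split_ifs with hv <;>
      simp only [Language.Formula.realize_not, Language.Formula.realize_equal,
        Language.Term.realize_var] <;> simpa [hv] using this
  · rw [Language.Formula.realize_iInf]
    refine forall_congr' fun t => ?_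
    split_ifs with hv
    · rw [Language.Formula.realize_rel]
      simp only [Language.Term.realize_var, hv, true_iff]
      rfl
    · rw [Language.Formula.realize_not, Language.Formula.realize_rel]
      simp only [Language.Term.realize_var, hv, false_iff]
      rfl

theorem realize_atomicDiagram_id {B : Type} [Finite B] [L.Structure B] (w : B → N) :
    (atomicDiagram (_root_.id : B → B) : L.Formula B).Realize w ↔ PEmb L w Set.univ := by
  rw [realize_atomicDiagram]
  constructor
  · rintro ⟨h1, h2⟩
    exact ⟨fun i _ j _ h => (h1 i j).2 h, fun n E x _ => (h2 ⟨n, E⟩ x).symm⟩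
  · rintro ⟨h1, h2⟩
    exact ⟨fun i j => ⟨fun h => by rw [show i = j from h], fun h => h1 trivial trivial h⟩,
      fun E t => (h2 E.1 E.2 t fun _ => trivial).symm⟩

theorem realize_omitSentence {B : Type} [Finite B] [L.Structure B] :
    N ⊨ omitSentence L B ↔ ∀ w : B → N, ¬ PEmb L w Set.univ := by
  unfold omitSentence Language.Sentence.Realize
  rw [Language.Formula.realize_iAlls]
  refine forall_congr' fun w => ?_
  rw [Language.Formula.realize_relabel, Language.Formula.realize_not]
  exact not_congr (realize_atomicDiagram_id w)

theorem realize_extensionSentence {B : Type} [Finite B] [L.Structure B] (A : L.Substructure B) :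
    N ⊨ extensionSentence A ↔ ∀ f : A → N, PEmb L f Set.univ →
      ∃ g : B → N, PEmb L g Set.univ ∧ ∀ a : A, g a = f a := by
  classical
  unfold extensionSentence Language.Sentence.Realize
  rw [Language.Formula.realize_iAlls]
  refine forall_congr' fun f => ?_
  rw [Language.Formula.realize_relabel, Language.Formula.realize_imp]
  refine imp_congr ?_ ?_
  · change (atomicDiagram fun a : A => (a : B)).Realize f ↔ _
    rw [realize_atomicDiagram]
    constructor
    · rintro ⟨h1, h2⟩
      exact ⟨fun i _ j _ h => Subtype.ext ((h1 i j).2 h), fun n E x _ => (h2 ⟨n, E⟩ x).symm⟩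
    · rintro ⟨h1, h2⟩
      exact ⟨fun i j => ⟨fun h => by rw [Subtype.ext h], fun h => by rw [h1 trivial trivial h]⟩,
        fun E t => (h2 E.1 E.2 t fun _ => trivial).symm⟩
  · rw [Language.Formula.realize_iExs]
    change (∃ y : {b : B // b ∉ A} → N, (atomicDiagram (Sum.elim (fun a : A => (a : B))
          (fun b : {b : B // b ∉ A} => (b : B)))).Realize (Sum.elim f y)) ↔ _
    simp only [realize_atomicDiagram]
    constructor
    · rintro ⟨y, h1, h2⟩
      let g : B → N := fun b => if h : b ∈ A then f ⟨b, h⟩ else y ⟨b, h⟩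
      let c : B → A ⊕ {b : B // b ∉ A} := fun b => if h : b ∈ A then .inl ⟨b, h⟩ else .inr ⟨b, h⟩
      have hc : ∀ b, Sum.elim (fun a : A => (a : B)) (fun b : {b : B // b ∉ A} => (b : B)) (c b)
          = b := fun b => by
        by_cases h : b ∈ A <;> simp [c, h]
      have hg : ∀ b, Sum.elim f y (c b) = g b := fun b => by
        by_cases h : b ∈ A <;> simp [c, g, h]
      refine ⟨g, ⟨fun i _ j _ h => ?_, fun n E x _ => ?_⟩, fun a => by simp [g]⟩
      · rw [← hg, ← hg, ← h1, hc, hc] at h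
        exact h
      · have := h2 ⟨n, E⟩ (c ∘ x)
        rw [show Sum.elim f y ∘ c ∘ x = g ∘ x from funext fun i => hg (x i),
          show Sum.elim (fun a : A => (a : B)) (fun b : {b : B // b ∉ A} => (b : B)) ∘ c ∘ x = x
            from funext fun i => hc (x i)] at this
        exact this.symm
    · rintro ⟨g, ⟨h1, h2⟩, h3⟩
      have hg : Sum.elim f (fun b : {b : B // b ∉ A} => g b) =
          g ∘ Sum.elim (fun a : A => (a : B)) (fun b : {b : B // b ∉ A} => (b : B)) := by
        funext i
        rcases i with a | b
        · exact (h3 a).symm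
        · rfl
      refine ⟨fun b => g b, fun i j => ?_, fun E t => ?_⟩
      · rw [hg]
        exact ⟨fun h => by simp only [Function.comp_apply, h], fun h => h1 trivial trivial h⟩
      · rw [hg]
        exact (h2 E.1 E.2 _ fun _ => trivial).symm

variable [L.IsRelational] {α : (Σ n, L.Relations n) → ℝ}

omit [Fintype (Σ n, L.Relations n)] in
theorem exists_fin_pemb {B : Set M} (hB : B.Finite) :
    ∃ (n : ℕ) (_ : L.Structure (Fin n)) (h : Fin n → M), PEmb L h Set.univ ∧ Set.range h = B := by
  have := hB.to_subtype
  obtain ⟨n, ⟨e⟩⟩ := Finite.exists_equiv_fin B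
  let h : Fin n → M := fun i => (e.symm i : M)
  refine ⟨n, mkStr fun E x => RelMap E.2 (h ∘ x), h,
    ⟨(Subtype.val_injective.comp e.symm.injective).injOn, fun _ _ _ _ => Iff.rfl⟩, ?_⟩
  rw [show h = Subtype.val ∘ e.symm from rfl, Set.range_comp, e.symm.surjective.range_eq]
  simp

omit [Fintype (Σ n, L.Relations n)] [L.IsRelational] in
theorem IsHypergraph.of_pemb (hN : IsHypergraph L N) {f : M → N} (hf : PEmb L f Set.univ) :
    IsHypergraph L M := fun n E x hx => by
  have h := hN n E _ ((hf.2 n E x fun _ => trivial).2 hx)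
  exact ⟨h.1.of_comp, fun π => (hf.2 n E _ fun _ => trivial).1 (h.2 π)⟩

omit [L.IsRelational] in
theorem InK.of_pemb {f : M → N} (hf : PEmb L f Set.univ) [Finite M] (hN : IsHypergraph L N)
    (h : ∀ F ⊆ Set.range f, 0 ≤ delta α F) : InK α M :=
  ⟨inferInstance, hN.of_pemb hf, fun A _ => by
    rw [← delta_image (hf.mono (Set.subset_univ A))]
    exact h _ (Set.image_subset_range f A)⟩

theorem inKbar_of_models (hN : N ⊨ theoryS (L := L) α) : InKbar α N := by
  have key : ∀ B : Set N, B.Finite → ∃ (n : ℕ) (_ : L.Structure (Fin n)) (h : Fin n → N),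
      PEmb L h Set.univ ∧ Set.range h = B ∧ InK α (Fin n) := fun B hB => by
    obtain ⟨n, S, h, hh, hr⟩ := exists_fin_pemb (L := L) hB
    refine ⟨n, S, h, hh, hr, by_contra fun hK => ?_⟩
    have := hN.realize_of_mem (omitSentence L (Fin n)) (Or.inl ⟨n, S, hK, rfl⟩)
    exact realize_omitSentence.1 this h hh
  constructor
  · intro n E x hx
    obtain ⟨k, S, h, hh, hr, hK⟩ := key (Set.range x) (Set.finite_range x)
    have : ∀ i, ∃ y, h y = x i := fun i => by
      have : x i ∈ Set.range h := hr ▸ ⟨i, rfl⟩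
      exact this
    choose y hy using this
    have hxy : x = h ∘ y := funext fun i => (hy i).symm
    have h1 := hK.2.1 n E y ((hh.2 n E y fun _ => trivial).1 (hxy ▸ hx))
    rw [hxy]
    refine ⟨fun i j hij => h1.1 (hh.1 trivial trivial hij), fun π => ?_⟩
    exact (hh.2 n E _ fun _ => trivial).2 (h1.2 π)
  · intro A hA
    obtain ⟨k, S, h, hh, hr, hK⟩ := key A hA
    rw [← hr, ← Set.image_univ, delta_image hh]
    exact hK.2.2 _ Set.finite_univ

/-- Every model of `S_α` has the extension property for strong pairs of finite subsets of an
arbitrary hypergraph. -/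
theorem exists_extension (hN : N ⊨ theoryS (L := L) α) (hM : IsHypergraph L M) {A B : Set M}
    (hB : B.Finite) (hK : ∀ F ⊆ B, 0 ≤ delta α F) (hAB : StrongIn α A B) {f : M → N}
    (hf : PEmb L f A) : ∃ g : M → N, PEmb L g B ∧ Set.EqOn g f A := by
  classical
  obtain ⟨n, S, h, hh, hr⟩ := exists_fin_pemb (L := L) hB
  let A' : L.Substructure (Fin n) := ⟨h ⁻¹' A, fun f => isEmptyElim f⟩
  have hBi : h '' Set.univ = B := by rw [Set.image_univ, hr]
  have hAi : h '' (A' : Set (Fin n)) = A := by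
    change h '' (h ⁻¹' A) = A
    rw [Set.image_preimage_eq_iff, hr]
    exact hAB.1
  have hinK : InK α (Fin n) := InK.of_pemb hh hM (hr ▸ hK)
  have hst : StrongIn α (A' : Set (Fin n)) Set.univ := by
    refine ⟨Set.subset_univ _, fun C hC _ => ?_⟩
    rw [← delta_image (hh.mono (Set.subset_univ (A' : Set (Fin n)))),
      ← delta_image (hh.mono (Set.subset_univ C)), hAi]
    exact hAB.2 _ (hAi ▸ Set.image_mono hC) (hBi ▸ Set.image_mono (Set.subset_univ C))
  have := hN.realize_of_mem (extensionSentence A') (Or.inr ⟨n, S, A', hinK, hst, rfl⟩)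
  obtain ⟨g, hg, hgf⟩ := (realize_extensionSentence A').1 this (fun a => f (h a))
    ⟨fun a _ b _ hab => Subtype.ext (hh.1 trivial trivial (hf.1 a.2 b.2 hab)), fun k E x _ => by
      have h1 := hf.2 k E (fun i => h (x i)) fun i => (x i).2
      have h2 := hh.2 k E (fun i => (x i : Fin n)) fun _ => trivial
      exact h1.trans h2⟩
  have hinv : ∀ x ∈ B, ∃ y, h y = x := fun x hx => by
    rw [← hr] at hx
    exact hx
  let r : M → N := fun x => if hx : x ∈ B then g (hinv x hx).choose else f x
  have hrh : ∀ y, r (h y) = g y := fun y => by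
    have hy : h y ∈ B := hr ▸ ⟨y, rfl⟩
    simp only [r, hy, dif_pos]
    rw [hh.1 trivial trivial (hinv _ hy).choose_spec]
  refine ⟨r, ?_, fun a ha => ?_⟩
  · rw [← hBi]
    exact hh.of_comp (hg.congr fun y _ => (hrh y).symm)
  · rw [← hAi] at ha
    obtain ⟨y, hy, rfl⟩ := ha
    rw [hrh]
    exact hgf ⟨y, hy⟩

omit [L.IsRelational] in
/-- The converse of `inKbar_of_models` and `exists_extension`. -/
theorem models_theoryS (hN : InKbar α N)
    (h : ∀ (n : ℕ) (_ : L.Structure (Fin n)) (A : Set (Fin n)), InK α (Fin n) →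
      StrongIn α A Set.univ → ∀ f : Fin n → N, PEmb L f A →
      ∃ g : Fin n → N, PEmb L g Set.univ ∧ Set.EqOn g f A) (hne : Nonempty N) :
    N ⊨ theoryS (L := L) α := by
  classical
  refine ⟨?_⟩
  rintro φ (⟨n, S, hK, rfl⟩ | ⟨n, S, A, hK, hA, rfl⟩)
  · rw [realize_omitSentence]
    intro w hw
    exact hK (InK.of_pemb hw hN.1 fun F hF => hN.2 F ((Set.finite_range w).subset hF))
  · rw [realize_extensionSentence]
    intro f hf
    let f' : Fin n → N := fun x => if hx : x ∈ A then f ⟨x, hx⟩ else hne.some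
    have hff : ∀ a : A, f' a = f a := fun a => by simp [f']
    obtain ⟨g, hg, hgf⟩ := h n S A hK hA f' ⟨fun x hx y hy hxy => by
      have h1 := hff ⟨x, hx⟩
      have h2 := hff ⟨y, hy⟩
      have h3 := hf.1 trivial trivial (h1.symm.trans (hxy.trans h2))
      exact congrArg Subtype.val h3, fun k E x hx => by
      have h1 := hf.2 k E (fun i => ⟨x i, hx i⟩) fun _ => trivial
      have h2 : f' ∘ x = f ∘ fun i => ⟨x i, hx i⟩ := funext fun i => hff ⟨x i, hx i⟩
      rw [h2, h1]
      rfl⟩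
    exact ⟨g, hg, fun a => by rw [← hff]; exact hgf a.2⟩

end Semantics

/-! ### Hypergraphs with a prescribed family of edges, and the charging argument -/

section Family

variable {L : FirstOrder.Language.{u, v}} [L.IsRelational] [Fintype (Σ n, L.Relations n)]
  {α : (Σ n, L.Relations n) → ℝ}

/-- A family of sets of the right sizes, labelled by relation symbols, is the set of edges of a
hypergraph. -/
theorem exists_hypergraph_of_family {V : Type} [Finite V] {ι : Type} (I : Finset ι)
    (s : ι → Σ n, L.Relations n) (e : ι → Finset V) (hcard : ∀ j ∈ I, (e j).card = (s j).1)
    (hinj : ∀ j ∈ I, ∀ k ∈ I, s j = s k → e j = e k → j = k) :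
    ∃ _ : L.Structure V, IsHypergraph L V ∧ ∀ F : Set V, delta α F =
      F.ncard - ∑ j ∈ I, (open Classical in if (e j : Set V) ⊆ F then α (s j) else 0) := by
  classical
  let S : L.Structure V := mkStr fun E x =>
    Function.Injective x ∧ ∃ j ∈ I, s j = E ∧ Set.range x = e j
  have hedges : ∀ (E : Σ n, L.Relations n) (F : Set V), edges E F =
      (fun j => (e j : Set V)) '' (I.filter fun j => (e j : Set V) ⊆ F ∧ s j = E : Finset ι) := by
    intro E F
    ext t
    constructor
    · rintro ⟨htF, x, ⟨-, j, hj, hjE, hxj⟩, rfl⟩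
      refine ⟨j, ?_, hxj.symm⟩
      simp only [Finset.coe_filter, Set.mem_ofPred_eq]
      exact ⟨hj, hxj ▸ htF, hjE⟩
    · rintro ⟨j, hj, rfl⟩
      simp only [Finset.coe_filter, Set.mem_ofPred_eq] at hj
      obtain ⟨hjI, hjF, rfl⟩ := hj
      refine ⟨hjF, fun i => (((e j).equivFinOfCardEq (hcard j hjI)).symm i : V),
        ⟨Subtype.val_injective.comp (Equiv.injective _), j, hjI, rfl, ?_⟩, ?_⟩ <;>
      · change Set.range (Subtype.val ∘ ((e j).equivFinOfCardEq (hcard j hjI)).symm) = _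
        rw [Set.range_comp, (Equiv.surjective _).range_eq]
        simp
  refine ⟨S, ?_, fun F => ?_⟩
  · rintro n E x ⟨hx, j, hj, hjE, hxj⟩
    refine ⟨hx, fun π => ⟨hx.comp π.injective, j, hj, hjE, ?_⟩⟩
    rw [Set.range_comp, π.surjective.range_eq, Set.image_univ, hxj]
  · unfold delta
    congr 1
    rw [← Finset.sum_filter, ← Finset.sum_fiberwise (I.filter fun j => (e j : Set V) ⊆ F) s]
    refine Finset.sum_congr rfl fun E _ => ?_
    rw [hedges, Set.InjOn.ncard_image, Set.ncard_coe_finset, Finset.filter_filter,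
      Finset.sum_congr rfl (g := fun _ => α E), Finset.sum_const, nsmul_eq_mul, mul_comm]
    · intro j hj
      rw [(Finset.mem_filter.1 hj).2.2]
    · intro j hj k hk hjk
      have hj' := Finset.mem_filter.1 (Finset.mem_coe.1 hj)
      have hk' := Finset.mem_filter.1 (Finset.mem_coe.1 hk)
      exact hinj j hj'.1 k hk'.1 (hj'.2.2.trans hk'.2.2.symm) (Finset.coe_injective hjk)

end Family

section Counting

/-- The charging argument for the gadgets. Edges with weights `a 0, a 1, …` and partial sums `W`
are handed out to the vertices `1, …, K`: the vertex `i + 1` owns the edges `J i, …, J (i+1) - 1`,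
so that the vertices up to `i` own edges of total weight just below `i * ρ`. If `x t` says that
the vertex `t` lies in a set `F` and `κ i` is the weight of the edges owned by `i + 1` that lie
inside `F`, then the edges inside `F` weigh at most `ρ` per vertex of `F` other than `0`: the
vertex that starts an interval of `F` loses its first edge, which makes up for the rounding
error. If `0 ∉ F`, a further amount `g` is gained at the least vertex of `F`. -/
theorem charging {a W : ℕ → ℝ} {J : ℕ → ℕ} {K : ℕ} {ρ g : ℝ} {x : ℕ → Prop} [DecidablePred x]
    {κ : ℕ → ℝ} (hW : ∀ j, W (j + 1) = W j + a j)
    (hJ0 : W (J 0) = 0) (hJ : ∀ i ≤ K, W (J i) ≤ i * ρ) (hJ' : ∀ i < K, i * ρ < W (J i + 1))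
    (hJK : W (J K) = K * ρ)
    (h0 : ∀ i < K, ¬ x (i + 1) → κ i ≤ 0)
    (h1 : ∀ i < K, κ i ≤ W (J (i + 1)) - W (J i))
    (h2 : ∀ i < K, ¬ x i → κ i ≤ W (J (i + 1)) - W (J i + 1))
    (h3 : ∀ i < K, 1 ≤ i → ¬ x i → ¬ x (i - 1) →
      κ i ≤ W (J (i + 1)) - W (J i + 2) ∨ κ i ≤ 0) (hg0 : 0 ≤ g)
    (hg : ∀ j, g ≤ a j) (hg' : ∀ j, g ≤ ρ - a j) :
    (∑ i ∈ Finset.range K, κ i ≤ ρ * ∑ i ∈ Finset.range K, if x (i + 1) then (1 : ℝ) else 0) ∧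
    (¬ x 0 → (∃ i < K, x (i + 1)) → ∑ i ∈ Finset.range K, κ i ≤
      ρ * (∑ i ∈ Finset.range K, if x (i + 1) then (1 : ℝ) else 0) - g) := by
  -- the inductive step away from the least vertex of `F`
  have step : ∀ i < K, ∀ C n : ℝ, C ≤ ρ * n - (if x i then i * ρ - W (J i) else 0) →
      C + κ i ≤ ρ * (n + if x (i + 1) then (1 : ℝ) else 0) -
        (if x (i + 1) then ((i + 1 : ℕ) : ℝ) * ρ - W (J (i + 1)) else 0) := by
    intro i hi C n hC
    have e0 := hJ i hi.le
    by_cases hx' : x (i + 1)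
    · by_cases hx : x i
      · simp only [hx, hx', if_true] at hC ⊢
        have := h1 i hi
        push_cast
        linarith
      · simp only [hx, hx', if_true, if_false] at hC ⊢
        have := h2 i hi hx
        have := hJ' i hi
        push_cast
        linarith
    · have := h0 i hi hx'
      simp only [hx', if_false]
      split_ifs at hC <;> linarith
  have A : ∀ i ≤ K, ∑ t ∈ Finset.range i, κ t ≤
      ρ * (∑ t ∈ Finset.range i, if x (t + 1) then (1 : ℝ) else 0) -
        (if x i then i * ρ - W (J i) else 0) := by
    intro i
    induction i with
    | zero => simp [hJ0]
    | succ i ih =>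
      intro hi
      rw [Finset.sum_range_succ, Finset.sum_range_succ]
      exact step i hi _ _ (ih (by omega))
  have fin : (if x K then (K : ℝ) * ρ - W (J K) else 0) = 0 := by simp [hJK]
  refine ⟨by simpa [fin] using A K le_rfl, fun hx0 hex => ?_⟩
  have B : ∀ i ≤ K, (∃ t < i, x (t + 1)) → ∑ t ∈ Finset.range i, κ t ≤
      ρ * (∑ t ∈ Finset.range i, if x (t + 1) then (1 : ℝ) else 0) -
        (if x i then i * ρ - W (J i) else 0) - g := by
    intro i
    induction i with
    | zero => rintro - ⟨t, ht, -⟩; omega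
    | succ i ih =>
      intro hi hex
      rw [Finset.sum_range_succ, Finset.sum_range_succ]
      by_cases hprev : ∃ t < i, x (t + 1)
      · have := step i hi (∑ t ∈ Finset.range i, κ t + g)
          (∑ t ∈ Finset.range i, if x (t + 1) then (1 : ℝ) else 0)
          (by have := ih (by omega) hprev; linarith)
        linarith
      · -- `i + 1` is the least vertex of `F`
        have hx' : x (i + 1) := by
          obtain ⟨t, ht, hxt⟩ := hex
          rcases Nat.lt_succ_iff_lt_or_eq.1 ht with h | rfl
          · exact absurd ⟨t, h, hxt⟩ hprev
          · exact hxt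
        have hnx : ∀ t ≤ i, ¬ x t := by
          intro t ht hxt
          rcases t with _ | t
          · exact hx0 hxt
          · exact hprev ⟨t, ht, hxt⟩
        have hn : ∑ t ∈ Finset.range i, (if x (t + 1) then (1 : ℝ) else 0) = 0 :=
          Finset.sum_eq_zero fun t ht => if_neg (hnx _ (Finset.mem_range.1 ht))
        have hC := A i (by omega)
        rw [hn, if_neg (hnx i le_rfl)] at hC
        rw [hn, if_pos hx', if_pos hx']
        push_cast
        have hJi := hJ' i hi
        suffices κ i ≤ ρ - ((i + 1) * ρ - W (J (i + 1))) - g by linarith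
        rcases Nat.eq_zero_or_pos i with rfl | hipos
        · have := h2 0 hi (hnx 0 le_rfl)
          have := hW (J 0)
          have := hg (J 0)
          simp only [Nat.cast_zero, zero_add] at *
          linarith
        · rcases h3 i hi hipos (hnx i le_rfl) (hnx _ (by omega)) with h | h
          · have := hW (J i + 1)
            have := hg (J i + 1)
            rw [show J i + 1 + 1 = J i + 2 from rfl] at *
            linarith
          · rcases Nat.lt_or_ge (i + 1) K with hlt | hge
            · have := hJ' (i + 1) hlt
              have := hW (J (i + 1))
              have := hg' (J (i + 1))
              push_cast at *
              linarith
            · have hiK : i + 1 = K := by omega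
              have := hg' 0
              have := hg 0
              have := hJK
              rw [← hiK] at this
              push_cast at this
              rw [this]
              linarith
  have := B K le_rfl hex
  rw [fin] at this
  linarith

end Counting

/-! ### Cyclic hypergraphs -/

section Cyclic

variable {L : FirstOrder.Language.{u, v}} [L.IsRelational] [Fintype (Σ n, L.Relations n)]
  {α : (Σ n, L.Relations n) → ℝ}

theorem natCast_zmod_inj {n x y : ℕ} (hx : x < n) (hy : y < n) (h : (x : ZMod n) = y) : x = y := by
  rw [ZMod.natCast_eq_natCast_iff', Nat.mod_eq_of_lt hx, Nat.mod_eq_of_lt hy] at h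
  exact h

/-- The elements of a subset of the cycle, counted as `0` and the classes of `1, …, K`. -/
theorem ncard_zmod {K : ℕ} (F : Set (ZMod (K + 1)))
    [DecidablePred fun t : ℕ => (t : ZMod (K + 1)) ∈ F] :
    (F.ncard : ℝ) = (∑ t ∈ Finset.range K, if ((t + 1 : ℕ) : ZMod (K + 1)) ∈ F then (1 : ℝ) else 0)
      + if ((0 : ℕ) : ZMod (K + 1)) ∈ F then (1 : ℝ) else 0 := by
  classical
  rw [← Finset.sum_range_succ' (fun t : ℕ => if (t : ZMod (K + 1)) ∈ F then (1 : ℝ) else 0),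
    Finset.sum_boole]
  congr 1
  rw [← Finset.card_image_of_injOn (s := Finset.filter (fun t : ℕ =>
    (t : ZMod (K + 1)) ∈ F) (Finset.range (K + 1))) (f := fun t : ℕ => (t : ZMod (K + 1))),
    ← Set.ncard_coe_finset]
  · congr 1
    ext z
    simp only [Finset.coe_image, Finset.coe_filter, Finset.mem_range, Set.mem_image,
      Set.mem_ofPred_eq]
    constructor
    · exact fun hz => ⟨z.val, ⟨ZMod.val_lt z, by rwa [ZMod.natCast_zmod_val]⟩,
        ZMod.natCast_zmod_val z⟩
    · rintro ⟨t, ⟨-, ht⟩, rfl⟩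
      exact ht
  · intro x hx y hy hxy
    exact natCast_zmod_inj (Finset.mem_range.1 (Finset.mem_filter.1 hx).1)
      (Finset.mem_range.1 (Finset.mem_filter.1 hy).1) hxy

/-- The offsets of the `l`-th edge, of size `r`, owned by a vertex. -/
def offsets (l r : ℕ) : Finset ℕ := insert 0 (Finset.Icc (l + 1) (l + r - 1))

/-- The `l`-th edge, of size `r`, owned by the vertex `i + 1` of a cycle of length `K + 1`: it
consists of `i + 1` and of a block of `r - 1` consecutive vertices before it, the last of which
is `i - l`. -/
def cyclicEdge (K i l r : ℕ) : Finset (ZMod (K + 1)) :=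
  (offsets l r).image fun x : ℕ => ((i + 1 : ℕ) : ZMod (K + 1)) - x

theorem le_of_mem_offsets {l r x : ℕ} (hx : x ∈ offsets l r) : x ≤ l + r := by
  simp only [offsets, Finset.mem_insert, Finset.mem_Icc] at hx
  omega

theorem sub_natCast_injOn {n : ℕ} (z : ZMod n) {x y : ℕ} (hx : x < n) (hy : y < n)
    (h : z - (x : ZMod n) = z - y) : x = y :=
  natCast_zmod_inj hx hy (sub_right_injective h)

theorem card_cyclicEdge {K i l r : ℕ} (hr : 1 ≤ r) (hK : l + r < K + 1) :
    (cyclicEdge K i l r).card = r := by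
  rw [cyclicEdge, Finset.card_image_of_injOn, offsets, Finset.card_insert_of_notMem, Nat.card_Icc]
  · omega
  · simp
  · intro x hx y hy hxy
    exact sub_natCast_injOn _ ((le_of_mem_offsets hx).trans_lt hK)
      ((le_of_mem_offsets hy).trans_lt hK) hxy

theorem cyclicEdge_inj {K i l i' l' r : ℕ} (hr : 2 ≤ r) (hl : 2 * (l + r) < K + 1)
    (hl' : 2 * (l' + r) < K + 1) (hi : i < K) (hi' : i' < K)
    (h : cyclicEdge K i l r = cyclicEdge K i' l' r) : i = i' ∧ l = l' := by
  have key : ∀ {i l i' l'}, cyclicEdge K i l r = cyclicEdge K i' l' r →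
      ∀ x ∈ offsets l r, ∃ y ∈ offsets l' r,
        ((i' + 1 : ℕ) : ZMod (K + 1)) - y = ((i + 1 : ℕ) : ZMod (K + 1)) - x := by
    intro i l i' l' h x hx
    have : ((i + 1 : ℕ) : ZMod (K + 1)) - x ∈ cyclicEdge K i' l' r :=
      h ▸ Finset.mem_image_of_mem _ hx
    exact Finset.mem_image.1 this
  have z0 : ∀ l, 0 ∈ offsets l r := fun l => Finset.mem_insert_self _ _
  obtain ⟨y, hy, hy'⟩ := key h 0 (z0 l)
  obtain ⟨x, hx, hx'⟩ := key h.symm 0 (z0 l')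
  have hxl := le_of_mem_offsets hx
  have hyl := le_of_mem_offsets hy
  have h0 : ((x + y : ℕ) : ZMod (K + 1)) = (0 : ℕ) := by
    push_cast at hy' hx' ⊢
    linear_combination -hy' - hx'
  have hxy := natCast_zmod_inj (n := K + 1) (by omega) (by omega) h0
  have hx0 : x = 0 := by omega
  subst hx0
  have hii : i + 1 = i' + 1 :=
    natCast_zmod_inj (n := K + 1) (by omega) (by omega) (by simpa using hx')
  have hii' : i = i' := by omega
  subst hii'
  refine ⟨rfl, ?_⟩
  have key2 : ∀ {l l'}, 2 * (l + r) < K + 1 → 2 * (l' + r) < K + 1 →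
      cyclicEdge K i l r = cyclicEdge K i l' r → l' ≤ l := by
    intro l l' hl hl' h
    obtain ⟨y, hy, hyx⟩ := key h (l + 1) (by
      simp only [offsets, Finset.mem_insert, Finset.mem_Icc]; omega)
    have hyl := le_of_mem_offsets hy
    have := sub_natCast_injOn _ (by omega) (by omega) hyx
    simp only [offsets, Finset.mem_insert, Finset.mem_Icc] at hy
    omega
  exact le_antisymm (key2 hl' hl h.symm) (key2 hl hl' h)

/-- A hypergraph on a cycle of length `K + 1` that carries any given sequence of edges of total
weight `K + d`, spread out evenly: up to a proportional share of the excess `d`, a set that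
contains `0` has rank at least `1`, and any other nonempty set has rank at least `g`. -/
theorem exists_cyclic_hypergraph (har : ∀ E : Σ n, L.Relations n, 2 ≤ E.1) (hα1 : ∀ E, α E ≤ 1)
    {lo : ℝ} (hlo : 0 < lo) (hlo' : ∀ E, lo ≤ α E) {s : ℕ → Σ n, L.Relations n} {N K H r : ℕ}
    {d g : ℝ} (hr : ∀ E : Σ n, L.Relations n, E.1 ≤ r)
    (hH : 3 ≤ ((H : ℝ) - r) * lo) (hK : 2 * H < K + 1) (hd : 0 < d) (hdK : d ≤ K)
    (hN : ∑ j ∈ Finset.range N, α (s j) = K + d) (hg0 : 0 ≤ g) (hg : ∀ j, g ≤ α (s j))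
    (hg' : ∀ j, g ≤ 1 + d / K - α (s j)) :
    ∃ _ : L.Structure (ZMod (K + 1)), IsHypergraph L (ZMod (K + 1)) ∧
      delta α (Set.univ : Set (ZMod (K + 1))) = 1 - d ∧
      (∀ F : Set (ZMod (K + 1)), 0 ∈ F → 1 - ((F.ncard : ℝ) - 1) * (d / K) ≤ delta α F) ∧
      ∀ F : Set (ZMod (K + 1)), 0 ∉ F → F.Nonempty → g - (F.ncard : ℝ) * (d / K) ≤ delta α F := by
  classical
  have hKpos : (0 : ℝ) < K := lt_of_lt_of_le hd hdK
  set ρ : ℝ := 1 + d / K with hρ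
  have hρK : (K : ℝ) * ρ = K + d := by rw [hρ]; field_simp
  have hρ2 : ρ ≤ 2 := by
    have := (div_le_one hKpos).2 hdK
    linarith
  have hρ1 : 1 ≤ ρ := by
    have := (div_pos hd hKpos).le
    linarith
  let W : ℕ → ℝ := fun n => ∑ j ∈ Finset.range n, α (s j)
  have hW : ∀ j, W (j + 1) = W j + α (s j) := fun j => Finset.sum_range_succ _ _
  have hWadd : ∀ n k, W (n + k) = W n + ∑ l ∈ Finset.range k, α (s (n + l)) :=
    fun n k => Finset.sum_range_add _ _ _
  have hWmono : StrictMono W := strictMono_nat_of_lt_succ fun j => by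
    have := hlo' (s j)
    rw [hW]
    linarith
  -- the vertices `1, …, i` own the edges before `J i`, as many as weigh at most `i * ρ`
  let J : ℕ → ℕ := fun i => Nat.findGreatest (fun j => W j ≤ i * ρ) N
  have hJN : ∀ i, J i ≤ N := fun i => Nat.findGreatest_le N
  have hJ : ∀ i, W (J i) ≤ i * ρ := fun i =>
    Nat.findGreatest_spec (P := fun j => W j ≤ i * ρ) (Nat.zero_le N) (by
      simp only [W, Finset.range_zero, Finset.sum_empty]
      positivity)
  have hJ0 : W (J 0) = 0 := by
    refine le_antisymm (by simpa using hJ 0) ?_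
    have := hWmono.monotone (Nat.zero_le (J 0))
    simpa [W] using this
  have hJK : W (J K) = K * ρ := by
    have : J K = N := le_antisymm (hJN K) (Nat.le_findGreatest le_rfl (by
      rw [hρK]
      exact hN.le))
    rw [this, hρK]
    exact hN
  have hJ' : ∀ i < K, i * ρ < W (J i + 1) := fun i hi => by
    rcases (hJN i).lt_or_eq with h | h
    · by_contra hc
      exact Nat.findGreatest_is_greatest (P := fun j => W j ≤ i * ρ) (Nat.lt_succ_self (J i)) h
        (not_lt.1 hc)
    · exfalso
      have h1 := hJ i
      rw [h] at h1
      have h2 : W N = K * ρ := by rw [hρK]; exact hN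
      rw [h2] at h1
      have : (i : ℝ) < K := by exact_mod_cast hi
      nlinarith
  have hJlt : ∀ i < K, J i + 1 ≤ J (i + 1) := fun i hi => by
    refine Nat.le_findGreatest ?_ ?_
    · rcases (hJN i).lt_or_eq with h | h
      · exact h
      · have h1 := hJ i
        have h2 : W N = K * ρ := by rw [hρK]; exact hN
        rw [h, h2] at h1
        have : (i : ℝ) < K := by exact_mod_cast hi
        nlinarith
    · have := hJ i
      have := hα1 (s (J i))
      rw [hW]
      push_cast
      linarith
  let c : ℕ → ℕ := fun i => J (i + 1) - J i
  have hc : ∀ i < K, J i + c i = J (i + 1) := fun i hi => by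
    have := hJlt i hi
    simp only [c]
    omega
  -- each vertex owns few edges, so that all edges are short in comparison with the cycle
  have hcH : ∀ i < K, c i + r ≤ H := fun i hi => by
    have h1 : W (J (i + 1)) - W (J i) ≤ 3 := by
      have h2 := hJ (i + 1)
      have h3 := hJ' i hi
      rw [hW] at h3
      have := hα1 (s (J i))
      push_cast at h2
      linarith
    have h2 : (c i : ℝ) * lo ≤ W (J (i + 1)) - W (J i) := by
      rw [← hc i hi, hWadd, add_sub_cancel_left]
      have := Finset.card_nsmul_le_sum (Finset.range (c i)) (fun l => α (s (J i + l))) lo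
        fun l _ => hlo' _
      simpa using this
    have h3 : (c i : ℝ) ≤ H - r := le_of_mul_le_mul_right (by linarith) hlo
    have : ((c i + r : ℕ) : ℝ) ≤ H := by push_cast; linarith
    exact_mod_cast this
  let lab : (Σ _ : ℕ, ℕ) → Σ n, L.Relations n := fun p => s (J p.1 + p.2)
  let e : (Σ _ : ℕ, ℕ) → Finset (ZMod (K + 1)) := fun p => cyclicEdge K p.1 p.2 (lab p).1
  let I : Finset (Σ _ : ℕ, ℕ) := (Finset.range K).sigma fun i => Finset.range (c i)
  have hI : ∀ p ∈ I, p.1 < K ∧ 2 * (p.2 + (lab p).1) < K + 1 := fun p hp => by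
    have h := Finset.mem_sigma.1 hp
    have h1 := Finset.mem_range.1 h.1
    have h2 := Finset.mem_range.1 h.2
    have h3 := hcH _ h1
    have h4 := hr (lab p)
    exact ⟨h1, by omega⟩
  obtain ⟨S, hS, hδ⟩ := exists_hypergraph_of_family (α := α) I lab e
    (fun p hp => card_cyclicEdge (by have := har (lab p); omega) (by have := (hI p hp).2; omega))
    (fun p hp q hq hpq h => by
      have hp' := hI p hp
      have hq' := hI q hq
      have h' : cyclicEdge K p.1 p.2 (lab p).1 = cyclicEdge K q.1 q.2 (lab p).1 :=
        h.trans (by rw [hpq])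
      have := cyclicEdge_inj (har _) hp'.2 (by rw [hpq]; exact hq'.2) hp'.1 hq'.1 h'
      exact Sigma.ext this.1 (heq_of_eq this.2))
  -- the weight of the edges inside `F` that are owned by `i + 1`
  let κ : Set (ZMod (K + 1)) → ℕ → ℝ := fun F i => ∑ l ∈ Finset.range (c i),
    if (e ⟨i, l⟩ : Set (ZMod (K + 1))) ⊆ F then α (s (J i + l)) else 0
  have hδ' : ∀ F : Set (ZMod (K + 1)), delta α F = F.ncard - ∑ i ∈ Finset.range K, κ F i := by
    intro F
    rw [hδ, Finset.sum_sigma]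
  have hκ : ∀ F, ∀ i < K, ∀ k ≤ c i,
      (∀ l < k, ¬ (e ⟨i, l⟩ : Set (ZMod (K + 1))) ⊆ F) → κ F i ≤ W (J (i + 1)) - W (J i + k) := by
    intro F i hi k hk hlost
    obtain ⟨q, hq⟩ := Nat.exists_eq_add_of_le hk
    have h1 : κ F i = ∑ l ∈ Finset.range q,
        if (e ⟨i, k + l⟩ : Set (ZMod (K + 1))) ⊆ F then α (s (J i + (k + l))) else 0 := by
      simp only [κ]
      rw [hq, Finset.sum_range_add, Finset.sum_eq_zero, zero_add]
      exact fun l hl => if_neg (hlost l (Finset.mem_range.1 hl))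
    rw [h1, ← hc i hi, hq, ← add_assoc, hWadd, add_sub_cancel_left]
    refine Finset.sum_le_sum fun l _ => ?_
    rw [add_assoc]
    split_ifs
    · exact le_rfl
    · exact hlo.le.trans (hlo' _)
  have hmem : ∀ i l x : ℕ, x ∈ offsets l (lab ⟨i, l⟩).1 →
      ((i + 1 : ℕ) : ZMod (K + 1)) - x ∈ (e ⟨i, l⟩ : Set (ZMod (K + 1))) := fun i l x hx =>
    Finset.mem_coe.2 (Finset.mem_image_of_mem _ hx)
  have hmem1 : ∀ i l : ℕ, l + 1 ∈ offsets l (lab ⟨i, l⟩).1 := fun i l => by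
    have := har (lab ⟨i, l⟩)
    simp only [offsets, Finset.mem_insert, Finset.mem_Icc]
    omega
  have hch := fun F : Set (ZMod (K + 1)) =>
    charging (a := fun j => α (s j)) (W := W) (J := J) (K := K) (ρ := ρ) (g := g)
      (x := fun t => (t : ZMod (K + 1)) ∈ F) (κ := κ F) hW hJ0 (fun i _ => hJ i) hJ' hJK
      (fun i hi hx => by
        refine le_of_eq (Finset.sum_eq_zero fun l _ => if_neg fun hsub => hx (hsub ?_))
        simpa using hmem i l 0 (Finset.mem_insert_self _ _))
      (fun i hi => by simpa using hκ F i hi 0 (Nat.zero_le _) (by simp))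
      (fun i hi hx => by
        refine hκ F i hi 1 (by have := hJlt i hi; have := hc i hi; omega) fun l hl hsub => hx ?_
        obtain rfl : l = 0 := by omega
        simpa using hsub (hmem i 0 1 (hmem1 i 0)))
      (fun i hi hi1 hx hx' => by
        have hlost : ∀ l < 2, ¬ (e ⟨i, l⟩ : Set (ZMod (K + 1))) ⊆ F := fun l hl hsub => by
          obtain rfl | rfl : l = 0 ∨ l = 1 := by omega
          · exact hx (by simpa using hsub (hmem i 0 1 (hmem1 i 0)))
          · refine hx' ?_
            have := hsub (hmem i 1 2 (hmem1 i 1))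
            obtain ⟨k, rfl⟩ := Nat.exists_eq_add_of_le' hi1
            convert this using 1
            push_cast
            ring
        rcases Nat.lt_or_ge (c i) 2 with h | h
        · right
          refine le_of_eq (Finset.sum_eq_zero fun l hl => if_neg (hlost l ?_))
          exact (Finset.mem_range.1 hl).trans h
        · exact Or.inl (hκ F i hi 2 h hlost))
      hg0 hg hg'
  have hn := fun F : Set (ZMod (K + 1)) => ncard_zmod F
  refine ⟨S, hS, ?_, fun F hF => ?_, fun F hF hne => ?_⟩
  · have h1 : ∀ n ≤ K, ∑ i ∈ Finset.range n, κ Set.univ i = W (J n) := by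
      intro n
      induction n with
      | zero => simp [hJ0]
      | succ n ih =>
        intro hn
        rw [Finset.sum_range_succ, ih (by omega), ← hc n (by omega), hWadd]
        simp [κ]
    rw [hδ', h1 K le_rfl, hJK, hρK]
    simp
  · have := (hch F).1
    have hF' := hn F
    rw [Nat.cast_zero, if_pos hF] at hF'
    rw [hδ']
    rw [show d / K = ρ - 1 by rw [hρ]; ring]
    rw [← sub_eq_iff_eq_add] at hF'
    rw [← hF'] at this
    linarith
  · have := (hch F).2 (by simpa using hF) (by
      obtain ⟨z, hz⟩ := hne
      have hz' := ZMod.natCast_zmod_val z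
      have hlt := ZMod.val_lt z
      rcases h : z.val with _ | t
      · rw [h] at hz'
        exact absurd (by rw [← hz'] at hz; simpa using hz) hF
      · rw [h] at hz' hlt
        exact ⟨t, by omega, by rw [hz']; exact hz⟩)
    have hF' := hn F
    rw [Nat.cast_zero, if_neg hF, add_zero] at hF'
    rw [hδ']
    rw [show d / K = ρ - 1 by rw [hρ]; ring]
    rw [← hF'] at this
    linarith

end Cyclic

/-! ### Sums of weights near the integers -/

section Weights

/-- All negative numbers `k - ∑ α` with `k ≤ m` are at most `-ε`. Here `k - ∑ α` stands for the
relative rank of an extension by `k` points. -/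
def IsGap {S : Type*} (α : S → ℝ) (m : ℕ) (ε : ℝ) : Prop :=
  ∀ (s : Multiset S) (k : ℕ), k ≤ m → (k : ℝ) - (s.map α).sum < 0 → (k : ℝ) - (s.map α).sum ≤ -ε

variable {S : Type*} [Fintype S] {α : S → ℝ}

/-- Among the negative numbers `k - ∑ α` with `k ≤ m` there is a largest one, `-ε`. -/
theorem exists_gap [Nonempty S] (hα : ∀ E, 0 < α E) (m : ℕ) : ∃ ε : ℝ, 0 < ε ∧
    (∃ (s : Multiset S) (k : ℕ), ε = (s.map α).sum - k) ∧
    IsGap α m ε := by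
  classical
  obtain ⟨E₀⟩ := ‹Nonempty S›
  obtain ⟨E₁, -, hE₁⟩ := Finset.exists_min_image Finset.univ α ⟨E₀, Finset.mem_univ _⟩
  let T : Set (Multiset S × ℕ) := {p | p.2 ≤ m ∧ 0 < (p.1.map α).sum - p.2 ∧
    (p.1.map α).sum - p.2 ≤ α E₀}
  obtain ⟨C, hC⟩ := exists_nat_ge ((m + α E₀) / α E₁)
  have hT : T.Finite := by
    refine ((Set.finite_Iic (C • (Finset.univ : Finset S).val)).prod (Set.finite_Iic m)).subset ?_
    rintro ⟨s, k⟩ ⟨hk, -, h⟩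
    refine ⟨Multiset.le_iff_count.2 fun E => ?_, hk⟩
    rw [Multiset.count_nsmul, Multiset.count_eq_one_of_mem Finset.univ.nodup (Finset.mem_univ E),
      mul_one]
    refine (Multiset.count_le_card E s).trans ?_
    have h1 : (s.card : ℝ) * α E₁ ≤ (s.map α).sum := by
      have := Multiset.card_nsmul_le_sum (s := s.map α) (a := α E₁) fun x hx => by
        obtain ⟨E, -, rfl⟩ := Multiset.mem_map.1 hx
        exact hE₁ E (Finset.mem_univ _)
      simpa using this
    have h2 : (k : ℝ) ≤ m := by exact_mod_cast hk
    have h3 : (s.card : ℝ) ≤ (m + α E₀) / α E₁ := by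
      rw [le_div_iff₀ (hα _)]
      simp only at h
      linarith
    exact_mod_cast h3.trans hC
  obtain ⟨p, hp, hmin⟩ := Set.exists_min_image T (fun p => (p.1.map α).sum - (p.2 : ℝ)) hT
    ⟨({E₀}, 0), Nat.zero_le _, by simpa using hα E₀, by simp⟩
  refine ⟨(p.1.map α).sum - p.2, hp.2.1, ⟨p.1, p.2, rfl⟩, fun s k hk hs => ?_⟩
  by_cases h : (s.map α).sum - k ≤ α E₀
  · have := hmin (s, k) ⟨hk, by simp only; linarith, h⟩
    simp only at this
    linarith
  · have := hp.2.2
    linarith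

omit [Fintype S] in
theorem sum_map_one {s : Multiset S} (h : ∀ E ∈ s, α E = 1) : (s.map α).sum = s.card := by
  rw [Multiset.map_congr rfl h]
  simp

/-- Given a number `ε > 0` of the form `∑ α - k`, there is a number `v ≤ ε` of this form which is
small with respect to the weights it uses, unless all weights are `1`. -/
theorem exists_drop [Nonempty S] (hα : ∀ E, 0 < α E ∧ α E ≤ 1) {ε : ℝ} (hε : 0 < ε)
    (hε' : ∃ (s : Multiset S) (k : ℕ), ε = (s.map α).sum - k) :
    ∃ (v : ℝ) (s : Multiset S) (k : ℤ), 0 < v ∧ v ≤ ε ∧ s ≠ 0 ∧ v = (s.map α).sum - k ∧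
      (∀ E ∈ s, v ≤ α E) ∧ ((∀ E ∈ s, v ≤ 1 - α E) ∨ (∀ E, α E = 1) ∧ v = 1) := by
  classical
  obtain ⟨E₀⟩ := ‹Nonempty S›
  obtain ⟨s₀, k₀, hs₀⟩ := hε'
  by_cases hall : ∀ E, α E = 1
  · refine ⟨1, {E₀}, 0, one_pos, ?_, by simp, by simp [hall], by simp [hall], Or.inr ⟨hall, rfl⟩⟩
    rw [sum_map_one fun E _ => hall E] at hs₀
    rw [hs₀] at hε ⊢
    have h1 : (k₀ : ℝ) < s₀.card := by linarith
    have h2 : k₀ + 1 ≤ s₀.card := by exact_mod_cast h1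
    have h3 : (k₀ : ℝ) + 1 ≤ s₀.card := by exact_mod_cast h2
    linarith
  · push Not at hall
    obtain ⟨E', hE'⟩ := hall
    let U : Finset S := Finset.univ.filter fun E => α E < 1
    have hU : U.Nonempty := ⟨E', by simpa [U] using lt_of_le_of_ne (hα E').2 hE'⟩
    have hUmem : ∀ E, E ∈ U ↔ α E < 1 := fun E => by simp [U]
    obtain ⟨E₁, hE₁, hmax⟩ := Finset.exists_max_image U α hU
    obtain ⟨E₂, hE₂, hmin⟩ := Finset.exists_min_image U α hU
    let P : ℝ → Prop := fun v => 0 < v ∧ ∃ (s : Multiset S) (k : ℤ),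
      (∀ E ∈ s, E ∈ U) ∧ v = (s.map α).sum - k
    -- symbols of weight `1` can be traded for vertices
    have hP1 : P ε := by
      refine ⟨hε, s₀.filter (· ∈ U), (k₀ : ℤ) - (s₀.filter fun E => ¬ E ∈ U).card,
        fun E hE => (Multiset.mem_filter.1 hE).2, ?_⟩
      have h1 : (s₀.map α).sum = ((s₀.filter (· ∈ U)).map α).sum +
          ((s₀.filter fun E => ¬ E ∈ U).map α).sum := by
        rw [← Multiset.sum_add, ← Multiset.map_add, Multiset.filter_add_not]
      rw [hs₀, h1, sum_map_one (s := s₀.filter fun E => ¬ E ∈ U) fun E hE => ?_]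
      · push_cast
        ring
      · have := (Multiset.mem_filter.1 hE).2
        rw [hUmem, not_lt] at this
        exact le_antisymm (hα E).2 this
    have hβ : 0 < 1 - α E₁ := by
      have := (hUmem E₁).1 hE₁
      linarith
    have hP2 : ∃ v₂, P v₂ ∧ v₂ ≤ 1 - α E₁ := by
      -- `(j + 1) α - j = α - j (1 - α)` with `j` as large as positivity permits
      obtain ⟨j, hj⟩ : ∃ j : ℕ, ⌈α E₁ / (1 - α E₁)⌉₊ = j + 1 :=
        Nat.exists_eq_succ_of_ne_zero (Nat.pos_iff_ne_zero.1
          (Nat.ceil_pos.2 (div_pos (hα E₁).1 hβ)))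
      have h1 := Nat.le_ceil (α E₁ / (1 - α E₁))
      have h2 := Nat.ceil_lt_add_one (div_pos (hα E₁).1 hβ).le
      rw [hj] at h1 h2
      push_cast at h1 h2
      rw [div_le_iff₀ hβ] at h1
      have h3 : (j : ℝ) * (1 - α E₁) < α E₁ := by
        rw [← lt_div_iff₀ hβ]
        linarith
      refine ⟨α E₁ - j * (1 - α E₁), ⟨by linarith, Multiset.replicate (j + 1) E₁, j,
        fun E hE => ?_, ?_⟩, by linarith⟩
      · rwa [Multiset.eq_of_mem_replicate hE]
      · simp
        ring
    obtain ⟨v₂, hP2, hv₂⟩ := hP2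
    have hP3 : P (α E₂) := ⟨(hα _).1, {E₂}, 0, by simpa using hE₂, by simp⟩
    obtain ⟨h0, s, k, hs, hv⟩ : P (min ε (min v₂ (α E₂))) :=
      min_rec' P hP1 (min_rec' P hP2 hP3)
    have hle2 : min ε (min v₂ (α E₂)) ≤ 1 - α E₁ :=
      (min_le_right _ _).trans ((min_le_left _ _).trans hv₂)
    refine ⟨_, s, k, h0, min_le_left _ _, ?_, hv, fun E hE => ?_, Or.inl fun E hE => ?_⟩
    · rintro rfl
      have h1 : 0 < -(k : ℝ) := by simpa [hv] using h0
      have h2 : -(k : ℝ) < 1 := by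
        have := (hα E₁).1
        simp only [Multiset.map_zero, Multiset.sum_zero, zero_sub] at hv
        linarith
      have h3 : 0 < -k := by exact_mod_cast h1
      have h4 : -k < 1 := by exact_mod_cast h2
      omega
    · exact (min_le_right _ _).trans ((min_le_right _ _).trans (hmin E (hs E hE)))
    · have := hmax E (hs E hE)
      linarith

omit [Fintype S] in
/-- Enumeration of a multiset by an initial segment of the natural numbers. -/
theorem exists_seq_of_multiset (s : Multiset S) (hs : s ≠ 0) :
    ∃ f : ℕ → S, (∀ i, f i ∈ s) ∧ ∑ i ∈ Finset.range s.card, α (f i) = (s.map α).sum := by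
  obtain ⟨E₀, hE₀⟩ := Multiset.exists_mem_of_ne_zero hs
  refine ⟨fun i => s.toList.getD i E₀, fun i => ?_, ?_⟩
  · rcases Nat.lt_or_ge i s.toList.length with h | h
    · simp only [List.getD_eq_getElem _ _ h]
      exact Multiset.mem_toList.1 (List.getElem_mem h)
    · simp only [List.getD_eq_default _ _ h]
      exact hE₀
  · have h1 : (s.map α).sum = (s.toList.map α).sum := by
      conv_lhs => rw [← Multiset.coe_toList s]
      rw [Multiset.map_coe, Multiset.sum_coe]
    rw [h1, ← Multiset.length_toList, ← Fin.sum_univ_fun_getElem,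
      Finset.sum_range fun i => α (s.toList.getD i E₀)]
    exact Finset.sum_congr rfl fun i _ => by rw [List.getD_eq_getElem _ _ i.2]

end Weights

/-! ### Gadgets -/

section Gadget

variable {L : FirstOrder.Language.{u, v}} [Fintype (Σ n, L.Relations n)]
  {α : (Σ n, L.Relations n) → ℝ}

/-- A gadget: a finite hypergraph `T` with a base point `b` such that attaching `T` to a vertex
`b` of a structure lowers the rank of the structure by `d`, although no extension of `b` inside
`T` by at most `m` points has lower rank than `b`. -/
structure IsGadget (α : (Σ n, L.Relations n) → ℝ) {W : Type} [L.Structure W] (T : Set W) (b : W)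
    (m : ℕ) (d : ℝ) : Prop where
  hypergraph : IsHypergraph L W
  finite : T.Finite
  mem : b ∈ T
  nonneg : ∀ F ⊆ T, b ∉ F → 0 ≤ delta α F
  le_delta : ∀ F ⊆ T, b ∈ F → 1 - d ≤ delta α F
  one_le_delta : ∀ F ⊆ T, b ∈ F → F.ncard ≤ m + 1 → 1 ≤ delta α F
  delta_eq : delta α T = 1 - d

variable [L.IsRelational]

/-- The gadget that consists of the base point only. -/
theorem exists_trivial_gadget (har : ∀ E : Σ n, L.Relations n, 2 ≤ E.1) (m : ℕ) :
    ∃ (W : Type) (_ : L.Structure W) (T : Set W) (b : W), IsGadget α T b m 0 ∧ T.ncard = 1 := by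
  let S : L.Structure Unit := mkStr fun _ _ => False
  have hS : IsHypergraph L Unit := fun _ _ _ h => h.elim
  have h1 : delta α ({()} : Set Unit) = 1 := hS.delta_singleton har ()
  have h2 : ∀ F : Set Unit, () ∈ F → F = {()} := fun F hF => by
    ext x
    exact ⟨fun _ => rfl, fun _ => hF⟩
  refine ⟨Unit, S, {()}, (), ⟨hS, Set.finite_singleton _, rfl, fun F hF hb => ?_, fun F _ hb => ?_,
    fun F _ hb _ => ?_, by simpa using h1⟩, Set.ncard_singleton _⟩
  · have : F = ∅ := Set.eq_empty_of_forall_notMem fun x hx => hb hx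
    rw [this, delta_empty har]
  · rw [h2 F hb, h1]
    simp
  · rw [h2 F hb, h1]

/-- There is a gadget that lowers the rank by a positive amount `d ≤ ε`. It is a long cycle of
`K + 1` vertices carrying edges of total weight `K + d`; a subset of it with at most `m + 1` points
cannot lower the rank, since it could only do so by less than the gap `ε`. -/
theorem exists_small_gadget [Nonempty (Σ n, L.Relations n)]
    (har : ∀ E : Σ n, L.Relations n, 2 ≤ E.1) (hα : ∀ E, 0 < α E ∧ α E ≤ 1) {m : ℕ} {ε : ℝ}
    (hε : 0 < ε) (hε' : ∃ (s : Multiset (Σ n, L.Relations n)) (k : ℕ), ε = (s.map α).sum - k)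
    (hgap : IsGap α m ε) :
    ∃ d : ℝ, 0 < d ∧ d ≤ ε ∧
      ∃ (W : Type) (_ : L.Structure W) (T : Set W) (b : W), IsGadget α T b m d := by
  classical
  obtain ⟨v, s, k, hv0, hvε, hs, hv, hvs, hcase⟩ := exists_drop hα hε hε'
  obtain ⟨E₁, -, hE₁⟩ := Finset.exists_min_image Finset.univ α Finset.univ_nonempty
  obtain ⟨E₂, -, hE₂⟩ := Finset.exists_max_image Finset.univ
    (fun E : Σ n, L.Relations n => E.1) Finset.univ_nonempty
  set lo := α E₁ with hlo
  have hlo0 : 0 < lo := (hα _).1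
  set r := E₂.1
  obtain ⟨H, hH⟩ := exists_nat_ge (3 / lo + r)
  have hH' : 3 ≤ ((H : ℝ) - r) * lo := by
    rw [← div_le_iff₀ hlo0]
    linarith
  set σ := (s.map α).sum with hσ
  have hσ0 : 0 < σ := by
    obtain ⟨E, hE⟩ := Multiset.exists_mem_of_ne_zero hs
    have h1 := Multiset.single_le_sum (s := s.map α) (fun x hx => by
      obtain ⟨E, -, rfl⟩ := Multiset.mem_map.1 hx
      exact (hα E).1.le) (α E) (Multiset.mem_map_of_mem α hE)
    linarith [(hα E).1]
  -- With `v = ∑ α - k`, the multiset of edges is `j • s`, where `j` is large and `j * v` is just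
  -- above an integer `P`; then `j * σ - d` is an integer `K` for `d = j * v - P`, and `K ≥ C`.
  set C : ℝ := 2 * H + m + 1 + v with hC
  obtain ⟨P, hP⟩ := exists_nat_ge ((C + v) * v / σ)
  set j : ℕ := ⌊(P : ℝ) / v⌋₊ + 1 with hj
  have hj1 : (P : ℝ) < j * v := by
    rw [← div_lt_iff₀ hv0, hj]
    push_cast
    exact Nat.lt_floor_add_one _
  have hj2 : ((j : ℝ) - 1) * v ≤ P := by
    rw [← le_div_iff₀ hv0, hj]
    push_cast
    rw [add_sub_cancel_right]
    exact Nat.floor_le (by positivity)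
  set d : ℝ := j * v - P with hd
  have hd0 : 0 < d := by linarith
  have hdv : d ≤ v := by linarith
  have hKbig : C ≤ j * σ - d := by
    have h1 : (C + v) * v ≤ P * σ := (div_le_iff₀ hσ0).1 hP
    have h2 : (P : ℝ) * σ ≤ j * v * σ := mul_le_mul_of_nonneg_right hj1.le hσ0.le
    have h3 : (C + v) * v ≤ (j * σ) * v := by linarith
    have := le_of_mul_le_mul_right h3 hv0
    linarith
  have hKint : (j : ℝ) * σ - d = ((P + j * k : ℤ) : ℝ) := by
    rw [hd, hv]
    push_cast
    ring
  obtain ⟨K, hK⟩ : ∃ K : ℕ, (K : ℝ) = j * σ - d := by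
    have h1 : (0 : ℝ) ≤ ((P + j * k : ℤ) : ℝ) := by
      rw [← hKint]
      refine le_trans ?_ hKbig
      positivity
    have h2 : 0 ≤ (P + j * k : ℤ) := by exact_mod_cast h1
    refine ⟨(P + j * k : ℤ).toNat, ?_⟩
    rw [hKint]
    exact_mod_cast Int.toNat_of_nonneg h2
  have hKC : 2 * (H : ℝ) + m + 1 + v ≤ K := by rw [hK]; exact hKbig
  have hj0 : j ≠ 0 := by omega
  have hHr : (0 : ℝ) ≤ H := Nat.cast_nonneg _
  have hmr : (0 : ℝ) ≤ m := Nat.cast_nonneg _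
  have hKpos : (0 : ℝ) < K := by linarith
  have hns : j • s ≠ 0 := by
    rw [Ne, ← Multiset.card_eq_zero, Multiset.card_nsmul]
    have := Multiset.card_pos.2 hs
    positivity
  obtain ⟨f, hfs, hfsum⟩ := exists_seq_of_multiset (α := α) (j • s) hns
  have hfs' : ∀ i, f i ∈ s := fun i => Multiset.mem_of_mem_nsmul (hfs i)
  have hsum : ∑ i ∈ Finset.range (j • s).card, α (f i) = K + d := by
    rw [hfsum, Multiset.map_nsmul, Multiset.sum_nsmul, nsmul_eq_mul, hK]
    ring
  have hdK : d / K ≤ 1 := (div_le_one hKpos).2 (by linarith)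
  have hdK0 : 0 < d / K := div_pos hd0 hKpos
  -- the amount gained by a set that misses the base point
  obtain ⟨g, hg0, hg1, hg2, hg3⟩ : ∃ g : ℝ, 0 ≤ g ∧ (∀ i, g ≤ α (f i)) ∧
      (∀ i, g ≤ 1 + d / K - α (f i)) ∧ (g = d ∨ (∀ E, α E = 1) ∧ v = 1 ∧ g = d / K) := by
    rcases hcase with h | ⟨h, hv1⟩
    · exact ⟨d, hd0.le, fun i => hdv.trans (hvs _ (hfs' i)), fun i => by
        have := h _ (hfs' i)
        linarith, Or.inl rfl⟩
    · exact ⟨d / K, hdK0.le, fun i => by rw [h]; exact hdK, fun i => by rw [h]; linarith,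
        Or.inr ⟨h, hv1, rfl⟩⟩
  obtain ⟨S, hS, hS1, hS2, hS3⟩ := exists_cyclic_hypergraph (α := α) har (fun E => (hα E).2)
    hlo0 (fun E => hE₁ E (Finset.mem_univ E)) (s := f) (N := (j • s).card) (K := K) (H := H)
    (r := r) (d := d) (g := g) (fun E => hE₂ E (Finset.mem_univ E)) hH' (by
      have : ((2 * H : ℕ) : ℝ) < ((K + 1 : ℕ) : ℝ) := by
        push_cast
        linarith
      exact_mod_cast this) hd0 (by linarith) hsum hg0 hg1 hg2
  have hcard : ∀ F : Set (ZMod (K + 1)), F.ncard ≤ K + 1 := fun F => by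
    have := Set.ncard_le_ncard (Set.subset_univ F)
    rwa [Set.ncard_univ, Nat.card_zmod] at this
  refine ⟨d, hd0, hdv.trans hvε, ZMod (K + 1), S, Set.univ, 0, hS, Set.finite_univ, trivial,
    fun F _ hF => ?_, fun F _ hF => ?_, fun F _ hF hFm => ?_, hS1⟩
  · rcases F.eq_empty_or_nonempty with rfl | hne
    · rw [delta_empty har]
    have h1 := hS3 F hF hne
    have h2 : F.ncard ≤ K := by
      have : F.ncard < (Set.univ : Set (ZMod (K + 1))).ncard :=
        Set.ncard_lt_ncard ((Set.ssubset_univ_iff).2 fun h => hF (h ▸ trivial))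
      rw [Set.ncard_univ, Nat.card_zmod] at this
      omega
    have h3 : (F.ncard : ℝ) * (d / K) ≤ d := by
      have : (F.ncard : ℝ) ≤ K := by exact_mod_cast h2
      calc (F.ncard : ℝ) * (d / K) ≤ K * (d / K) := mul_le_mul_of_nonneg_right this hdK0.le
        _ = d := by field_simp
    rcases hg3 with h | ⟨hα1, hv1, h⟩
    · linarith
    · -- all ranks are integers and `-1 < δ(F)`
      obtain ⟨t, ht⟩ := delta_sub_eq (α := α) F.toFinite (Set.empty_subset F)
      rw [delta_empty har, sum_map_one fun E _ => hα1 E, sub_zero] at ht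
      have h4 : (-1 : ℝ) < ((F \ ∅).ncard : ℝ) - t.card := by linarith
      have h5 : (-1 : ℤ) < ((F \ ∅).ncard : ℤ) - t.card := by exact_mod_cast h4
      have h6 : (0 : ℤ) ≤ ((F \ ∅).ncard : ℤ) - t.card := by omega
      rw [ht]
      exact_mod_cast h6
  · have h1 := hS2 F hF
    have h2 : (F.ncard : ℝ) ≤ K + 1 := by exact_mod_cast hcard F
    have h3 : ((F.ncard : ℝ) - 1) * (d / K) ≤ d :=
      calc ((F.ncard : ℝ) - 1) * (d / K) ≤ K * (d / K) :=
            mul_le_mul_of_nonneg_right (by linarith) hdK0.le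
        _ = d := by field_simp
    linarith
  · by_contra hc
    have h1 := hS2 F hF
    obtain ⟨t, ht⟩ := delta_sub_eq (α := α) F.toFinite (Set.singleton_subset_iff.2 hF)
    rw [hS.delta_singleton har] at ht
    have hF1 : ((F \ {0}).ncard : ℝ) = F.ncard - 1 := by
      rw [eq_sub_iff_add_eq]
      exact_mod_cast Set.ncard_sdiff_singleton_add_one hF
    have hFm' : (F \ {0}).ncard ≤ m := by
      have := Set.ncard_sdiff_singleton_add_one hF
      omega
    have h2 := hgap t _ hFm' (by linarith)
    have h3 : ((F \ {0}).ncard : ℝ) ≤ m := by exact_mod_cast hFm'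
    have h4 : ((F \ {0}).ncard : ℝ) * (d / K) ≤ m * (d / K) :=
      mul_le_mul_of_nonneg_right h3 hdK0.le
    rw [hF1] at h4 h2 ht
    have h5 : (m : ℝ) * (d / K) < d := by
      rw [mul_div_assoc', div_lt_iff₀ hKpos, mul_comm]
      exact mul_lt_mul_of_pos_left (by linarith) hd0
    linarith

omit [Fintype (Σ n, L.Relations n)] [L.IsRelational] in
theorem IsHypergraph.not_relMap_of_subsingleton {M : Type w} [L.Structure M]
    (h : IsHypergraph L M) {n : ℕ} (hn : 2 ≤ n) {E : L.Relations n} {x : Fin n → M} {a : M}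
    (hx : ∀ i, x i = a) : ¬ RelMap E x := fun hE => by
  have := (h n E x hE).1 ((hx ⟨0, by omega⟩).trans (hx ⟨1, by omega⟩).symm)
  simp at this

omit [Fintype (Σ n, L.Relations n)] [L.IsRelational] in
theorem pemb_singleton {M : Type w} [L.Structure M] {N : Type w'} [L.Structure N]
    (har : ∀ E : Σ n, L.Relations n, 2 ≤ E.1) (hM : IsHypergraph L M) (hN : IsHypergraph L N)
    (f : M → N) (a : M) : PEmb L f {a} :=
  ⟨Set.injOn_singleton f a, fun n E _ hx => iff_of_false
    (hN.not_relMap_of_subsingleton (har ⟨n, E⟩) (a := f a) fun i => congrArg f (hx i))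
    (hM.not_relMap_of_subsingleton (har ⟨n, E⟩) hx)⟩

/-- Gadgets can be glued along their base points. -/
theorem IsGadget.wedge (har : ∀ E : Σ n, L.Relations n, 2 ≤ E.1) {W₁ W₂ : Type} [L.Structure W₁]
    [L.Structure W₂] {T₁ : Set W₁} {T₂ : Set W₂} {b₁ : W₁} {b₂ : W₂} {m : ℕ} {d₁ d₂ : ℝ}
    (h₁ : IsGadget α T₁ b₁ m d₁) (h₂ : IsGadget α T₂ b₂ m d₂) :
    ∃ (W : Type) (_ : L.Structure W) (T : Set W) (b : W), IsGadget α T b m (d₁ + d₂) ∧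
      T.ncard ≤ T₁.ncard + T₂.ncard := by
  obtain ⟨S, i, j, h⟩ := exists_isFreeAmalgam h₁.hypergraph h₂.hypergraph
    (pemb_singleton har h₂.hypergraph h₁.hypergraph (fun _ => b₁) b₂)
  have hb : j b₂ = i b₁ := h.eqOn b₂ rfl
  have hT : (i '' T₁ ∪ j '' T₂).Finite := (h₁.finite.image i).union (h₂.finite.image j)
  have hF : ∀ F ⊆ i '' T₁ ∪ j '' T₂, i ⁻¹' F ⊆ T₁ ∧ j ⁻¹' F ⊆ T₂ := fun F hF =>
    ⟨h.preimage_left_subset (fun _ _ => h₁.mem) hF,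
      h.preimage_right_subset (Set.singleton_subset_iff.2 h₂.mem) hF⟩
  have hδ : ∀ F ⊆ i '' T₁ ∪ j '' T₂, delta α F =
      delta α (i ⁻¹' F) + delta α (j ⁻¹' F) - delta α (j ⁻¹' F ∩ {b₂}) := fun F hF =>
    h.delta_eq_of_subset h₁.finite h₂.finite hF
  have hin : ∀ F : Set (W₁ ⊕ W₂), i b₁ ∈ F → delta α (j ⁻¹' F ∩ {b₂}) = 1 := fun F hF => by
    rw [Set.inter_eq_right.2 (Set.singleton_subset_iff.2 (by rw [Set.mem_preimage, hb]; exact hF)),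
      h₂.hypergraph.delta_singleton har]
  have hin' : ∀ F : Set (W₁ ⊕ W₂), i b₁ ∈ F → b₂ ∈ j ⁻¹' F := fun F hF => by
    rw [Set.mem_preimage, hb]
    exact hF
  refine ⟨W₁ ⊕ W₂, S, i '' T₁ ∪ j '' T₂, i b₁, ⟨h.hypergraph, hT, Or.inl ⟨b₁, h₁.mem, rfl⟩,
    fun F hFT hbF => ?_, fun F hFT hbF => ?_, fun F hFT hbF hm => ?_, ?_⟩, ?_⟩
  · have hb2 : b₂ ∉ j ⁻¹' F := by rwa [Set.mem_preimage, hb]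
    rw [hδ F hFT, Set.inter_singleton_eq_empty.2 hb2, delta_empty har]
    have := h₁.nonneg _ (hF F hFT).1 hbF
    have := h₂.nonneg _ (hF F hFT).2 hb2
    linarith
  · rw [hδ F hFT, hin F hbF]
    have := h₁.le_delta _ (hF F hFT).1 hbF
    have := h₂.le_delta _ (hF F hFT).2 (hin' F hbF)
    linarith
  · rw [hδ F hFT, hin F hbF]
    have hfin := hT.subset hFT
    have := h₁.one_le_delta _ (hF F hFT).1 hbF ((Set.ncard_le_ncard_of_injOn i (fun x hx => hx)
      h.left_injective.injOn hfin).trans hm)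
    have := h₂.one_le_delta _ (hF F hFT).2 (hin' F hbF) ((Set.ncard_le_ncard_of_injOn j
      (fun x hx => hx) h.right_injective.injOn hfin).trans hm)
    linarith
  · have hbT : i b₁ ∈ i '' T₁ ∪ j '' T₂ := Or.inl ⟨b₁, h₁.mem, rfl⟩
    rw [hδ _ subset_rfl, hin _ hbT]
    rw [(hF _ subset_rfl).1.antisymm fun x hx => Or.inl ⟨x, hx, rfl⟩,
      (hF _ subset_rfl).2.antisymm fun x hx => Or.inr ⟨x, hx, rfl⟩, h₁.delta_eq, h₂.delta_eq]
    ring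
  · exact (Set.ncard_union_le _ _).trans (add_le_add (Set.ncard_image_le h₁.finite)
      (Set.ncard_image_le h₂.finite))

/-- Gadgets of bounded size that lower the rank by any `d ∈ [0, 1]` up to an error below `ε`. -/
theorem exists_gadget [Nonempty (Σ n, L.Relations n)] (har : ∀ E : Σ n, L.Relations n, 2 ≤ E.1)
    (hα : ∀ E, 0 < α E ∧ α E ≤ 1) {m : ℕ} {ε : ℝ}
    (hε : 0 < ε) (hε' : ∃ (s : Multiset (Σ n, L.Relations n)) (k : ℕ), ε = (s.map α).sum - k)
    (hgap : IsGap α m ε) :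
    ∃ n₀ : ℕ, ∀ d : ℝ, 0 ≤ d → d ≤ 1 → ∃ d' ≤ d, d < d' + ε ∧
      ∃ (W : Type) (_ : L.Structure W) (T : Set W) (b : W), IsGadget α T b m d' ∧
        T.ncard ≤ n₀ := by
  obtain ⟨d₀, hd₀, hd₀ε, W₁, S₁, T₁, b₁, hT₁⟩ := exists_small_gadget har hα hε hε' hgap
  have hq : ∀ q : ℕ, ∃ (W : Type) (_ : L.Structure W) (T : Set W) (b : W),
      IsGadget α T b m (q * d₀) ∧ T.ncard ≤ q * T₁.ncard + 1 := by
    intro q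
    induction q with
    | zero =>
      obtain ⟨W, S, T, b, hT, hc⟩ := exists_trivial_gadget (α := α) har m
      exact ⟨W, S, T, b, by simpa using hT, by omega⟩
    | succ q ih =>
      obtain ⟨W, S, T, b, hT, hc⟩ := ih
      obtain ⟨W', S', T', b', hT', hc'⟩ := hT.wedge har hT₁
      refine ⟨W', S', T', b', ?_, ?_⟩
      · convert hT' using 1
        push_cast
        ring
      · rw [Nat.succ_mul]
        omega
  refine ⟨⌊1 / d₀⌋₊ * T₁.ncard + 1, fun d hd hd1 => ?_⟩
  obtain ⟨W, S, T, b, hT, hc⟩ := hq ⌊d / d₀⌋₊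
  have h1 := Nat.floor_le (div_nonneg hd hd₀.le)
  have h2 := Nat.lt_floor_add_one (d / d₀)
  rw [le_div_iff₀ hd₀] at h1
  rw [div_lt_iff₀ hd₀] at h2
  refine ⟨⌊d / d₀⌋₊ * d₀, h1, by linarith, W, S, T, b, hT, hc.trans ?_⟩
  have : ⌊d / d₀⌋₊ ≤ ⌊1 / d₀⌋₊ := Nat.floor_le_floor (div_le_div_of_nonneg_right hd1 hd₀.le)
  have := Nat.mul_le_mul_right T₁.ncard this
  omega

end Gadget

/-! ### `m`-strong subsets and the extension property -/

section MStrong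

variable {L : FirstOrder.Language.{u, v}} [Fintype (Σ n, L.Relations n)]
  {α : (Σ n, L.Relations n) → ℝ} {M : Type w} [L.Structure M] {N : Type w'} [L.Structure N]

/-- A bounded form of `A ≤ M`: no extension of `A` in `M` by at most `m` points has smaller
rank. -/
def MStrong (α : (Σ n, L.Relations n) → ℝ) (m : ℕ) (A : Set M) : Prop :=
  ∀ C : Set M, C.Finite → A ⊆ C → (C \ A).ncard ≤ m → delta α A ≤ delta α C

theorem MStrong.mono {m m' : ℕ} {A : Set M} (h : MStrong α m' A) (hm : m ≤ m') : MStrong α m A :=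
  fun C hC hAC hcard => h C hC hAC (hcard.trans hm)

theorem MStrong.strongIn {m : ℕ} {A B : Set M} (h : MStrong α m A) (hB : B.Finite) (hAB : A ⊆ B)
    (hm : (B \ A).ncard ≤ m) : StrongIn α A B :=
  ⟨hAB, fun C hAC hCB => h C (hB.subset hCB) hAC
    ((Set.ncard_le_ncard (Set.sdiff_subset_sdiff_left hCB) hB.sdiff).trans hm)⟩

theorem IsGap.delta_le {m : ℕ} {ε : ℝ} (h : IsGap α m ε) {A C : Set M} (hC : C.Finite)
    (hAC : A ⊆ C) (hm : (C \ A).ncard ≤ m) (hlt : delta α C < delta α A) :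
    delta α C ≤ delta α A - ε := by
  obtain ⟨s, hs⟩ := delta_sub_eq (α := α) hC hAC
  have := h s _ hm (by linarith)
  linarith

variable [L.IsRelational]

/-- The basic step of `exists_extension_mStrong`: the extension is by a set `F` of minimal rank
over `A`. A gadget is attached to a point `b` of `F \ A`; it uses up almost all of the rank of
`F` over `A`, so that a small extension of `F` of negative rank would contradict the choice of
`A`. -/
theorem exists_extension_of_minimal (har : ∀ E : Σ n, L.Relations n, 2 ≤ E.1)
    (hα : ∀ E, 0 ≤ α E) {m n₀ : ℕ} {ε : ℝ} (hgap : IsGap α m ε)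
    (hgad : ∀ d : ℝ, 0 ≤ d → d ≤ 1 → ∃ d' ≤ d, d < d' + ε ∧
      ∃ (W : Type) (_ : L.Structure W) (T : Set W) (b : W), IsGadget α T b m d' ∧ T.ncard ≤ n₀)
    (hN : N ⊨ theoryS (L := L) α) (hM : IsHypergraph L M) {A F : Set M} (hF : F.Finite)
    (hK : ∀ X ⊆ F, 0 ≤ delta α X) (hAF : StrongIn α A F)
    (hmin : ∀ X, A ⊆ X → X ⊆ F → X ≠ A → delta α F ≤ delta α X) {b : M} (hbF : b ∈ F)
    (hbA : b ∉ A) {f : M → N} (hf : PEmb L f A)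
    (hfA : MStrong α ((F \ A).ncard + n₀ + m) (f '' A)) :
    ∃ g : M → N, PEmb L g F ∧ Set.EqOn g f A ∧ MStrong α m (g '' F) := by
  have hA : A.Finite := hF.subset hAF.1
  obtain ⟨d', hd', hdd', W, SW, T, b₀, hT, hTn⟩ := hgad (delta α F - delta α A)
    (by linarith [hAF.2 F hAF.1 subset_rfl]) (by
      have h1 := hmin (insert b A) (Set.subset_insert b A) (Set.insert_subset hbF hAF.1)
        fun h => hbA (h ▸ Set.mem_insert b A)
      have h2 := delta_insert_le hα hA b
      linarith)
  obtain ⟨SD, i, j, h⟩ := exists_isFreeAmalgam hM hT.hypergraph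
    (pemb_singleton har hT.hypergraph hM (fun _ => b) b₀)
  have hjb : j b₀ = i b := h.eqOn b₀ rfl
  set D : Set (M ⊕ W) := i '' F ∪ j '' T with hD
  have hDfin : D.Finite := (hF.image i).union (hT.finite.image j)
  have hl : ∀ G ⊆ D, i ⁻¹' G ⊆ F := fun G hG => h.preimage_left_subset (fun _ _ => hbF) hG
  have hr : ∀ G ⊆ D, j ⁻¹' G ⊆ T := fun G hG =>
    h.preimage_right_subset (Set.singleton_subset_iff.2 hT.mem) hG
  have hδb : ∀ G ⊆ D, i b ∈ G → delta α G = delta α (i ⁻¹' G) + delta α (j ⁻¹' G) - 1 :=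
    fun G hG hb => by
      rw [h.delta_eq_of_subset hF hT.finite hG, Set.inter_eq_right.2
        (Set.singleton_subset_iff.2 (by rw [Set.mem_preimage, hjb]; exact hb)),
        hT.hypergraph.delta_singleton har]
  have hδb' : ∀ G ⊆ D, i b ∉ G → delta α G = delta α (i ⁻¹' G) + delta α (j ⁻¹' G) :=
    fun G hG hb => by
      rw [h.delta_eq_of_subset hF hT.finite hG, Set.inter_singleton_eq_empty.2
        (by rw [Set.mem_preimage, hjb]; exact hb), delta_empty har, sub_zero]
  have hδi : ∀ X : Set M, delta α (i '' X) = delta α X := fun X =>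
    delta_image (h.left.mono (Set.subset_univ X))
  have hAD : StrongIn α (i '' A) D := by
    refine ⟨(Set.image_mono hAF.1).trans Set.subset_union_left, fun G hAG hGD => ?_⟩
    rw [hδi]
    have hAi : A ⊆ i ⁻¹' G := Set.image_subset_iff.1 hAG
    by_cases hb : i b ∈ G
    · rw [hδb G hGD hb]
      have h1 := hmin (i ⁻¹' G) hAi (hl G hGD) fun he => hbA (he ▸ hb)
      have h2 := hT.le_delta _ (hr G hGD) (show j b₀ ∈ G by rwa [hjb])
      linarith
    · rw [hδb' G hGD hb]
      have h1 := hAF.2 (i ⁻¹' G) hAi (hl G hGD)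
      have h2 := hT.nonneg _ (hr G hGD) (show j b₀ ∉ G by rwa [hjb])
      linarith
  have hDK : ∀ X ⊆ D, 0 ≤ delta α X := by
    refine hAD.delta_nonneg hα hDfin fun X hX => ?_
    obtain ⟨Y, hY, rfl⟩ := Set.subset_image_iff.1 hX
    rw [hδi]
    exact hK Y (hY.trans hAF.1)
  have : Nonempty M := ⟨b⟩
  have hinv := Function.leftInverse_invFun h.left_injective
  obtain ⟨g', hg', hg'f⟩ := exists_extension hN h.hypergraph hDfin hDK hAD
    (f := f ∘ Function.invFun i) ((h.left.mono (Set.subset_univ A)).of_comp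
      (hf.congr fun x _ => congrArg f (hinv x).symm))
  have hFD : i '' F ⊆ D := Set.subset_union_left
  have hgf : Set.EqOn (g' ∘ i) f A := fun x hx =>
    (hg'f ⟨x, hx, rfl⟩).trans (congrArg f (hinv x))
  refine ⟨g' ∘ i, (hg'.mono hFD).comp (h.left.mono (Set.subset_univ F)), hgf,
    fun C hC hFC hCm => ?_⟩
  rw [Set.image_comp] at hFC hCm ⊢
  by_contra! hlt
  rw [delta_image (hg'.mono hFD), hδi] at hlt
  set G : Set (M ⊕ W) := D ∩ g' ⁻¹' C with hG
  have hGD : G ⊆ D := Set.inter_subset_left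
  have hFG : i '' F ⊆ G := Set.subset_inter hFD (Set.image_subset_iff.1 hFC)
  have hbG : i b ∈ G := hFG ⟨b, hbF, rfl⟩
  have hGC : g' '' G = C ∩ g' '' D := by
    rw [hG, Set.image_inter_preimage, Set.inter_comm]
  have hδG : delta α F ≤ delta α (C ∩ g' '' D) := by
    rw [← hGC, delta_image (hg'.mono hGD), hδb G hGD hbG,
      (hl G hGD).antisymm (Set.image_subset_iff.1 hFG)]
    have hb₀ : b₀ ∈ j ⁻¹' G := by rwa [Set.mem_preimage, hjb]
    have h1 : (j ⁻¹' G \ {b₀}).ncard ≤ m := by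
      refine (Set.ncard_le_ncard_of_injOn (t := C \ g' '' (i '' F)) (g' ∘ j) ?_ ?_
        hC.sdiff).trans hCm
      · rintro y ⟨hy, hyb⟩
        refine ⟨hy.2, ?_⟩
        rintro ⟨_, ⟨x, hx, rfl⟩, hxy⟩
        exact hyb (h.mem_of_eq x y (hg'.1 (hFD ⟨x, hx, rfl⟩) hy.1 hxy)).1
      · exact fun y hy y' hy' he => h.right_injective (hg'.1 hy.1.1 hy'.1.1 he)
    have h2 := Set.ncard_sdiff_singleton_add_one hb₀ (hT.finite.subset (hr G hGD))
    have h3 := hT.one_le_delta _ (hr G hGD) hb₀ (by omega)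
    linarith
  -- the part of `C` outside the image of `D` lowers the rank, hence lowers it by `ε`
  have hgapC : delta α C ≤ delta α (C ∩ g' '' D) - ε := by
    refine hgap.delta_le hC Set.inter_subset_left ?_ (by linarith)
    refine (Set.ncard_le_ncard (Set.sdiff_subset_sdiff_right ?_) hC.sdiff).trans hCm
    exact Set.subset_inter hFC (Set.image_mono hFD)
  have hsub := delta_union_add_inter_le hα hC (hDfin.image g')
  have hδD : delta α (g' '' D) = delta α F - d' := by
    rw [delta_image hg', hδb D subset_rfl (hFD ⟨b, hbF, rfl⟩),
      (hl D subset_rfl).antisymm fun x hx => hFD ⟨x, hx, rfl⟩,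
      (hr D subset_rfl).antisymm fun y hy => Or.inr ⟨y, hy, rfl⟩, hT.delta_eq]
    ring
  have hfAF : f '' A ⊆ g' '' (i '' F) := by
    rintro _ ⟨x, hx, rfl⟩
    exact ⟨i x, ⟨x, hAF.1 hx, rfl⟩, hgf hx⟩
  -- now `C ∪ g' '' D` has rank below that of `A`, since `d'` is within `ε` of `δ(F) - δ(A)`
  have hlast := hfA (C ∪ g' '' D) (hC.union (hDfin.image g'))
    (hfAF.trans (hFC.trans Set.subset_union_left)) (by
      have hsub : (C ∪ g' '' D) \ f '' A ⊆
          (g' '' (i '' (F \ A)) ∪ g' '' (j '' T)) ∪ (C \ g' '' (i '' F)) := by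
        rintro z ⟨hz, hzA⟩
        by_cases hzF : z ∈ g' '' (i '' F)
        · obtain ⟨_, ⟨x, hx, rfl⟩, rfl⟩ := hzF
          exact Or.inl (Or.inl ⟨i x, ⟨x, ⟨hx, fun hxA => hzA ⟨x, hxA, (hgf hxA).symm⟩⟩, rfl⟩, rfl⟩)
        · rcases hz with hz | ⟨_, hz | hz, rfl⟩
          · exact Or.inr ⟨hz, hzF⟩
          · exact absurd ⟨_, hz, rfl⟩ hzF
          · exact Or.inl (Or.inr ⟨_, hz, rfl⟩)
      have hFA : (F \ A).Finite := hF.sdiff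
      have f1 : (g' '' (i '' (F \ A))).Finite := (hFA.image i).image g'
      have f2 : (g' '' (j '' T)).Finite := (hT.finite.image j).image g'
      refine (Set.ncard_le_ncard hsub ((f1.union f2).union hC.sdiff)).trans ?_
      refine (Set.ncard_union_le _ _).trans (add_le_add ((Set.ncard_union_le _ _).trans
        (add_le_add ?_ ?_)) hCm)
      · exact (Set.ncard_image_le (hFA.image i)).trans (Set.ncard_image_le hFA)
      · exact (Set.ncard_image_le (hT.finite.image j)).trans
          ((Set.ncard_image_le hT.finite).trans hTn))
  rw [delta_image hf] at hlast
  linarith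

/-- Strong extensions of bounded size of a sufficiently strong finite subset of a model of `S_α`
can be realized in the model by `m`-strong subsets. The strength needed does not depend on the
size of the base `A`. -/
theorem exists_extension_mStrong [Nonempty (Σ n, L.Relations n)]
    (har : ∀ E : Σ n, L.Relations n, 2 ≤ E.1) (hα : ∀ E, 0 < α E ∧ α E ≤ 1) (k m : ℕ) :
    ∃ m' ≥ m, ∀ (M : Type w) [L.Structure M] (N : Type w') [L.Structure N],
      N ⊨ theoryS (L := L) α → IsHypergraph L M → ∀ (A B : Set M), B.Finite →
      (∀ X ⊆ B, 0 ≤ delta α X) → StrongIn α A B → (B \ A).ncard ≤ k → ∀ f : M → N, PEmb L f A →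
      MStrong α m' (f '' A) → ∃ g : M → N, PEmb L g B ∧ Set.EqOn g f A ∧ MStrong α m (g '' B) := by
  have hα0 : ∀ E, 0 ≤ α E := fun E => (hα E).1.le
  induction k generalizing m with
  | zero =>
    refine ⟨m, le_rfl, fun M _ N _ _ _ A B hB _ hAB hk f hf hfA => ?_⟩
    have : B = A := by
      have h1 : B \ A = ∅ := (Set.ncard_eq_zero hB.sdiff).1 (by omega)
      exact (Set.sdiff_eq_empty.1 h1).antisymm hAB.1
    subst this
    exact ⟨f, hf, fun _ _ => rfl, hfA⟩
  | succ k ih =>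
    obtain ⟨m₁, hm₁, ih⟩ := ih m
    obtain ⟨ε, hε, hε', hgap⟩ := exists_gap (α := α) (fun E => (hα E).1) m₁
    obtain ⟨n₀, hgad⟩ := exists_gadget har hα hε hε' hgap
    refine ⟨(k + 1) + n₀ + m₁, by omega, fun M _ N _ hN hM A B hB hK hAB hk f hf hfA => ?_⟩
    by_cases hBA : B = A
    · subst hBA
      exact ⟨f, hf, fun _ _ => rfl, hfA.mono (by omega)⟩
    -- a proper extension of `A` inside `B` of least rank
    obtain ⟨F, ⟨hAF, hFB, hFA⟩, hmin⟩ := Set.exists_min_image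
      {X : Set M | A ⊆ X ∧ X ⊆ B ∧ X ≠ A} (delta α) (hB.finite_subsets.subset fun X hX => hX.2.1)
      ⟨B, hAB.1, subset_rfl, hBA⟩
    have hF : F.Finite := hB.subset hFB
    obtain ⟨b, hbF, hbA⟩ := Set.exists_of_ssubset (hAF.ssubset_of_ne hFA.symm)
    have hbBA : b ∈ B \ A := ⟨hFB hbF, hbA⟩
    obtain ⟨g₁, hg₁, hg₁f, hg₁s⟩ := exists_extension_of_minimal har hα0 hgap hgad hN hM hF
      (fun X hX => hK X (hX.trans hFB)) (hAB.mono hAF hFB)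
      (fun X hAX hXF hXA => hmin X ⟨hAX, hXF.trans hFB, hXA⟩) hbF hbA hf
      (hfA.mono (by
        have := Set.ncard_le_ncard (Set.sdiff_subset_sdiff_left (t := A) hFB) hB.sdiff
        omega))
    have hFB' : StrongIn α F B := ⟨hFB, fun X hFX hXB => hmin X ⟨hAF.trans hFX, hXB, fun h =>
      hFA ((hFX.trans h.subset).antisymm hAF)⟩⟩
    obtain ⟨g, hg, hgg₁, hgs⟩ := ih M N hN hM F B hB hK hFB' (by
      have h1 : (B \ F).ncard < (B \ A).ncard := by
        refine Set.ncard_lt_ncard ?_ hB.sdiff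
        refine (Set.ssubset_iff_of_subset (Set.sdiff_subset_sdiff_right hAF)).2 ⟨b, hbBA, ?_⟩
        exact fun h => h.2 hbF
      omega) g₁ hg₁ hg₁s
    exact ⟨g, hg, fun x hx => (hgg₁ (hAF hx)).trans (hg₁f hx), hgs⟩

end MStrong

/-! ### Back and forth between models -/

section BackAndForth

variable {L : FirstOrder.Language.{u, v}} [Fintype (Σ n, L.Relations n)]
  {α : (Σ n, L.Relations n) → ℝ}

/-- Adding a point to a sufficiently strong set `A` leads, by a bounded number of further points,
to an `m`-strong set: each failure of `m`-strength lowers the rank by at least a fixed amount. -/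
theorem exists_mStrong_insert [Nonempty (Σ n, L.Relations n)] (hα : ∀ E, 0 < α E) (m : ℕ) :
    ∃ m' : ℕ, ∀ (M : Type w) [L.Structure M] (A : Set M), A.Finite → MStrong α m' A → ∀ c : M,
      ∃ Z : Set M, Z.Finite ∧ insert c A ⊆ Z ∧ (Z \ A).ncard ≤ m' ∧ MStrong α m Z := by
  obtain ⟨ε, hε, -, hgap⟩ := exists_gap hα m
  obtain ⟨J, hJ⟩ := exists_nat_gt (1 / ε)
  rw [div_lt_iff₀ hε] at hJ
  refine ⟨1 + m * J, fun M _ A hA hAm c => ?_⟩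
  by_contra! hno
  have key : ∀ j ≤ J, ∃ Z : Set M, Z.Finite ∧ insert c A ⊆ Z ∧ (Z \ A).ncard ≤ 1 + m * j ∧
      delta α Z ≤ delta α A + 1 - j * ε := by
    intro j
    induction j with
    | zero =>
      intro _
      refine ⟨insert c A, hA.insert c, subset_rfl, ?_, by
        simpa using delta_insert_le (fun E => (hα E).le) hA c⟩
      refine (Set.ncard_le_ncard (t := {c}) ?_).trans (by simp)
      rintro x ⟨rfl | hx, hxA⟩
      · rfl
      · exact absurd hx hxA
    | succ j ih =>
      intro hj
      obtain ⟨Z, hZ, hAZ, hcard, hδ⟩ := ih (by omega)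
      have hmul := Nat.mul_le_mul_left m hj
      have hns := hno Z hZ hAZ (by rw [Nat.mul_succ] at hmul; omega)
      simp only [MStrong, not_forall, not_le] at hns
      obtain ⟨C, hC, hZC, hCm, hlt⟩ := hns
      have h1 := hgap.delta_le hC hZC hCm hlt
      refine ⟨C, hC, hAZ.trans hZC, ?_, by push_cast; linarith⟩
      have h2 : C \ A ⊆ (C \ Z) ∪ (Z \ A) := fun x hx => by
        by_cases hxZ : x ∈ Z
        · exact Or.inr ⟨hxZ, hx.2⟩
        · exact Or.inl ⟨hx.1, hxZ⟩
      have h3 := (Set.ncard_le_ncard h2 (hC.sdiff.union hZ.sdiff)).trans (Set.ncard_union_le _ _)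
      rw [Nat.mul_succ]
      omega
  obtain ⟨Z, hZ, hAZ, hcard, hδ⟩ := key J le_rfl
  have := hAm Z hZ ((Set.subset_insert c A).trans hAZ) hcard
  linarith

variable [L.IsRelational] {M : Type w} [L.Structure M] {N : Type w'} [L.Structure N]

/-- The forth step: an isomorphism between sufficiently strong finite sets extends to an
isomorphism between `m`-strong finite sets whose domain contains a given point. -/
theorem exists_forth [Nonempty (Σ n, L.Relations n)] (har : ∀ E : Σ n, L.Relations n, 2 ≤ E.1)
    (hα : ∀ E, 0 < α E ∧ α E ≤ 1) (m : ℕ) :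
    ∃ m' : ℕ, ∀ (M : Type w) [L.Structure M] (N : Type w') [L.Structure N],
      M ⊨ theoryS (L := L) α → N ⊨ theoryS (L := L) α → ∀ A : Set M, A.Finite → ∀ f : M → N,
      PEmb L f A → MStrong α m' A → MStrong α m' (f '' A) → ∀ c : M, ∃ (A' : Set M) (g : M → N),
        A'.Finite ∧ A ⊆ A' ∧ c ∈ A' ∧ PEmb L g A' ∧ Set.EqOn g f A ∧ MStrong α m A' ∧
          MStrong α m (g '' A') := by
  obtain ⟨k, hk⟩ := exists_mStrong_insert.{u, v, w} (fun E => (hα E).1) m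
  obtain ⟨m₁, -, hm₁⟩ := exists_extension_mStrong.{u, v, w, w'} har hα k m
  refine ⟨max k m₁, fun M _ N _ hM hN A hA f hf hAs hfAs c => ?_⟩
  obtain ⟨Z, hZ, hAZ, hZk, hZs⟩ := hk M A hA (hAs.mono (le_max_left _ _)) c
  have hMK := inKbar_of_models hM
  have hAZ' := (Set.subset_insert c A).trans hAZ
  obtain ⟨g, hg, hgf, hgs⟩ := hm₁ M N hN hMK.1 A Z hZ (fun X hX => hMK.2 X (hZ.subset hX))
    ((hAs.mono (le_max_left k m₁)).strongIn hZ hAZ' hZk) hZk f hf (hfAs.mono (le_max_right _ _))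
  exact ⟨Z, g, hZ, hAZ', hAZ (Set.mem_insert c A), hg, hgf, hZs, hgs⟩

/-- The back step, obtained from the forth step by inverting the isomorphism. -/
theorem exists_back [Nonempty (Σ n, L.Relations n)] (har : ∀ E : Σ n, L.Relations n, 2 ≤ E.1)
    (hα : ∀ E, 0 < α E ∧ α E ≤ 1) (m : ℕ) :
    ∃ m' : ℕ, ∀ (M : Type w) [L.Structure M] (N : Type w') [L.Structure N],
      M ⊨ theoryS (L := L) α → N ⊨ theoryS (L := L) α → Nonempty M → ∀ A : Set M, A.Finite →
      ∀ f : M → N, PEmb L f A → MStrong α m' A → MStrong α m' (f '' A) → ∀ c : N,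
        ∃ (A' : Set M) (g : M → N), A'.Finite ∧ A ⊆ A' ∧ c ∈ g '' A' ∧ PEmb L g A' ∧
          Set.EqOn g f A ∧ MStrong α m A' ∧ MStrong α m (g '' A') := by
  obtain ⟨m', hm'⟩ := exists_forth.{u, v, w', w} har hα m
  refine ⟨m', fun M _ N _ hM hN _ A hA f hf hAs hfAs c => ?_⟩
  have hl : Set.LeftInvOn (Function.invFunOn f A) f A := hf.1.leftInvOn_invFunOn
  have himg : Function.invFunOn f A '' (f '' A) = A := hl.image_image
  obtain ⟨Z, r, hZ, hAZ, hcZ, hr, hrf, hZs, hrs⟩ := hm' N M hN hM (f '' A) (hA.image f)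
    (Function.invFunOn f A) (hf.leftInv hl) hfAs (by rwa [himg]) c
  have : Nonempty N := ⟨c⟩
  have hl' : Set.LeftInvOn (Function.invFunOn r Z) r Z := hr.1.leftInvOn_invFunOn
  have hrfA : ∀ a ∈ A, r (f a) = a := fun a ha => (hrf ⟨a, ha, rfl⟩).trans (hl ha)
  have himg' : Function.invFunOn r Z '' (r '' Z) = Z := hl'.image_image
  refine ⟨r '' Z, Function.invFunOn r Z, hZ.image r, fun a ha =>
    ⟨f a, hAZ ⟨a, ha, rfl⟩, hrfA a ha⟩, by rwa [himg'], hr.leftInv hl', fun a ha => ?_, hrs,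
    by rwa [himg']⟩
  have := hl' (hAZ ⟨a, ha, rfl⟩)
  rwa [hrfA a ha] at this

omit [Fintype (Σ n, L.Relations n)] in
theorem realize_term_comp {β : Type*} (f : M → N) (t : L.Term β) (v : β → M) :
    t.realize (f ∘ v) = f (t.realize v) := by
  cases t with
  | var x => rfl
  | func F ts => exact isEmptyElim F

omit [Fintype (Σ n, L.Relations n)] in
theorem realize_term_mem {β : Type*} (t : L.Term β) {v : β → M} {A : Set M} (hv : ∀ b, v b ∈ A) :
    t.realize v ∈ A := by
  cases t with
  | var x => exact hv x
  | func F ts => exact isEmptyElim F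

/-- Isomorphisms between sufficiently strong finite subsets of models of `S_α` preserve the truth
of a given formula. -/
theorem realize_iff_of_mStrong [Nonempty (Σ n, L.Relations n)]
    (har : ∀ E : Σ n, L.Relations n, 2 ≤ E.1) (hα : ∀ E, 0 < α E ∧ α E ≤ 1) {β : Type*} {n : ℕ}
    (φ : L.BoundedFormula β n) :
    ∃ m : ℕ, ∀ (M : Type w) [L.Structure M] (N : Type w') [L.Structure N],
      M ⊨ theoryS (L := L) α → N ⊨ theoryS (L := L) α → Nonempty M → ∀ A : Set M, A.Finite →
      ∀ f : M → N, PEmb L f A → MStrong α m A → MStrong α m (f '' A) → ∀ (v : β → M)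
      (xs : Fin n → M), (∀ b, v b ∈ A) → (∀ i, xs i ∈ A) →
        (φ.Realize v xs ↔ φ.Realize (f ∘ v) (f ∘ xs)) := by
  induction φ with
  | falsum => exact ⟨0, fun _ _ _ _ _ _ _ _ _ _ _ _ _ _ _ _ _ => Iff.rfl⟩
  | equal t₁ t₂ =>
    refine ⟨0, fun M _ N _ _ _ _ A _ f hf _ _ v xs hv hxs => ?_⟩
    have hvx : ∀ b, Sum.elim v xs b ∈ A := fun b => by
      rcases b with b | b
      · exact hv b
      · exact hxs b
    change t₁.realize _ = t₂.realize _ ↔ t₁.realize _ = t₂.realize _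
    rw [← Sum.comp_elim, realize_term_comp, realize_term_comp]
    exact ⟨congrArg f, fun h => hf.1 (realize_term_mem _ hvx) (realize_term_mem _ hvx) h⟩
  | rel R ts =>
    refine ⟨0, fun M _ N _ _ _ _ A _ f hf _ _ v xs hv hxs => ?_⟩
    have hvx : ∀ b, Sum.elim v xs b ∈ A := fun b => by
      rcases b with b | b
      · exact hv b
      · exact hxs b
    change RelMap R (fun i => (ts i).realize _) ↔ RelMap R (fun i => (ts i).realize _)
    rw [← Sum.comp_elim]
    simp only [realize_term_comp]
    exact (hf.2 _ R _ fun i => realize_term_mem _ hvx).symm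
  | imp φ ψ ih₁ ih₂ =>
    obtain ⟨m₁, h₁⟩ := ih₁
    obtain ⟨m₂, h₂⟩ := ih₂
    refine ⟨max m₁ m₂, fun M _ N _ hM hN hne A hA f hf hAs hfAs v xs hv hxs => ?_⟩
    exact imp_congr
      (h₁ M N hM hN hne A hA f hf (hAs.mono (le_max_left _ _)) (hfAs.mono (le_max_left _ _)) v xs
        hv hxs)
      (h₂ M N hM hN hne A hA f hf (hAs.mono (le_max_right _ _)) (hfAs.mono (le_max_right _ _)) v xs
        hv hxs)
  | @all n φ ih =>
    obtain ⟨m, hm⟩ := ih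
    obtain ⟨m₁, h₁⟩ := exists_forth.{u, v, w, w'} har hα m
    obtain ⟨m₂, h₂⟩ := exists_back.{u, v, w, w'} har hα m
    refine ⟨max m₁ m₂, fun M _ N _ hM hN hne A hA f hf hAs hfAs v xs hv hxs => ?_⟩
    have key : ∀ (A' : Set M) (g : M → N) (c : M), A'.Finite → A ⊆ A' → c ∈ A' → PEmb L g A' →
        Set.EqOn g f A → MStrong α m A' → MStrong α m (g '' A') →
        (φ.Realize v (Fin.snoc xs c) ↔ φ.Realize (f ∘ v) (Fin.snoc (f ∘ xs) (g c))) := by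
      intro A' g c hA' hAA' hc hg hgf hs hs'
      have h1 := hm M N hM hN hne A' hA' g hg hs hs' v (Fin.snoc xs c) (fun b => hAA' (hv b))
        (fun i => by
          refine Fin.lastCases ?_ (fun i => ?_) i
          · simpa using hc
          · simpa using hAA' (hxs i))
      rw [h1, Fin.comp_snoc, show g ∘ v = f ∘ v from funext fun b => hgf (hv b),
        show g ∘ xs = f ∘ xs from funext fun i => hgf (hxs i)]
    rw [Language.BoundedFormula.realize_all, Language.BoundedFormula.realize_all]
    constructor
    · intro h c
      obtain ⟨A', g, hA', hAA', ⟨d, hd, rfl⟩, hg, hgf, hs, hs'⟩ := h₂ M N hM hN hne A hA f hf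
        (hAs.mono (le_max_right _ _)) (hfAs.mono (le_max_right _ _)) c
      exact (key A' g d hA' hAA' hd hg hgf hs hs').1 (h d)
    · intro h c
      obtain ⟨A', g, hA', hAA', hc, hg, hgf, hs, hs'⟩ := h₁ M N hM hN A hA f hf
        (hAs.mono (le_max_left _ _)) (hfAs.mono (le_max_left _ _)) c
      exact (key A' g c hA' hAA' hc hg hgf hs hs').2 (h (g c))

omit [L.IsRelational] in
theorem mStrong_empty (har : ∀ E : Σ n, L.Relations n, 2 ≤ E.1) (hM : InKbar α M) (m : ℕ) :
    MStrong α m (∅ : Set M) := fun C hC _ _ => by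
  rw [delta_empty har]
  exact hM.2 C hC

/-- Any two models of `S_α` are elementarily equivalent. -/
theorem realize_sentence_iff_of_models [Nonempty (Σ n, L.Relations n)]
    (har : ∀ E : Σ n, L.Relations n, 2 ≤ E.1) (hα : ∀ E, 0 < α E ∧ α E ≤ 1) [Nonempty M]
    [Nonempty N] (hM : M ⊨ theoryS (L := L) α) (hN : N ⊨ theoryS (L := L) α) (φ : L.Sentence) :
    M ⊨ φ ↔ N ⊨ φ := by
  obtain ⟨m, hm⟩ := realize_iff_of_mStrong.{u, v, w, w'} har hα φ
  have h := hm M N hM hN ‹_› ∅ Set.finite_empty (fun _ => Classical.arbitrary N)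
    ⟨Set.injOn_empty _, fun n E x hx => by
      have := har ⟨n, E⟩
      exact (hx ⟨0, by simp only at this; omega⟩).elim⟩
    (mStrong_empty har (inKbar_of_models hM) m)
    (by rw [Set.image_empty]; exact mStrong_empty har (inKbar_of_models hN) m)
    default default (fun b => b.elim) (fun i => i.elim0)
  unfold Language.Sentence.Realize Language.Formula.Realize
  rw [h]
  exact iff_of_eq (by congr 1 <;> exact Subsingleton.elim _ _)

end BackAndForth

/-! ### Algebraic closure -/

section AlgebraicClosure

variable {L : FirstOrder.Language.{u, v}} [Fintype (Σ n, L.Relations n)]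
  {α : (Σ n, L.Relations n) → ℝ} {M : Type w} [L.Structure M]

/-- `X` is closed under minimal pairs if and only if it is strong in all its finite extensions. -/
theorem minimalPair_closed_iff {X : Set M} :
    (∀ B C : Set M, B.Finite → C.Finite → MinimalPair α B C → B ⊆ X → C ⊆ X) ↔
      ∀ B : Set M, B.Finite → StrongIn α (B ∩ X) B := by
  constructor
  · intro h B hB
    by_contra hns
    have hns' : ∃ C, B ∩ X ⊆ C ∧ C ⊆ B ∧ delta α C < delta α (B ∩ X) := by
      by_contra! hno
      exact hns ⟨Set.inter_subset_left, hno⟩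
    obtain ⟨C, ⟨hBC, hCB, hlt⟩, hmin⟩ := Set.exists_min_image
      {C : Set M | B ∩ X ⊆ C ∧ C ⊆ B ∧ delta α C < delta α (B ∩ X)} Set.ncard
      (hB.finite_subsets.subset fun C hC => hC.2.1) hns'
    have hC : C.Finite := hB.subset hCB
    have hpair : MinimalPair α (B ∩ X) C := by
      refine ⟨hBC, fun D hBD hDC => ⟨hBD, fun F hBF hFD => ?_⟩, fun hs => ?_⟩
      · by_contra! hF
        have h1 := hmin F ⟨hBF, hFD.trans (hDC.subset.trans hCB), hF⟩
        have h2 := Set.ncard_lt_ncard (hFD.trans_ssubset hDC) hC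
        omega
      · exact absurd (hs.2 C hBC subset_rfl) (not_le.2 hlt)
    have hCX := h (B ∩ X) C (hB.subset Set.inter_subset_left) hC hpair Set.inter_subset_right
    have : C = B ∩ X := (Set.subset_inter hCB hCX).antisymm hBC
    rw [this] at hlt
    exact lt_irrefl _ hlt
  · intro h B C hB hC hpair hBX
    by_contra hCX
    have hss : C ∩ X ⊂ C := Set.ssubset_of_ssubset_of_subset
      (Set.inter_subset_left.ssubset_of_ne fun he => hCX (Set.inter_eq_left.1 he)) subset_rfl
    have h1 := (hpair.2.1 (C ∩ X) (Set.subset_inter hpair.1 hBX) hss).2 _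
      (Set.subset_inter hpair.1 hBX) subset_rfl
    refine hpair.2.2 ⟨hpair.1, fun D hBD hDC => ?_⟩
    by_cases hD : D = C
    · rw [hD]
      exact h1.trans ((h C hC).2 C Set.inter_subset_left subset_rfl)
    · exact (hpair.2.1 D hBD (hDC.ssubset_of_ne hD)).2 D hBD subset_rfl

variable [L.IsRelational]

/-- Algebraically closed sets are closed under minimal pairs: a minimal pair `(B, C)` has only
finitely many copies over `B`, since each copy that is not covered by the previous ones lowers the
rank of their union by a fixed amount. -/
theorem IsAlgClosedSet.minimalPair_closed (hα : ∀ E, 0 ≤ α E) (hM : InKbar α M) {X : Set M}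
    (hX : IsAlgClosedSet L X) {B C : Set M} (hB : B.Finite) (hC : C.Finite)
    (hBC : MinimalPair α B C) (hBX : B ⊆ X) : C ⊆ X := by
  classical
  obtain ⟨n, S, h, hh, hr⟩ := exists_fin_pemb (L := L) hC
  have hhC : h '' Set.univ = C := by rw [Set.image_univ, hr]
  let D : Set (Fin n → M) := {w | PEmb L w Set.univ} ∩ ⋂ i : Fin n,
    if h i ∈ B then {w | w i = h i} else Set.univ
  have hDmem : ∀ w ∈ D, PEmb L w Set.univ ∧ ∀ i, h i ∈ B → w i = h i := fun w hw => by
    refine ⟨hw.1, fun i hi => ?_⟩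
    have := Set.mem_iInter.1 hw.2 i
    rwa [if_pos hi] at this
  have hhD : h ∈ D := ⟨hh, Set.mem_iInter.2 fun i => by split_ifs <;> trivial⟩
  have hdef : X.Definable L D := by
    refine Set.Definable.inter ?_ (Set.definable_iInter_of_finite fun i => ?_)
    · refine Set.Definable.mono (A := ∅) ?_ (Set.empty_subset X)
      rw [Set.empty_definable_iff]
      refine ⟨atomicDiagram (_root_.id : Fin n → Fin n), ?_⟩
      ext w
      exact (realize_atomicDiagram_id w).symm
    · split_ifs with hi
      · exact (Set.Definable.singleton_of_mem L (hBX hi)).preimage_comp fun _ : Fin 1 => i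
      · exact Set.definable_univ
  have hdelta : delta α C < delta α B := by
    by_contra! hle
    refine hBC.2.2 ⟨hBC.1, fun F hBF hFC => ?_⟩
    by_cases hF : F = C
    · rwa [hF]
    · exact (hBC.2.1 F hBF (hFC.ssubset_of_ne hF)).2 F hBF subset_rfl
  have hfin : (⋃ w ∈ D, Set.range w).Finite := by
    by_contra hinf
    have key : ∀ j : ℕ, ∃ Z : Set M, Z.Finite ∧ B ⊆ Z ∧
        delta α Z ≤ delta α B - j * (delta α B - delta α C) := by
      intro j
      induction j with
      | zero => exact ⟨B, hB, subset_rfl, by simp⟩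
      | succ j ih =>
        obtain ⟨Z, hZ, hBZ, hδ⟩ := ih
        have hex : ∃ w ∈ D, ¬ Set.range w ⊆ Z := by
          by_contra! hno
          exact hinf (hZ.subset (Set.iUnion₂_subset hno))
        obtain ⟨w, hw, hwZ⟩ := hex
        obtain ⟨hwe, hwB⟩ := hDmem w hw
        refine ⟨Z ∪ Set.range w, hZ.union (Set.finite_range w), hBZ.trans Set.subset_union_left, ?_⟩
        have h1 := delta_union_add_inter_le hα hZ (Set.finite_range w)
        have h2 : delta α (Set.range w) = delta α C := by
          rw [← Set.image_univ, delta_image hwe, ← hhC, delta_image hh]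
        have h3 : delta α (Z ∩ Set.range w) = delta α (h '' (w ⁻¹' Z)) := by
          rw [← Set.image_preimage_eq_inter_range, delta_image (hwe.mono (Set.subset_univ _)),
            delta_image (hh.mono (Set.subset_univ _))]
        have h4 : delta α B ≤ delta α (h '' (w ⁻¹' Z)) := by
          have hBh : B ⊆ h '' (w ⁻¹' Z) := fun b hb => by
            obtain ⟨i, rfl⟩ : b ∈ Set.range h := hr ▸ hBC.1 hb
            exact ⟨i, by rw [Set.mem_preimage, hwB i hb]; exact hBZ hb, rfl⟩
          refine (hBC.2.1 _ hBh ?_).2 _ hBh subset_rfl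
          rw [← hhC]
          refine (Set.image_mono (Set.subset_univ _)).ssubset_of_ne fun he => hwZ ?_
          rintro _ ⟨i, rfl⟩
          obtain ⟨i', hi', he'⟩ := he.symm.subset ⟨i, trivial, rfl⟩
          rw [← hh.1 trivial trivial he']
          exact hi'
        push_cast
        linarith
    obtain ⟨j, hj⟩ := exists_nat_gt (delta α B / (delta α B - delta α C))
    rw [div_lt_iff₀ (by linarith)] at hj
    obtain ⟨Z, hZ, -, hδ⟩ := key j
    have := hM.2 Z hZ
    linarith
  rw [← hr]
  rintro _ ⟨i, rfl⟩
  refine hX ((fun w : Fin n → M => w i) '' D) ?_ (hfin.subset ?_) ⟨h, hhD, rfl⟩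
  · have := hdef.image_comp (fun _ : Fin 1 => i)
    unfold Set.Definable₁
    convert this using 1
    ext x
    constructor
    · rintro ⟨w, hw, hwx⟩
      exact ⟨w, hw, funext fun k => by rw [Subsingleton.elim k 0]; exact hwx⟩
    · rintro ⟨w, hw, rfl⟩
      exact ⟨w, hw, rfl⟩
  · rintro _ ⟨w, hw, rfl⟩
    exact Set.mem_iUnion₂.2 ⟨w, hw, i, rfl⟩

omit [L.IsRelational] in
/-- Finite subsets of a closed set `X` are contained in finite `m`-strong subsets of `X`. -/
theorem exists_mStrong_of_closed [Nonempty (Σ n, L.Relations n)] (hα : ∀ E, 0 < α E) (m : ℕ)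
    (hM : InKbar α M) {X : Set M} (hX : ∀ B : Set M, B.Finite → StrongIn α (B ∩ X) B)
    {A : Set M} (hA : A.Finite) (hAX : A ⊆ X) :
    ∃ Z : Set M, Z.Finite ∧ A ⊆ Z ∧ Z ⊆ X ∧ MStrong α m Z := by
  obtain ⟨ε, hε, -, hgap⟩ := exists_gap hα m
  by_contra! hno
  have key : ∀ j : ℕ, ∃ Z : Set M, Z.Finite ∧ A ⊆ Z ∧ Z ⊆ X ∧ delta α Z ≤ delta α A - j * ε := by
    intro j
    induction j with
    | zero => exact ⟨A, hA, subset_rfl, hAX, by simp⟩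
    | succ j ih =>
      obtain ⟨Z, hZ, hAZ, hZX, hδ⟩ := ih
      have hns := hno Z hZ hAZ hZX
      simp only [MStrong, not_forall, not_le] at hns
      obtain ⟨C, hC, hZC, hCm, hlt⟩ := hns
      have h1 := hgap.delta_le hC hZC hCm hlt
      have h2 := (hX C hC).2 C Set.inter_subset_left subset_rfl
      refine ⟨C ∩ X, hC.subset Set.inter_subset_left, hAZ.trans (Set.subset_inter hZC hZX),
        Set.inter_subset_right, ?_⟩
      push_cast
      linarith
  obtain ⟨j, hj⟩ := exists_nat_gt (delta α A / ε)
  rw [div_lt_iff₀ hε] at hj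
  obtain ⟨Z, hZ, -, -, hδ⟩ := key j
  have := hM.2 Z hZ
  linarith

omit [L.IsRelational] in
/-- Over a closed set `X`, every point `a` lies in a finite `m`-strong set `B` which meets `X` in
an `m'`-strong set, where `m'` may depend on the size of `B \ X`. One takes `B` of almost minimal
rank over `B ∩ X` and enlarges `B ∩ X`. -/
theorem exists_mStrong_over_closed [Nonempty (Σ n, L.Relations n)] (hα : ∀ E, 0 < α E) (m : ℕ)
    (M₁ : ℕ → ℕ) (hM₁ : ∀ k, m ≤ M₁ k)
    (hM : InKbar α M) {X : Set M} (hX : ∀ B : Set M, B.Finite → StrongIn α (B ∩ X) B)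
    {A : Set M} (hA : A.Finite) (hAX : A ⊆ X) (a : M) :
    ∃ B : Set M, B.Finite ∧ A ⊆ B ∩ X ∧ a ∈ B ∧ MStrong α m B ∧
      MStrong α (M₁ (B \ X).ncard) (B ∩ X) := by
  obtain ⟨ε, hε, -, hgap⟩ := exists_gap hα m
  have hα0 : ∀ E, 0 ≤ α E := fun E => (hα E).le
  let R : Set ℝ := {r | ∃ B : Set M, B.Finite ∧ a ∈ B ∧ r = delta α B - delta α (B ∩ X)}
  have hR : R.Nonempty := ⟨_, {a}, Set.finite_singleton a, rfl, rfl⟩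
  have hRb : BddBelow R := by
    refine ⟨0, ?_⟩
    rintro _ ⟨B, hB, -, rfl⟩
    have := (hX B hB).2 B Set.inter_subset_left subset_rfl
    linarith
  obtain ⟨_, ⟨B, hB, haB, rfl⟩, hlt⟩ := exists_lt_of_csInf_lt hR (lt_add_of_pos_right (sInf R) hε)
  obtain ⟨P, hP, hAP, hPX, hPs⟩ := exists_mStrong_of_closed hα (M₁ (B \ X).ncard) hM hX
    ((hB.subset Set.inter_subset_left).union hA) (Set.union_subset Set.inter_subset_right hAX)
  have hBXP : B ∩ X ⊆ P := Set.subset_union_left.trans hAP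
  have hBPX : (B ∪ P) ∩ X = P := by
    rw [Set.union_inter_distrib_right, Set.inter_eq_left.2 hPX, Set.union_eq_right.2 hBXP]
  have hBP : B ∩ P = B ∩ X :=
    (Set.inter_subset_inter_right B hPX).antisymm (Set.subset_inter Set.inter_subset_left hBXP)
  have hdiff : (B ∪ P) \ X = B \ X := by
    rw [Set.union_sdiff_distrib, Set.sdiff_eq_empty.2 hPX, Set.union_empty]
  have hBPfin : (B ∪ P).Finite := hB.union hP
  refine ⟨B ∪ P, hBPfin, ?_, Or.inl haB, fun C hC hBC hCm => ?_, by rwa [hBPX, hdiff]⟩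
  · rw [hBPX]
    exact Set.subset_union_right.trans hAP
  · by_contra! hlt'
    have h1 := hgap.delta_le hC hBC hCm hlt'
    have h2 := delta_union_add_inter_le hα0 hB hP
    rw [hBP] at h2
    have h3 : delta α P ≤ delta α (C ∩ X) := by
      refine hPs (C ∩ X) (hC.subset Set.inter_subset_left)
        (Set.subset_inter (Set.subset_union_right.trans hBC) hPX) (le_trans ?_ (hCm.trans (hM₁ _)))
      refine Set.ncard_le_ncard (fun x hx => ⟨hx.1.1, fun hxB => hx.2 ?_⟩) hC.sdiff
      rw [← hBPX]
      exact ⟨hxB, hx.1.2⟩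
    have h4 := csInf_le hRb ⟨C, hC, hBC (Or.inl haB), rfl⟩
    linarith

/-- In a model of `S_α`, a point outside a closed set `X` has infinitely many conjugates over any
finite subset of `X`: the set `B` given by `exists_mStrong_over_closed` has copies over `B ∩ X`
that are free from any given finite set `Q`. -/
theorem isAlgClosedSet_of_closed [Nonempty (Σ n, L.Relations n)]
    (har : ∀ E : Σ n, L.Relations n, 2 ≤ E.1) (hα : ∀ E, 0 < α E ∧ α E ≤ 1)
    (hM : M ⊨ theoryS (L := L) α) {X : Set M}
    (hX : ∀ B : Set M, B.Finite → StrongIn α (B ∩ X) B) : IsAlgClosedSet L X := by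
  intro S hS hSfin a haS
  by_contra haX
  have hα0 : ∀ E, 0 ≤ α E := fun E => (hα E).1.le
  have hMK := inKbar_of_models hM
  have hne : Nonempty M := ⟨a⟩
  obtain ⟨A₀, hA₀X, hS'⟩ := Set.definable_iff_finitely_definable.1 hS
  obtain ⟨φ, hφ⟩ := Set.definable_iff_exists_formula_sum.1 hS'
  obtain ⟨m, hm⟩ := realize_iff_of_mStrong.{u, v, w, w} har hα φ
  choose M₁ hM₁ hext using fun k => exists_extension_mStrong.{u, v, w, w} har hα k m
  obtain ⟨B, hB, hAB, haB, hBs, hPs⟩ := exists_mStrong_over_closed (fun E => (hα E).1) m M₁ hM₁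
    hMK hX A₀.finite_toSet hA₀X a
  set P : Set M := B ∩ X with hP
  have hPfin : P.Finite := hB.subset Set.inter_subset_left
  have hPB : P ⊆ B := Set.inter_subset_left
  have haP : a ∉ P := fun h => haX h.2
  obtain ⟨Q, hQ, hPQ, -, hQs⟩ := exists_mStrong_of_closed (fun E => (hα E).1)
    (M₁ (B \ X).ncard) hMK (X := Set.univ) (fun B _ => by rw [Set.inter_univ]; exact .refl B)
    (hPfin.union hSfin) (Set.subset_univ _)
  have hPQ' : P ⊆ Q := Set.subset_union_left.trans hPQ
  obtain ⟨SD, i, j, h⟩ := exists_isFreeAmalgam hMK.1 hMK.1 (PEmb.id (L := L) P)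
  have hji : ∀ p ∈ P, j p = i p := h.eqOn
  set D : Set (M ⊕ M) := i '' Q ∪ j '' B with hD
  have hDfin : D.Finite := (hQ.image i).union (hB.image j)
  have hQD : i '' Q ⊆ D := Set.subset_union_left
  have hBD : j '' B ⊆ D := Set.subset_union_right
  have hl : ∀ G ⊆ D, i ⁻¹' G ⊆ Q := fun G hG => h.preimage_left_subset (fun p hp => hPQ' hp) hG
  have hr : ∀ G ⊆ D, j ⁻¹' G ⊆ B := fun G hG => h.preimage_right_subset hPB hG
  have hδi : ∀ Y : Set M, delta α (i '' Y) = delta α Y := fun Y =>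
    delta_image (h.left.mono (Set.subset_univ Y))
  have hδ : ∀ G ⊆ D, P ⊆ j ⁻¹' G →
      delta α G = delta α (i ⁻¹' G) + delta α (j ⁻¹' G) - delta α P := fun G hG hPG => by
    rw [h.delta_eq_of_subset hQ hB hG, Set.inter_eq_right.2 hPG]
  have hQDs : StrongIn α (i '' Q) D :=
    h.strongIn_left hQ hB (fun p hp => hPQ' hp) (hX B hB)
  have hDK : ∀ Y ⊆ D, 0 ≤ delta α Y := by
    refine hQDs.delta_nonneg hα0 hDfin fun Y hY => ?_
    obtain ⟨Y', hY', rfl⟩ := Set.subset_image_iff.1 hY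
    rw [hδi]
    exact hMK.2 Y' (hQ.subset hY')
  have hinv := Function.leftInverse_invFun h.left_injective
  have himg : Function.invFun i '' (i '' Q) = Q := (hinv.leftInvOn Q).image_image
  obtain ⟨g, hg, hgi, hgs⟩ := hext (B \ X).ncard (M ⊕ M) M hM h.hypergraph (i '' Q) D hDfin hDK
    hQDs (by
      refine (Set.ncard_le_ncard (t := j '' (B \ X)) ?_ (hB.sdiff.image j)).trans
        (Set.ncard_image_le hB.sdiff)
      rintro z ⟨hz | ⟨y, hy, rfl⟩, hzQ⟩
      · exact absurd hz hzQ
      · exact ⟨y, ⟨hy, fun hyX => hzQ ⟨y, hPQ' ⟨hy, hyX⟩, (hji y ⟨hy, hyX⟩).symm⟩⟩, rfl⟩)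
    (Function.invFun i) ((h.left.mono (Set.subset_univ Q)).leftInv (hinv.leftInvOn Q))
    (by rwa [himg])
  have hgQ : ∀ q ∈ Q, g (i q) = q := fun q hq => (hgi ⟨q, hq, rfl⟩).trans (hinv q)
  have hgj : PEmb L (g ∘ j) B := (hg.mono hBD).comp (h.right.mono (Set.subset_univ B))
  have hgP : ∀ p ∈ P, g (j p) = p := fun p hp => by rw [hji p hp, hgQ p (hPQ' hp)]
  have hfree : ∀ x ∈ Q, ∀ y ∈ B, x = g (j y) → y ∈ P := fun x hx y hy he => by
    refine (h.mem_of_eq x y (hg.1 (hQD ⟨x, hx, rfl⟩) (hBD ⟨y, hy, rfl⟩) ?_)).1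
    rw [hgQ x hx, he]
  have hBs' : MStrong α m ((g ∘ j) '' B) := by
    intro C hC hBC hCm
    rw [Set.image_comp] at hBC hCm ⊢
    have h1 := hgs (C ∪ g '' D) (hC.union (hDfin.image g)) Set.subset_union_right
      (le_trans (Set.ncard_le_ncard (fun x hx => ?_) hC.sdiff) hCm)
    swap
    · rcases hx with ⟨hx | hx, hxD⟩
      · exact ⟨hx, fun hxB => hxD (Set.image_mono hBD hxB)⟩
      · exact absurd hx hxD
    have h2 := delta_union_add_inter_le hα0 hC (hDfin.image g)
    set G : Set (M ⊕ M) := D ∩ g ⁻¹' C with hG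
    have hGD : G ⊆ D := Set.inter_subset_left
    have hBG : j '' B ⊆ G := Set.subset_inter hBD (Set.image_subset_iff.1 hBC)
    have hPG : P ⊆ j ⁻¹' G := hPB.trans (Set.image_subset_iff.1 hBG)
    have hGC : g '' G = C ∩ g '' D := by
      rw [hG, Set.image_inter_preimage, Set.inter_comm]
    have hPiG : P ⊆ i ⁻¹' G := fun p hp => by
      rw [Set.mem_preimage, ← hji p hp]
      exact hPG hp
    have h3 : delta α P ≤ delta α (i ⁻¹' G) := by
      refine hPs _ (hQ.subset (hl G hGD)) hPiG
        (le_trans (Set.ncard_le_ncard (fun x hx => ?_) hC.sdiff) (hCm.trans (hM₁ _)))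
      have hxQ := hl G hGD hx.1
      refine ⟨hgQ x hxQ ▸ hx.1.2, ?_⟩
      rintro ⟨_, ⟨y, hy, rfl⟩, hyx⟩
      have hyP := hfree x hxQ y hy hyx.symm
      rw [hgP y hyP] at hyx
      exact hx.2 (hyx ▸ hyP)
    rw [← hGC, delta_image (hg.mono hGD), hδ G hGD hPG,
      (hr G hGD).antisymm (Set.image_subset_iff.1 hBG)] at h2
    rw [delta_image (hg.mono hBD), delta_image (h.right.mono (Set.subset_univ B))]
    linarith
  have hiff := hm M M hM hM hne B hB (g ∘ j) hgj hBs hBs'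
    (Sum.elim (fun x : (A₀ : Set M) => (x : M)) fun _ : Fin 1 => a) default
    (fun b => by
      rcases b with b | b
      · exact (hAB b.2).1
      · exact haB) (fun i => i.elim0)
  have hmem : ∀ x : M, x ∈ S ↔ φ.Realize (Sum.elim (fun x : (A₀ : Set M) => (x : M))
      fun _ : Fin 1 => x) := fun x => Set.ext_iff.1 hφ fun _ => x
  have hcomp : (g ∘ j) ∘ (Sum.elim (fun x : (A₀ : Set M) => (x : M)) fun _ : Fin 1 => a) =
      Sum.elim (fun x : (A₀ : Set M) => (x : M)) fun _ : Fin 1 => g (j a) := by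
    funext b
    rcases b with b | b
    · exact hgP b (hAB b.2)
    · rfl
  have haS' : g (j a) ∈ S := by
    rw [hmem]
    rw [hmem] at haS
    rw [hcomp] at hiff
    unfold Language.Formula.Realize at haS ⊢
    rw [Subsingleton.elim ((g ∘ j) ∘ (default : Fin 0 → M)) default] at hiff
    exact hiff.1 haS
  exact haP (hfree _ (hPQ (Or.inr haS')) a haB rfl)

end AlgebraicClosure

/-! ### Generic structures are models -/

section Generic

variable {L : FirstOrder.Language.{u, v}} [Fintype (Σ n, L.Relations n)] [L.IsRelational]
  {α : (Σ n, L.Relations n) → ℝ}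

/-- A partial embedding defined everywhere, as an embedding of structures. -/
def PEmb.toEmbedding {M : Type w} [L.Structure M] {N : Type w'} [L.Structure N] {f : M → N}
    (h : PEmb L f Set.univ) : M ↪[L] N where
  toFun := f
  inj' := fun _ _ hxy => h.1 trivial trivial hxy
  map_fun' := fun F => isEmptyElim F
  map_rel' := fun R x => h.2 _ R x fun _ => trivial

omit [L.IsRelational] in
theorem Strong.of_chain {M : Type w} [L.Structure M] (hα : ∀ E, 0 ≤ α E) {A : ℕ → Set M}
    (hfin : ∀ i, (A i).Finite) (hs : ∀ i, StrongIn α (A i) (A (i + 1)))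
    (hU : ⋃ i, A i = Set.univ) (i : ℕ) : Strong α (A i) := by
  have hle : ∀ k, StrongIn α (A i) (A (i + k)) := by
    intro k
    induction k with
    | zero => exact .refl _
    | succ k ih => exact ih.trans hα (hs (i + k)) (hfin _)
  have hmono : Monotone A := monotone_nat_of_le_succ fun n => (hs n).1
  intro B hB hAB
  obtain ⟨k, hk⟩ : ∃ k, B ⊆ A k :=
    hmono.directed_le.exists_mem_subset_of_finset_subset_biUnion (s := hB.toFinset) (by simp [hU])
      |>.imp fun k hk => by simpa using hk
  exact (hle k).mono hAB (hk.trans (hmono (Nat.le_add_left k i)))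

omit [L.IsRelational] in
theorem Strong.trans {M : Type w} [L.Structure M] (hα : ∀ E, 0 ≤ α E) {A B : Set M}
    (hAB : StrongIn α A B) (hB : Strong α B) (hBfin : B.Finite) : Strong α A := fun C hC hAC =>
  (hAB.trans hα (hB (B ∪ C) (hBfin.union hC) Set.subset_union_left) (hBfin.union hC)).mono hAC
    Set.subset_union_right

/-- The extension property of a generic structure, for finite subsets of arbitrary hypergraphs. -/
theorem IsGeneric.exists_strong_extension {M : Type w} [L.Structure M] (hM : IsGeneric α M)
    {D : Type w'} [L.Structure D] (hD : IsHypergraph L D) {A B : Set D} (hB : B.Finite)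
    (hK : ∀ X ⊆ B, 0 ≤ delta α X) (hAB : StrongIn α A B) {f : D → M} (hf : PEmb L f A)
    (hfA : Strong α (f '' A)) : ∃ g : D → M, PEmb L g B ∧ Set.EqOn g f A ∧ Strong α (g '' B) := by
  classical
  obtain ⟨n, S, h, hh, hr⟩ := exists_fin_pemb (L := L) hB
  let A' : L.Substructure (Fin n) := ⟨h ⁻¹' A, fun f => isEmptyElim f⟩
  have hBi : h '' Set.univ = B := by rw [Set.image_univ, hr]
  have hAi : h '' (A' : Set (Fin n)) = A := by
    change h '' (h ⁻¹' A) = A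
    rw [Set.image_preimage_eq_iff, hr]
    exact hAB.1
  have hst : StrongIn α (A' : Set (Fin n)) Set.univ := by
    refine ⟨Set.subset_univ _, fun C hC _ => ?_⟩
    rw [← delta_image (hh.mono (Set.subset_univ (A' : Set (Fin n)))),
      ← delta_image (hh.mono (Set.subset_univ C)), hAi]
    exact hAB.2 _ (hAi ▸ Set.image_mono hC) (hBi ▸ Set.image_mono (Set.subset_univ C))
  have hf' : PEmb L (fun a : A' => f (h a)) Set.univ :=
    ⟨fun a _ b _ hab => Subtype.ext (hh.1 trivial trivial (hf.1 a.2 b.2 hab)), fun k E x _ =>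
      (hf.2 k E (fun i => h (x i)) fun i => (x i).2).trans
        (hh.2 k E (fun i => (x i : Fin n)) fun _ => trivial)⟩
  obtain ⟨g, hg, hgf⟩ := hM.2.2.2 (Fin n) A' (InK.of_pemb hh hD (hr ▸ hK)) hst hf'.toEmbedding (by
    have : Set.range hf'.toEmbedding = f '' A := by
      rw [← hAi]
      ext y
      constructor
      · rintro ⟨a, rfl⟩
        exact ⟨h a, ⟨a, a.2, rfl⟩, rfl⟩
      · rintro ⟨_, ⟨a, ha, rfl⟩, rfl⟩
        exact ⟨⟨a, ha⟩, rfl⟩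
    rwa [this])
  have hinv : ∀ x ∈ B, ∃ y, h y = x := fun x hx => by
    rw [← hr] at hx
    exact hx
  let r : D → M := fun x => if hx : x ∈ B then g (hinv x hx).choose else f x
  have hrh : ∀ y, r (h y) = g y := fun y => by
    have hy : h y ∈ B := hr ▸ ⟨y, rfl⟩
    simp only [r, hy, dif_pos]
    rw [hh.1 trivial trivial (hinv _ hy).choose_spec]
  refine ⟨r, ?_, fun a ha => ?_, ?_⟩
  · rw [← hBi]
    exact hh.of_comp ((PEmb.of_embedding g Set.univ).congr fun y _ => (hrh y).symm)
  · rw [← hAi] at ha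
    obtain ⟨y, hy, rfl⟩ := ha
    rw [hrh]
    exact hgf ⟨y, hy⟩
  · rw [← hBi, ← Set.image_comp, show r ∘ h = g from funext hrh, Set.image_univ]
    exact hg

/-- Generic structures are models of `S_α`. -/
theorem IsGeneric.models (har : ∀ E : Σ n, L.Relations n, 2 ≤ E.1) (hα : ∀ E, 0 ≤ α E)
    {M : Type w} [L.Structure M] (hM : IsGeneric α M) : Nonempty M ∧ M ⊨ theoryS (L := L) α := by
  obtain ⟨A, hAfin, hAs, hAU⟩ := hM.2.2.1
  have hAst := Strong.of_chain hα hAfin hAs hAU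
  have hmono : Monotone A := monotone_nat_of_le_succ fun n => (hAs n).1
  have hne : Nonempty M := by
    -- otherwise the one-point structure embeds over the empty set
    by_contra hne
    rw [not_nonempty_iff] at hne
    let S : L.Structure Unit := mkStr fun _ _ => False
    have hS : IsHypergraph L Unit := fun _ _ _ h => h.elim
    have h1 : delta α ({()} : Set Unit) = 1 := hS.delta_singleton har ()
    have hnn : ∀ X : Set Unit, 0 ≤ delta α X := fun X => by
      rcases X.eq_empty_or_nonempty with rfl | ⟨⟨⟩, hx⟩
      · rw [delta_empty har]
      · rw [show X = {()} from Set.ext fun y => ⟨fun _ => rfl, fun _ => hx⟩, h1]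
        exact zero_le_one
    have hB : InK α Unit := ⟨inferInstance, hS, fun X _ => hnn X⟩
    have hA0 : ((⟨∅, fun f => isEmptyElim f⟩ : L.Substructure Unit) : Set Unit) = ∅ := rfl
    have hf : PEmb L (fun a : (⟨∅, fun f => isEmptyElim f⟩ : L.Substructure Unit) =>
        (a.2.elim : M)) Set.univ :=
      ⟨fun a => a.2.elim, fun n E x _ =>
        (x ⟨0, by have := har ⟨n, E⟩; simp only at this; omega⟩).2.elim⟩
    obtain ⟨g, -, -⟩ := hM.2.2.2 Unit ⟨∅, fun f => isEmptyElim f⟩ hB (by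
      rw [hA0]
      refine ⟨Set.subset_univ _, fun C _ _ => ?_⟩
      rw [delta_empty har]
      exact hnn C) hf.toEmbedding (by
      intro C hC hAC
      have : C = ∅ := Set.eq_empty_of_isEmpty C
      subst this
      rw [Set.subset_empty_iff.1 hAC]
      exact .refl ∅)
    exact hne.elim (g ())
  -- to extend `f : B → M`, the structure `S` is amalgamated with a member `A k` of the chain
  -- containing the image of `f`, and the amalgam, in which `A k` is strong, is embedded over `A k`
  refine ⟨hne, models_theoryS hM.2.1 (fun n S B hK hB f hf => ?_) hne⟩
  obtain ⟨k, hk⟩ : ∃ k, f '' B ⊆ A k :=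
    hmono.directed_le.exists_mem_subset_of_finset_subset_biUnion
      (s := (B.toFinite.image f).toFinset) (by simp [hAU])
      |>.imp fun k hk => by simpa using hk
  obtain ⟨SD, i, j, h⟩ := exists_isFreeAmalgam hM.2.1.1 hK.2.1 hf
  have hQD := h.strongIn_left (α := α) (hAfin k) Set.finite_univ (fun b hb => hk ⟨b, hb, rfl⟩) hB
  have hDfin : (i '' A k ∪ j '' Set.univ).Finite :=
    ((hAfin k).image i).union (Set.finite_univ.image j)
  have hinv := Function.leftInverse_invFun h.left_injective
  obtain ⟨g, hg, hgi, -⟩ := hM.exists_strong_extension h.hypergraph hDfin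
    (hQD.delta_nonneg hα hDfin fun Y hY => by
      obtain ⟨Y', hY', rfl⟩ := Set.subset_image_iff.1 hY
      rw [delta_image (h.left.mono (Set.subset_univ _))]
      exact hM.2.1.2 Y' ((hAfin k).subset hY')) hQD
    ((h.left.mono (Set.subset_univ (A k))).leftInv (hinv.leftInvOn (A k)))
    (by rw [(hinv.leftInvOn (A k)).image_image]; exact hAst k)
  refine ⟨g ∘ j, (hg.mono Set.subset_union_right).comp h.right, fun b hb => ?_⟩
  rw [Function.comp_apply, h.eqOn b hb, hgi ⟨f b, hk ⟨b, hb, rfl⟩, rfl⟩, hinv]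

end Generic

/-! ### Existence of a generic structure -/

section Agree

variable {L : FirstOrder.Language.{u, v}} {X : Type w} {S T : L.Structure X} {A B : Set X}

/-- Two structures on the same set induce the same substructure on `B`. -/
def AgreeOn (S T : L.Structure X) (B : Set X) : Prop :=
  ∀ (n : ℕ) (E : L.Relations n) (x : Fin n → X), (∀ i, x i ∈ B) →
    (S.RelMap E x ↔ T.RelMap E x)

theorem AgreeOn.symm (h : AgreeOn S T B) : AgreeOn T S B := fun n E x hx => (h n E x hx).symm

theorem AgreeOn.pemb_id (h : AgreeOn S T B) : @PEmb L X S X T id B :=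
  ⟨Function.injective_id.injOn, fun n E x hx => (h n E x hx).symm⟩

theorem AgreeOn.pemb {Y : Type w'} [L.Structure Y] {D : Set Y} {f : Y → X} (h : AgreeOn S T B)
    (hf : @PEmb L Y _ X S f D) (hfB : f '' D ⊆ B) : @PEmb L Y _ X T f D :=
  ⟨hf.1, fun n E x hx =>
    (h n E (f ∘ x) fun i => hfB ⟨x i, hx i, rfl⟩).symm.trans (hf.2 n E x hx)⟩

variable [Fintype (Σ n, L.Relations n)] {α : (Σ n, L.Relations n) → ℝ}

theorem AgreeOn.delta_eq (h : AgreeOn S T B) (hA : A ⊆ B) :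
    @delta L X S _ α A = @delta L X T _ α A := by
  have := @delta_image L X S X T _ α id A (@PEmb.mono L X S X T id A B h.pemb_id hA)
  rw [Set.image_id] at this
  exact this.symm

theorem AgreeOn.strongIn (h : AgreeOn S T B) (hA : @StrongIn L X S _ α A B) :
    @StrongIn L X T _ α A B :=
  ⟨hA.1, fun C hAC hCB => by
    rw [← h.delta_eq hA.1, ← h.delta_eq hCB]
    exact hA.2 C hAC hCB⟩

end Agree

section Existence

variable {L : FirstOrder.Language.{u, v}} [Fintype (Σ n, L.Relations n)]

/-- The forcing conditions for a generic structure on `ℕ`: finite structures in `K_α` whose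
universe `s` is a set of natural numbers. The points outside `s` lie on no edge. -/
structure Condition (α : (Σ n, L.Relations n) → ℝ) where
  [str : L.Structure ℕ]
  s : Set ℕ
  finite : s.Finite
  hypergraph : IsHypergraph L ℕ
  supp : ∀ (n : ℕ) (E : L.Relations n) (x : Fin n → ℕ), RelMap E x → ∀ i, x i ∈ s
  nonneg : ∀ X ⊆ s, 0 ≤ delta α X

variable {α : (Σ n, L.Relations n) → ℝ}

namespace Condition

/-- A condition is stronger when it is a strong extension. -/
def Le (p q : Condition α) : Prop :=
  AgreeOn p.str q.str p.s ∧ @StrongIn L ℕ q.str _ α p.s q.s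

theorem Le.refl (p : Condition α) : Le p p :=
  ⟨fun _ _ _ _ => Iff.rfl, @StrongIn.refl L ℕ p.str _ α p.s⟩

theorem Le.trans (hα : ∀ E, 0 ≤ α E) {p q r : Condition α} (hpq : Le p q) (hqr : Le q r) :
    Le p r :=
  ⟨fun n E x hx => (hpq.1 n E x hx).trans (hqr.1 n E x fun i => hpq.2.1 (hx i)),
    @StrongIn.trans L ℕ r.str _ α hα _ _ _ (hqr.1.strongIn hpq.2) hqr.2 r.finite⟩

/-- The empty structure. -/
theorem nonempty [L.IsRelational] (har : ∀ E : Σ n, L.Relations n, 2 ≤ E.1) :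
    Nonempty (Condition α) := by
  let S : L.Structure ℕ := mkStr fun _ _ => False
  exact ⟨{ s := ∅
           finite := Set.finite_empty
           hypergraph := fun _ _ _ h => False.elim h
           supp := fun _ _ _ h => False.elim h
           nonneg := fun X hX => by rw [Set.subset_empty_iff.1 hX, delta_empty har] }⟩

/-- A finite structure in `K_α` is isomorphic to a condition on any set of numbers of the right
size. -/
theorem exists_of_injOn [L.IsRelational] {N : Type w} [L.Structure N] (hN : IsHypergraph L N)
    {D : Set N} (hD : D.Finite) (hK : ∀ X ⊆ D, 0 ≤ delta α X) {e : N → ℕ} (he : Set.InjOn e D) :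
    ∃ q : Condition α, q.s = e '' D ∧ @PEmb L N _ ℕ q.str e D := by
  let S : L.Structure ℕ := mkStr fun E x => ∃ y, (∀ k, y k ∈ D) ∧ x = e ∘ y ∧ RelMap E.2 y
  have hrel : ∀ (n : ℕ) (E : L.Relations n) (x : Fin n → ℕ), RelMap E x ↔
    ∃ y, (∀ k, y k ∈ D) ∧ x = e ∘ y ∧ RelMap E y := fun _ _ _ => Iff.rfl
  have hp : PEmb L e D := by
    refine ⟨he, fun n E x hx => ?_⟩
    rw [hrel]
    constructor
    · rintro ⟨y, hy, hxy, h⟩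
      rwa [show x = y from funext fun k => he (hx k) (hy k) (congrFun hxy k)]
    · exact fun h => ⟨x, hx, rfl, h⟩
  refine ⟨{ s := e '' D, finite := hD.image e, hypergraph := ?_, supp := ?_, nonneg := ?_ },
    rfl, hp⟩
  · rintro n E _ ⟨y, hy, rfl, h⟩
    obtain ⟨h1, h2⟩ := hN n E y h
    exact ⟨fun k l hkl => h1 (he (hy k) (hy l) hkl), fun π =>
      ⟨y ∘ π, fun k => hy (π k), rfl, h2 π⟩⟩
  · rintro n E _ ⟨y, hy, rfl, h⟩ k
    exact ⟨y k, hy k, rfl⟩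
  · intro X hX
    obtain ⟨X', hX', rfl⟩ := Set.subset_image_iff.1 hX
    rw [delta_image (hp.mono hX')]
    exact hK X' hX'

theorem delta_inter_le (p : Condition α) {X : Set ℕ} (hX : X.Finite) :
    @delta L ℕ p.str _ α (X ∩ p.s) ≤ @delta L ℕ p.str _ α X := by
  let _ := p.str
  have he : ∀ E : Σ n, L.Relations n, edges E (X ∩ p.s) = edges E X := fun E =>
    (edges_mono E Set.inter_subset_left).antisymm fun t ht => by
      obtain ⟨ht, x, hx, rfl⟩ := ht
      refine ⟨Set.subset_inter ht ?_, x, hx, rfl⟩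
      rintro _ ⟨k, rfl⟩
      exact p.supp _ _ _ hx k
  unfold delta
  simp only [he]
  have := Set.ncard_le_ncard (Set.inter_subset_left (s := X) (t := p.s)) hX
  have : ((X ∩ p.s).ncard : ℝ) ≤ X.ncard := by exact_mod_cast this
  linarith

/-- Isolated points may be added to a condition. -/
theorem exists_le_union (p : Condition α) {X : Set ℕ} (hX : X.Finite) :
    ∃ q : Condition α, Le p q ∧ X ⊆ q.s := by
  let _ := p.str
  refine ⟨{ s := p.s ∪ X, finite := p.finite.union hX, hypergraph := p.hypergraph,
            supp := fun n E x hx i => Or.inl (p.supp n E x hx i), nonneg := fun Y hY => ?_ },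
    ⟨fun _ _ _ _ => Iff.rfl, Set.subset_union_left, fun C hC hC' => ?_⟩, Set.subset_union_right⟩
  · exact (p.nonneg _ Set.inter_subset_right).trans
      (p.delta_inter_le ((p.finite.union hX).subset hY))
  · have := p.delta_inter_le ((p.finite.union hX).subset hC')
    rwa [Set.inter_eq_right.2 hC] at this

/-- One step of the construction: `B` is amalgamated freely with `p` over `A`. -/
theorem exists_le_extension [L.IsRelational] (hα : ∀ E, 0 ≤ α E) (p : Condition α) {N : Type}
    [L.Structure N] (hN : IsHypergraph L N) {A B : Set N} (hB : B.Finite) (hAB : StrongIn α A B)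
    {f : N → ℕ} (hf : @PEmb L N _ ℕ p.str f A) (hfA : @StrongIn L ℕ p.str _ α (f '' A) p.s) :
    ∃ q : Condition α, Le p q ∧ ∃ g : N → ℕ, @PEmb L N _ ℕ q.str g B ∧ Set.EqOn g f A ∧
      @StrongIn L ℕ q.str _ α (g '' B) q.s := by
  classical
  let _ := p.str
  obtain ⟨S, i, j, h⟩ := exists_isFreeAmalgam p.hypergraph hN hf
  have hD : (i '' p.s ∪ j '' B).Finite := (p.finite.image i).union (hB.image j)
  have hl := h.strongIn_left (α := α) p.finite hB (fun a ha => hfA.1 ⟨a, ha, rfl⟩) hAB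
  have hr := h.strongIn_right (α := α) p.finite hB hf hAB.1 hfA
  obtain ⟨m, hm⟩ := p.finite.bddAbove
  obtain ⟨c, hc⟩ := Set.countable_iff_exists_injOn.1 hD.countable
  have hinv := Function.leftInverse_invFun h.left_injective
  -- the new points are sent above all elements of `p.s`
  let e : ℕ ⊕ N → ℕ := fun y => if y ∈ i '' p.s then Function.invFun i y else m + 1 + c y
  have hei : ∀ x ∈ p.s, e (i x) = x := fun x hx => by
    have : i x ∈ i '' p.s := ⟨x, hx, rfl⟩
    simp only [e, this, if_true]
    exact hinv x
  have he' : ∀ y, y ∉ i '' p.s → e y = m + 1 + c y := fun y hy => if_neg hy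
  have he : Set.InjOn e (i '' p.s ∪ j '' B) := by
    intro x hx y hy hxy
    by_cases hx' : x ∈ i '' p.s <;> by_cases hy' : y ∈ i '' p.s
    · obtain ⟨a, ha, rfl⟩ := hx'
      obtain ⟨b, hb, rfl⟩ := hy'
      rw [hei a ha, hei b hb] at hxy
      rw [hxy]
    · obtain ⟨a, ha, rfl⟩ := hx'
      rw [hei a ha, he' y hy'] at hxy
      have := hm ha
      omega
    · obtain ⟨b, hb, rfl⟩ := hy'
      rw [hei b hb, he' x hx'] at hxy
      have := hm hb
      omega
    · rw [he' x hx', he' y hy'] at hxy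
      exact hc hx hy (by omega)
  obtain ⟨q, hqs, hq⟩ := exists_of_injOn (α := α) h.hypergraph hD
    (hl.delta_nonneg hα hD fun Y hY => by
      obtain ⟨Y', hY', rfl⟩ := Set.subset_image_iff.1 hY
      rw [delta_image (h.left.mono (Set.subset_univ _))]
      exact p.nonneg Y' hY') he
  have himg : e '' (i '' p.s) = p.s := by
    rw [Set.image_image]
    exact (Set.image_congr hei).trans (Set.image_id' _)
  refine ⟨q, ⟨fun n E x hx => ?_, ?_⟩, e ∘ j, ?_, fun a ha => ?_, ?_⟩
  · have h1 := hq.2 n E (i ∘ x) fun k => Or.inl ⟨x k, hx k, rfl⟩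
    rw [show e ∘ i ∘ x = x from funext fun k => hei _ (hx k)] at h1
    exact (h.left.2 n E x fun _ => trivial).symm.trans h1.symm
  · have := @StrongIn.image _ _ _ _ q.str _ _ _ _ _ hl hq
    rwa [himg, ← hqs] at this
  · exact @PEmb.comp _ _ _ _ _ _ q.str _ _ _ (@PEmb.mono _ _ _ _ q.str _ _ _ hq
      Set.subset_union_right) (h.right.mono (Set.subset_univ B))
  · rw [Function.comp_apply, h.eqOn a ha]
    exact hei _ (hfA.1 ⟨a, ha, rfl⟩)
  · have := @StrongIn.image _ _ _ _ q.str _ _ _ _ _ hr hq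
    rwa [← hqs, Set.image_image] at this

end Condition

variable [L.IsRelational]

/-- An extension problem for a structure on `ℕ`: to extend the embedding `f` of a substructure of
a finite structure, on the set `A`, to the whole finite structure, which is taken on `Fin k`. -/
structure ExtensionProblem (L : FirstOrder.Language.{u, v}) where
  k : ℕ
  [str : L.Structure (Fin k)]
  A : Set (Fin k)
  f : Fin k → ℕ

instance : Countable (ExtensionProblem L) := by
  have hstr : ∀ k, Function.Injective fun (S : L.Structure (Fin k))
      (E : Σ n, L.Relations n) (x : Fin E.1 → Fin k) => S.RelMap E.2 x := fun k S T h =>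
    Language.Structure.ext (funext fun n => funext fun F => isEmptyElim F)
      (funext fun n => funext fun E => congrFun h ⟨n, E⟩)
  have (k : ℕ) : Countable (L.Structure (Fin k)) := (hstr k).countable
  have : Function.Injective fun t : ExtensionProblem L =>
      (⟨t.k, t.str, t.A, t.f⟩ : Σ k : ℕ, L.Structure (Fin k) × Set (Fin k) × (Fin k → ℕ)) := by
    rintro @⟨k, S, A, f⟩ @⟨k', S', A', f'⟩ h
    simp only [Sigma.mk.injEq] at h
    obtain ⟨rfl, h⟩ := h
    simp only [heq_eq_eq, Prod.mk.injEq] at h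
    obtain ⟨rfl, rfl, rfl⟩ := h
    rfl
  exact this.countable

/-- The condition `p` solves the extension problem `t`, if that problem makes sense in `p`. -/
def Condition.Solves (p : Condition α) (t : ExtensionProblem L) : Prop :=
  letI := p.str
  letI := t.str
  t.f '' t.A ⊆ p.s ∧ (IsHypergraph L (Fin t.k) → StrongIn α t.A Set.univ → PEmb L t.f t.A →
    StrongIn α (t.f '' t.A) p.s →
    ∃ g : Fin t.k → ℕ, PEmb L g Set.univ ∧ Set.EqOn g t.f t.A ∧
      StrongIn α (g '' Set.univ) p.s)

theorem Condition.exists_le_solves (hα : ∀ E, 0 ≤ α E) (p : Condition α)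
    (t : ExtensionProblem L) : ∃ q : Condition α, q.Solves t ∧ p.Le q := by
  obtain ⟨q, hpq, hq⟩ := p.exists_le_union (t.A.toFinite.image t.f)
  by_cases hs : q.Solves t
  · exact ⟨q, hs, hpq⟩
  let _ := t.str
  simp only [Condition.Solves, hq, true_and, Classical.not_imp] at hs
  obtain ⟨h1, h2, h3, h4, -⟩ := hs
  obtain ⟨r, hqr, g, hg, hgf, hgr⟩ := q.exists_le_extension hα h1 Set.finite_univ h2 h3 h4
  exact ⟨r, ⟨hq.trans hqr.2.1, fun _ _ _ _ => ⟨g, hg, hgf, hgr⟩⟩, hpq.trans hα hqr⟩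

/-- An increasing sequence of conditions that solves all extension problems. -/
theorem Condition.exists_seq (har : ∀ E : Σ n, L.Relations n, 2 ≤ E.1) (hα : ∀ E, 0 ≤ α E) :
    ∃ p : ℕ → Condition α, (∀ i j, i ≤ j → (p i).Le (p j)) ∧
      ∀ t : ExtensionProblem L, ∃ i, (p i).Solves t := by
  let _ : Preorder (Condition α) :=
    { le := Condition.Le, le_refl := .refl, le_trans := fun _ _ _ => .trans hα }
  let _ := Encodable.ofCountable (ExtensionProblem L)
  obtain ⟨p₀⟩ := Condition.nonempty (α := α) har
  let 𝒟 : ExtensionProblem L → Order.Cofinal (Condition α) := fun t =>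
    ⟨{p | p.Solves t}, fun p => p.exists_le_solves hα t⟩
  exact ⟨Order.sequenceOfCofinals p₀ 𝒟,
    fun i j hij => Order.sequenceOfCofinals.monotone p₀ 𝒟 hij,
    fun t => ⟨_, Order.sequenceOfCofinals.encode_mem p₀ 𝒟 t⟩⟩

/-- A generic structure for `(K_α, ≤)` exists. -/
theorem exists_isGeneric (har : ∀ E : Σ n, L.Relations n, 2 ≤ E.1) (hα : ∀ E, 0 ≤ α E) :
    ∃ (M : Type) (_ : L.Structure M), IsGeneric α M := by
  obtain ⟨p, hp, hsolve⟩ := Condition.exists_seq (L := L) (α := α) har hα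
  let S : L.Structure ℕ := mkStr fun E x => ∃ i, (p i).str.RelMap E.2 x
  have hrel : ∀ (n : ℕ) (E : L.Relations n) (x : Fin n → ℕ), RelMap E x ↔
    ∃ i, (p i).str.RelMap E x := fun _ _ _ => Iff.rfl
  have hsub : ∀ i j, i ≤ j → (p i).s ⊆ (p j).s := fun i j hij => (hp i j hij).2.1
  have hagree : ∀ i, AgreeOn (p i).str S (p i).s := fun i n E x hx => by
    refine ⟨fun h => ⟨i, h⟩, fun ⟨j, h⟩ => ?_⟩
    have hj := ((hp j _ (le_max_right i j)).1 n E x ((p j).supp n E x h)).1 h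
    exact ((hp i _ (le_max_left i j)).1 n E x hx).2 hj
  have hcover : ∀ n, ∃ i, n ∈ (p i).s := fun n => by
    obtain ⟨i, hi, -⟩ := hsolve
      (@ExtensionProblem.mk L 1 (mkStr fun _ _ => False) Set.univ fun _ => n)
    exact ⟨i, hi ⟨0, trivial, rfl⟩⟩
  have hU : ⋃ i, (p i).s = Set.univ := Set.eq_univ_of_forall fun n => Set.mem_iUnion.2 (hcover n)
  have hchain : ∀ i, StrongIn α (p i).s (p (i + 1)).s := fun i =>
    (hagree (i + 1)).strongIn (hp i _ (Nat.le_succ i)).2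
  have hstrong : ∀ i, Strong α (p i).s :=
    Strong.of_chain hα (fun i => (p i).finite) hchain hU
  have hcoverF : ∀ A : Set ℕ, A.Finite → ∃ i, A ⊆ (p i).s := fun A hA =>
    (monotone_nat_of_le_succ fun i =>
      (hchain i).1).directed_le.exists_mem_subset_of_finset_subset_biUnion (s := hA.toFinset)
      (by simp [hU]) |>.imp fun k hk => by simpa using hk
  refine ⟨ℕ, S, inferInstance, ⟨?_, fun A hA => ?_⟩,
    ⟨fun i => (p i).s, fun i => (p i).finite, hchain, hU⟩, ?_⟩
  · rintro n E x ⟨i, h⟩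
    obtain ⟨h1, h2⟩ := (p i).hypergraph n E x h
    exact ⟨h1, fun π => ⟨i, h2 π⟩⟩
  · obtain ⟨i, hi⟩ := hcoverF A hA
    rw [← (hagree i).delta_eq hi]
    exact (p i).nonneg A hi
  · intro B SB A hK hAB f hf
    -- the problem is moved to a set `Fin k`, and solved at a stage that contains the image of `f`
    have := hK.1
    classical
    obtain ⟨k, T, h, hh, hr⟩ := exists_fin_pemb (L := L) (M := B) Set.finite_univ
    have hhs : Function.Surjective h := Set.range_eq_univ.1 hr
    have hhA : h '' (h ⁻¹' A) = A := Set.image_preimage_eq _ hhs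
    let f' : B → ℕ := fun b => if hb : b ∈ A then f ⟨b, hb⟩ else 0
    have hf' : ∀ a : A, f' a = f a := fun a => by simp [f']
    have hfA : f' '' A = Set.range f := by
      ext y
      constructor
      · rintro ⟨b, hb, rfl⟩
        exact ⟨⟨b, hb⟩, (hf' ⟨b, hb⟩).symm⟩
      · rintro ⟨a, rfl⟩
        exact ⟨a, a.2, hf' a⟩
    have hf'A : PEmb L f' A := by
      refine ⟨fun a ha b hb hab => ?_, fun n E x hx => ?_⟩
      · have : f ⟨a, ha⟩ = f ⟨b, hb⟩ := by rw [← hf', ← hf']; exact hab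
        exact congrArg Subtype.val (f.injective this)
      · have := f.map_rel E fun i => ⟨x i, hx i⟩
        rw [show f' ∘ x = f ∘ fun i => ⟨x i, hx i⟩ from funext fun i => hf' ⟨x i, hx i⟩]
        exact this
    have hfh : (f' ∘ h) '' (h ⁻¹' A) = Set.range f := by rw [Set.image_comp, hhA, hfA]
    obtain ⟨i, hi, hi'⟩ := hsolve ⟨k, h ⁻¹' A, f' ∘ h⟩
    simp only [hfh] at hi hi'
    have hfp : PEmb L (f' ∘ h) (h ⁻¹' A) :=
      (show PEmb L f' (h '' (h ⁻¹' A)) from hhA.symm ▸ hf'A).comp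
        (hh.mono (Set.subset_univ _))
    obtain ⟨g, hg, hgf, hgs⟩ := hi' (hK.2.1.of_pemb hh)
      ⟨Set.subset_univ _, fun C hC _ => by
        rw [← delta_image (hh.mono (Set.subset_univ (h ⁻¹' A))),
          ← delta_image (hh.mono (Set.subset_univ C)), hhA]
        exact hAB.2 _ (hhA.symm.subset.trans (Set.image_mono hC)) (Set.subset_univ _)⟩
      ((hagree i).symm.pemb hfp (hfh.subset.trans hi))
      ((hagree i).symm.strongIn (hf (p i).s (p i).finite hi))
    have hg' := (hagree i).pemb hg hgs.1
    let r := Function.surjInv hhs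
    have hrh : Function.LeftInverse r h := Function.leftInverse_surjInv
      ⟨Set.injOn_univ.1 hh.1, hhs⟩
    have hr' : PEmb L r (h '' Set.univ) := hh.leftInv (hrh.leftInvOn _)
    rw [Set.image_univ, hhs.range_eq] at hr'
    have hgr : PEmb L (g ∘ r) Set.univ := (hg'.mono (Set.subset_univ _)).comp hr'
    refine ⟨hgr.toEmbedding, ?_, fun a => ?_⟩
    · have : Set.range hgr.toEmbedding = g '' Set.univ := by
        change Set.range (g ∘ r) = _
        rw [Set.range_comp, hrh.surjective.range_eq]
      rw [this]
      exact Strong.trans hα ((hagree i).strongIn hgs) (hstrong i) (p i).finite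
    · obtain ⟨y, hy⟩ := hhs a
      change g (r a) = f a
      rw [← hy, hrh, hgf (show h y ∈ A from hy ▸ a.2), Function.comp_apply, hy, hf']

end Existence

/-! ### Consequences of `S_α` -/

section Complete

variable {L : FirstOrder.Language.{u, v}} [Fintype (Σ n, L.Relations n)] [L.IsRelational]
  {α : (Σ n, L.Relations n) → ℝ}

/-- The consequences of `S_α` are the sentences that hold in any one of its models. -/
theorem theoryS_models_iff [Nonempty (Σ n, L.Relations n)]
    (har : ∀ E : Σ n, L.Relations n, 2 ≤ E.1) (hα : ∀ E, 0 < α E ∧ α E ≤ 1) {M : Type w}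
    [L.Structure M] [Nonempty M] [M ⊨ theoryS (L := L) α] (φ : L.Sentence) :
    theoryS α ⊨ᵇ φ ↔ M ⊨ φ :=
  ⟨fun h => h.realize_sentence M, fun h => Language.Theory.models_sentence_iff.2 fun N =>
    (realize_sentence_iff_of_models har hα ‹_› N.is_model φ).1 h⟩

end Complete

end BaldwinShi

end

theorem mainTheorem4 (L : FirstOrder.Language.{u, v}) [L.IsRelational]
    [Fintype (Σ n, L.Relations n)]
    (har : ∀ E : Σ n, L.Relations n, 2 ≤ E.1)
    (α : (Σ n, L.Relations n) → ℝ)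
    (hα : ∀ E, 0 < α E ∧ α E ≤ 1)
    (hα' : (∀ E : Σ n, L.Relations n, E.1 = 2) → ¬ ∀ E, α E = 1) :
    ((theoryS α).IsComplete ∧
      (∃ (M : Type) (_ : L.Structure M), IsGeneric α M) ∧
      ∀ (M : Type w) [L.Structure M], IsGeneric α M →
        ∀ φ : L.Sentence, theoryS α ⊨ᵇ φ ↔ φ ∈ L.completeTheory M) ∧
    ∀ (M : Type w') [L.Structure M], M ⊨ theoryS α → ∀ X : Set M,
      List.TFAE [
        IsAlgClosedSet L X,
        ∀ B C : Set M, B.Finite → C.Finite → MinimalPair α B C → B ⊆ X → C ⊆ X,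
        ∀ B : Set M, B.Finite → StrongIn α (B ∩ X) B] := by
  have hα₀ : ∀ E, 0 ≤ α E := fun E => (hα E).1.le
  have hne : Nonempty (Σ n, L.Relations n) := by
    by_contra h
    rw [not_nonempty_iff] at h
    exact hα' isEmptyElim isEmptyElim
  refine ⟨⟨?_, exists_isGeneric har hα₀, fun M _ hM φ => ?_⟩, fun M _ hM X => ?_⟩
  · obtain ⟨G, _, hG⟩ := exists_isGeneric (α := α) har hα₀
    obtain ⟨_, _⟩ := hG.models har hα₀
    refine ⟨Language.Theory.Model.isSatisfiable G, fun φ => ?_⟩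
    rw [theoryS_models_iff har hα (M := G), theoryS_models_iff har hα (M := G),
      Language.Sentence.realize_not]
    exact em _
  · obtain ⟨_, _⟩ := hM.models har hα₀
    rw [theoryS_models_iff har hα (M := M), Language.mem_completeTheory]
  · tfae_have 1 → 2 := fun hX B C hB hC hBC hBX =>
      hX.minimalPair_closed hα₀ (inKbar_of_models hM) hB hC hBC hBX
    tfae_have 2 ↔ 3 := minimalPair_closed_iff
    tfae_have 3 → 1 := isAlgClosedSet_of_closed har hα hM
    tfae_finish
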